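/- Let $b\in(0,1)$ be irrational, $q=e^{\pi i b^2}$, $Q=b+b^{-1}$, and let $\alpha\in\frac{Q}{2}+i\mathbb R$. Write $(T_x^{ia}f)(x)=f(x+ia)$ and $$[d_x+a]_b=\frac{e^{\pi i ba}T_x^{ib/2}-e^{-\pi i ba}T_x^{-ib/2}}{q-q^{-1}},$$ and put $$E_\alpha=e^{2\pi bx}[d_x+Q-\alpha]_b,\quad F_\alpha=e^{-2\pi bx}[d_x+\alpha-Q]_b,\quad K_\alpha=T_x^{ib/2},\quad K_\alpha^{-1}=T_x^{-ib/2},$$ $$C_\alpha=F_\alpha E_\alpha-\frac{qK_\alpha^2+q^{-1}K_\alpha^{-2}-2}{(q-q^{-1})^2}.$$ Let $\mathcal P_\alpha$ be the space of entire functions $f$ whose restriction to $\mathbb R$ is integrable and square integrable and whose Fourier transform $\tilde f(\omega)=\int_{\mathbb R} e^{-2\pi i\omega x}f(x)\,dx$ extends to a meromorphic function on $\mathbb C$ with at most simple poles, located in the set of points $i(\alpha-Q-nb-mb^{-1})$ and $i(Q-\alpha+nb+mb^{-1})$, $n,m\in\mathbb Z_{\ge0}$, and decaying faster than $e^{-a|\mathrm{Re}\,\omega|}$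 for every $a>0$, uniformly in every horizontal strip $|\mathrm{Im}\,\omega|\le R$, as $|\mathrm{Re}\,\omega|\to\infty$. Then $E_\alpha,F_\alpha,K_\alpha$ define an integrable operator representation of $\mathcal U_q(\mathfrak{sl}(2,\mathbb R))$ on $L^2(\mathbb R)$. That is: (the restrictions to $\mathbb R$ of the elements of) $\mathcal P_\alpha$ form a dense subspace of $L^2(\mathbb R)$; the operators $E_\alpha,F_\alpha,K_\alpha,K_\alpha^{-1}$ map $\mathcal P_\alpha$ into itself and satisfy there $$K_\alpha K_\alpha^{-1}=K_\alpha^{-1}K_\alpha=1,\quad K_\alpha E_\alpha=qE_\alpha K_\alpha,\quad K_\alpha F_\alpha=q^{-1}F_\alpha K_\alpha,\quad [E_\alpha,F_\alpha]=-\frac{K_\alpha^2-K_\alpha^{-2}}{q-q^{-1}};$$ and there are self-adjoint operators $\mathsf E,\mathsf F,\mathsf K,\mathsf C$ in $L^2(\mathbb R)$ extending $E_\alpha,F_\alpha,K_\alpha,C_\alpha$ on $\mathcal P_\alpha$ such that: 1. $\mathsf E$, $-\mathsf F$ and $\mathsf K$ are strictly positive, i.e. $\langle u,\mathsf Eu\rangle>0$,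 $\langle u,\mathsf Fu\rangle<0$, $\langle u,\mathsf Ku\rangle>0$ for all nonzero $u$ in the respective domains; 2. the unitary operators $|\mathsf E|^{it}=\mathsf E^{it}$, $|\mathsf F|^{it}=(-\mathsf F)^{it}$, $|\mathsf K|^{it}=\mathsf K^{it}$ (defined by the spectral calculus) satisfy, for all $s,t\in\mathbb R$, $$\mathsf K^{is}\mathsf E^{it}=q^{-ts}\,\mathsf E^{it}\mathsf K^{is},\qquad \mathsf K^{is}|\mathsf F|^{it}=q^{ts}\,|\mathsf F|^{it}\mathsf K^{is},\qquad\text{where } q^{r}=e^{\pi i b^2 r};$$ 3. the $q$-Casimir $\mathsf C$ strongly commutes with $\mathsf E$, $\mathsf F$ and $\mathsf K$, i.e. its spectral projections commute with those of $\mathsf E$, $\mathsf F$ and $\mathsf K$. -/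

import Mathlib

open MeasureTheory Complex
open scoped FourierTransform InnerProductSpace

noncomputable section

/-! ### Spectral measures and self-adjoint operators -/

/-- A projection-valued (spectral) measure on the Borel subsets of `ℝ`. -/
structure SpectralMeasure (H : Type*) [NormedAddCommGroup H] [InnerProductSpace ℂ H]
    [CompleteSpace H] where
  proj : Set ℝ → H →L[ℂ] H
  isStarProjection : ∀ s, MeasurableSet s → IsStarProjection (proj s)
  proj_univ : proj Set.univ = 1
  proj_inter : ∀ s t, MeasurableSet s → MeasurableSet t →
    proj (s ∩ t) = proj s * proj t
  hasSum_iUnion : ∀ f : ℕ → Set ℝ, (∀ n, MeasurableSet (f n)) →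
    Pairwise (Function.onFun Disjoint f) →
    ∀ x : H, HasSum (fun n => proj (f n) x) (proj (⋃ n, f n) x)

namespace SpectralMeasure

variable {H : Type*} [NormedAddCommGroup H] [InnerProductSpace ℂ H] [CompleteSpace H]

theorem proj_empty (P : SpectralMeasure H) (x : H) : P.proj ∅ x = 0 := by
  have h := P.hasSum_iUnion (fun _ => ∅) (fun _ => MeasurableSet.empty)
    (fun _ _ _ => disjoint_bot_left) x
  exact tendsto_nhds_unique tendsto_const_nhds h.summable.tendsto_atTop_zero

theorem re_inner_nonneg (P : SpectralMeasure H) {s : Set ℝ} (hs : MeasurableSet s) (x : H) :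
    0 ≤ (inner ℂ x (P.proj s x)).re := by
  have hp := P.isStarProjection s hs
  have h1 : P.proj s (P.proj s x) = P.proj s x := by
    have := hp.isIdempotentElem
    exact congrArg (fun T : H →L[ℂ] H => T x) this
  have h2 : inner ℂ x (P.proj s (P.proj s x)) = inner ℂ (P.proj s x) (P.proj s x) := by
    have h3 := hp.isSelfAdjoint
    rw [ContinuousLinearMap.isSelfAdjoint_iff'] at h3
    conv_rhs => rw [← ContinuousLinearMap.adjoint_inner_right, h3]
  rw [← h1, h2]
  exact inner_self_nonneg (𝕜 := ℂ)

/-- The scalar measure `s ↦ ⟪x, P(s) x⟫` attached to the vector `x`. -/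
def measure (P : SpectralMeasure H) (x : H) : Measure ℝ :=
  Measure.ofMeasurable (fun s _ => ENNReal.ofReal (inner ℂ x (P.proj s x)).re)
    (by simp [P.proj_empty x])
    (by
      intro f hf hd
      have h := P.hasSum_iUnion f hf hd x
      have h2 : HasSum (fun n => (inner ℂ x (P.proj (f n) x)).re)
          (inner ℂ x (P.proj (⋃ n, f n) x)).re :=
        Complex.hasSum_re (h.mapL (innerSL ℂ x))
      change ENNReal.ofReal (inner ℂ x (P.proj (⋃ n, f n) x)).re = _
      rw [← h2.tsum_eq]
      exact ENNReal.ofReal_tsum_of_nonneg (fun n => P.re_inner_nonneg (hf n) x) h2.summable)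

/-- `P` is the spectral measure of the (unbounded) operator `A`, i.e. `A = ∫ r dP(r)`. -/
def IsSpectralMeasureOf (P : SpectralMeasure H) (A : H →ₗ.[ℂ] H) : Prop :=
  (∀ x : H, x ∈ A.domain ↔ Integrable (fun r : ℝ => r ^ 2) (P.measure x)) ∧
    ∀ x : A.domain, inner ℂ (x : H) (A x) = ((∫ r, r ∂(P.measure (x : H)) : ℝ) : ℂ)

/-- `U t = ∫ |r|^{it} dP(r)` for all real `t`, i.e. `U t = |A|^{it}`
if `P` is the spectral measure of `A`. -/
def IsImaginaryPowers (P : SpectralMeasure H) (U : ℝ → H →L[ℂ] H) : Prop :=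
  ∀ (t : ℝ) (x : H),
    inner ℂ x (U t x) = ∫ r : ℝ, ((|r| : ℝ) : ℂ) ^ (I * (t : ℂ)) ∂(P.measure x)

/-- Strong commutation: all the spectral projections commute. -/
def StronglyCommutes (P R : SpectralMeasure H) : Prop :=
  ∀ s t, MeasurableSet s → MeasurableSet t → Commute (P.proj s) (R.proj t)

end SpectralMeasure

/-! ### The finite difference operators -/

namespace QuantumSL2

/-- `q = e^{π i b²}`. -/
def q (b : ℝ) : ℂ := exp (Real.pi * I * (b : ℂ) ^ 2)

/-- `Q = b + b⁻¹`. -/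
def Q (b : ℝ) : ℝ := b + b⁻¹

/-- `(T^{ia} f)(z) = f(z + ia)`. -/
def shift (a : ℝ) : (ℂ → ℂ) →ₗ[ℂ] (ℂ → ℂ) where
  toFun f z := f (z + I * a)
  map_add' _ _ := rfl
  map_smul' _ _ := rfl

/-- Multiplication by the function `g`. -/
def mulOp (g : ℂ → ℂ) : (ℂ → ℂ) →ₗ[ℂ] (ℂ → ℂ) where
  toFun f z := g z * f z
  map_add' f h := by funext z; exact mul_add _ _ _
  map_smul' c f := by funext z; simp only [Pi.smul_apply, smul_eq_mul, RingHom.id_apply]; ring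

/-- `[d_x + a]_b = (e^{π i b a} T^{ib/2} - e^{-π i b a} T^{-ib/2}) / (e^{π i b²} - e^{-π i b²})`. -/
def dBracket (b : ℝ) (a : ℂ) : (ℂ → ℂ) →ₗ[ℂ] (ℂ → ℂ) :=
  (q b - (q b)⁻¹)⁻¹ • (exp (Real.pi * I * b * a) • shift (b / 2) -
    exp (-(Real.pi * I * b * a)) • shift (-(b / 2)))

/-- `π_α(E) = e^{2π b x} [d_x + Q - α]_b`. -/
def opE (b : ℝ) (α : ℂ) : (ℂ → ℂ) →ₗ[ℂ] (ℂ → ℂ) :=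
  mulOp (fun z => exp (2 * Real.pi * b * z)) ∘ₗ dBracket b (Q b - α)

/-- `π_α(F) = e^{-2π b x} [d_x + α - Q]_b`. -/
def opF (b : ℝ) (α : ℂ) : (ℂ → ℂ) →ₗ[ℂ] (ℂ → ℂ) :=
  mulOp (fun z => exp (-(2 * Real.pi * b * z))) ∘ₗ dBracket b (α - Q b)

/-- `π_α(K) = T^{ib/2}`. -/
def opK (b : ℝ) : (ℂ → ℂ) →ₗ[ℂ] (ℂ → ℂ) := shift (b / 2)

/-- `π_α(K⁻¹) = T^{-ib/2}`. -/
def opKinv (b : ℝ) : (ℂ → ℂ) →ₗ[ℂ] (ℂ → ℂ) := shift (-(b / 2))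

/-- The `q`-Casimir `C = F E - (q K² + q⁻¹ K⁻² - 2) / (q - q⁻¹)²`. -/
def opC (b : ℝ) (α : ℂ) : (ℂ → ℂ) →ₗ[ℂ] (ℂ → ℂ) :=
  opF b α ∘ₗ opE b α - ((q b - (q b)⁻¹) ^ 2)⁻¹ •
    (q b • (opK b ∘ₗ opK b) + (q b)⁻¹ • (opKinv b ∘ₗ opKinv b) - (2 : ℂ) • LinearMap.id)

/-! ### The representation space -/

/-- The points `i(α - Q - n b - m b⁻¹)` and `i(Q - α + n b + m b⁻¹)`, `n, m ≥ 0`. -/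
def poles (b : ℝ) (α : ℂ) : Set ℂ :=
  {w | ∃ n m : ℕ, w = I * (α - Q b - n * b - m * (b : ℂ)⁻¹) ∨
    w = I * (Q b - α + n * b + m * (b : ℂ)⁻¹)}

/-- `G` is meromorphic in the whole plane, its only possible singularities are at most simple
poles at `poles b α`, and in every horizontal strip it decays faster than any exponential. -/
structure IsTransform (b : ℝ) (α : ℂ) (G : ℂ → ℂ) : Prop where
  analyticAt : ∀ w, w ∉ poles b α → AnalyticAt ℂ G w
  meromorphicAt : ∀ w, w ∈ poles b α → MeromorphicAt G w
  order : ∀ w, w ∈ poles b α → -1 ≤ meromorphicOrderAt G w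
  decay : ∀ R a : ℝ, ∃ M C : ℝ, ∀ w : ℂ, |w.im| ≤ R → M ≤ |w.re| →
    ‖G w‖ ≤ C * Real.exp (-(a * |w.re|))

theorem IsTransform.zero (b : ℝ) (α : ℂ) : IsTransform b α 0 where
  analyticAt _ _ := analyticAt_const
  meromorphicAt w _ := MeromorphicAt.const 0 w
  order w _ := by
    have : meromorphicOrderAt (0 : ℂ → ℂ) w = ⊤ := by
      rw [meromorphicOrderAt_eq_top_iff]; simp
    rw [this]; exact le_top
  decay R a := ⟨0, 0, fun w _ _ => by simp⟩

theorem IsTransform.add {b : ℝ} {α : ℂ} {G G' : ℂ → ℂ} (h : IsTransform b α G)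
    (h' : IsTransform b α G') : IsTransform b α (G + G') where
  analyticAt w hw := (h.analyticAt w hw).add (h'.analyticAt w hw)
  meromorphicAt w hw := (h.meromorphicAt w hw).add (h'.meromorphicAt w hw)
  order w hw := (le_min (h.order w hw) (h'.order w hw)).trans
    (meromorphicOrderAt_add (h.meromorphicAt w hw) (h'.meromorphicAt w hw))
  decay R a := by
    obtain ⟨M, C, hC⟩ := h.decay R a
    obtain ⟨M', C', hC'⟩ := h'.decay R a
    refine ⟨max M M', C + C', fun w hw hM => ?_⟩
    rw [add_mul]
    exact (norm_add_le _ _).trans (add_le_add (hC w hw ((le_max_left _ _).trans hM))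
      (hC' w hw ((le_max_right _ _).trans hM)))

theorem IsTransform.smul {b : ℝ} {α : ℂ} {G : ℂ → ℂ} (c : ℂ) (h : IsTransform b α G) :
    IsTransform b α (c • G) := by
  rcases eq_or_ne c 0 with rfl | hc
  · rw [zero_smul]; exact IsTransform.zero b α
  refine ⟨fun w hw => (h.analyticAt w hw).const_smul, fun w hw =>
    (MeromorphicAt.const c w).smul (h.meromorphicAt w hw), fun w hw => ?_, fun R a => ?_⟩
  · have h1 : meromorphicOrderAt (fun _ : ℂ => c) w = 0 := by
      rw [meromorphicOrderAt_const, if_neg hc]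
    have h2 := meromorphicOrderAt_smul (MeromorphicAt.const c w) (h.meromorphicAt w hw)
    rw [h1, zero_add] at h2
    exact (h.order w hw).trans_eq h2.symm
  · obtain ⟨M, C, hC⟩ := h.decay R a
    refine ⟨M, ‖c‖ * C, fun w hw hM => ?_⟩
    rw [Pi.smul_apply, norm_smul, mul_assoc]
    exact mul_le_mul_of_nonneg_left (hC w hw hM) (norm_nonneg c)

theorem fourier_integrable {f : ℝ → ℂ} (hf : Integrable f) (w : ℝ) :
    Integrable (fun x : ℝ => Real.fourierChar (-(inner ℝ x w)) • f x) := by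
  have h : Integrable (fun x : ℝ => Real.fourierChar (-((innerₗ ℝ x) w)) • f x) :=
    (VectorFourier.fourierIntegral_convergent_iff Real.continuous_fourierChar
      (by exact (continuous_inner (𝕜 := ℝ) (E := ℝ))) w).2 hf
  exact h

/-- The space `𝒫_α` of entire functions `f` whose restriction to the real line is integrable and
square integrable and has a Fourier transform `∫ e^{-2π i ω x} f(x) dx` that is the restriction to
the real line of a function as in `IsTransform`. -/
def space (b : ℝ) (α : ℂ) : Submodule ℂ (ℂ → ℂ) where
  carrier := {f | Differentiable ℂ f ∧ Integrable (fun x : ℝ => f x) ∧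
    MemLp (fun x : ℝ => f x) 2 ∧
    ∃ G : ℂ → ℂ, IsTransform b α G ∧ ∀ w : ℝ, 𝓕 (fun x : ℝ => f x) w = G w}
  zero_mem' := ⟨differentiable_const 0, integrable_zero ℝ ℂ volume, MemLp.zero, 0,
    IsTransform.zero b α, fun w => by simp [Real.fourier_eq]⟩
  add_mem' := by
    rintro f g ⟨hf, hf1, hf2, F, hF, hfF⟩ ⟨hg, hg1, hg2, G, hG, hgG⟩
    refine ⟨hf.add hg, hf1.add hg1, hf2.add hg2, F + G, hF.add hG, fun w => ?_⟩
    rw [Pi.add_apply, ← hfF, ← hgG, Real.fourier_eq, Real.fourier_eq, Real.fourier_eq,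
      ← integral_add (fourier_integrable hf1 w) (fourier_integrable hg1 w)]
    simp only [Pi.add_apply, smul_add]
  smul_mem' := by
    rintro c f ⟨hf, hf1, hf2, F, hF, hfF⟩
    refine ⟨hf.const_smul c, hf1.smul c, hf2.const_smul c, c • F, hF.smul c, fun w => ?_⟩
    rw [Pi.smul_apply, ← hfF, Real.fourier_eq, Real.fourier_eq, ← integral_smul]
    refine integral_congr_ae (Filter.Eventually.of_forall fun x => ?_)
    exact smul_comm _ c (f x)

/-- The Hilbert space `L²(ℝ)`. -/
abbrev L2R : Type := Lp ℂ 2 (volume : Measure ℝ)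

/-- `u ∈ L²(ℝ)` is the class of the restriction of `f` to the real line. -/
def Represents (u : L2R) (f : ℂ → ℂ) : Prop := (u : ℝ → ℂ) =ᵐ[volume] fun x : ℝ => f x

/-- The operator `A` on `L²(ℝ)` extends the operator `T` with domain `𝒫_α`. -/
def Extends (b : ℝ) (α : ℂ) (A : L2R →ₗ.[ℂ] L2R) (T : (ℂ → ℂ) →ₗ[ℂ] (ℂ → ℂ)) : Prop :=
  ∀ f ∈ space b α, ∃ u : A.domain, Represents (u : L2R) f ∧ Represents (A u) (T f)

end QuantumSL2

end

open QuantumSL2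

noncomputable section

namespace QuantumSL2

/-! Everything becomes explicit on the Fourier side. If f is the inverse transform of G, then K f
has transform e^{-πbω} G(ω), and moving the line of integration by ib turns multiplication by
e^{2πbx} into G ↦ G(· + ib). With p = Im α, the operator E becomes G(ω) ↦ m(ω) G(ω + ib), where m is
`multE b p`, and F becomes G(ω) ↦ -m(-ω) G(ω - ib). These shifts are legitimate because every pole
has height at least Q/2 > b. They preserve 𝒫_α because the poles pushed outside the allowed set meet
zeros of m (`IsTransform.exists_multE_mul`).

The heart of the matter is a function g, unimodular on ℝ, holomorphic and of at most exponential
growth in 0 ≤ Im ω ≤ b, with g(x + ib) = m(x) g(x) (`exists_unimodular_multiplier`). Then g · m G(·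
+ ib) = (gG)(· + ib) on ℝ, so the Fourier multiplier V with symbol g satisfies V E = e^{2πbx} V on
𝒫_α (`fourierMul_intertwines`). Hence V⁻¹ e^{2πbx} V is a strictly positive self-adjoint extension
of E with an explicit spectral measure. The reflected symbol g(-ω) does the same for F, with
-e^{-2πbx}.

Since V commutes with the Fourier multiplier K, conjugation by V carries K^{is} and E^{it}
simultaneously to a translation and a modulation, and the required relation is Weyl's
(`unitaryCharacter_mul`). The Casimir is a real scalar on 𝒫_α (`opC_eq`), so its strong commutation
is immediate. Density follows by testing against Gaussians (`dense_space`).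

The function g comes from the double sine function: it is a translate of exp(i(S(ω) + cω)), where S
is `logSine b`. S is real on ℝ, and S(y + ib/2) - S(y - ib/2) has derivative -iπb tanh(πby), by the
sine transform of 1/sinh (`integral_sin_div_sinh`). Exponentiating i times this difference therefore
gives a constant times cosh(πby), and c is chosen to normalise the constant. -/

/-! ### Multiplication operators on `L²(ℝ)` -/

/-- `φ` is measurable and bounded by one. -/
def IsContraction (φ : ℝ → ℂ) : Prop := Measurable φ ∧ ∀ x, ‖φ x‖ ≤ 1

theorem IsContraction.memLp {φ : ℝ → ℂ} (hφ : IsContraction φ) {f : ℝ → ℂ} (hf : MemLp f 2) :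
    MemLp (fun x => φ x * f x) 2 :=
  hf.of_le (hφ.1.aestronglyMeasurable.mul hf.1) (Filter.Eventually.of_forall fun x => by
    rw [norm_mul]
    exact mul_le_of_le_one_left (norm_nonneg _) (hφ.2 x))

open scoped Classical in
/-- Multiplication by `φ`, as a bounded operator on `L²(ℝ)`, if `φ` is measurable and bounded
by one. -/
def mulCLM (φ : ℝ → ℂ) : L2R →L[ℂ] L2R :=
  if hφ : IsContraction φ then
    LinearMap.mkContinuous
      { toFun := fun u => (hφ.memLp (Lp.memLp u)).toLp
        map_add' := fun u v => by
          rw [← MemLp.toLp_add]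
          apply MemLp.toLp_congr
          filter_upwards [Lp.coeFn_add u v] with x hx
          simp only [hx, Pi.add_apply, mul_add]
        map_smul' := fun c u => by
          rw [RingHom.id_apply, ← MemLp.toLp_const_smul]
          apply MemLp.toLp_congr
          filter_upwards [Lp.coeFn_smul c u] with x hx
          simp only [hx, Pi.smul_apply, smul_eq_mul]
          ring } 1
      (fun u => by
        rw [one_mul]
        apply Lp.norm_le_norm_of_ae_le
        filter_upwards [(hφ.memLp (Lp.memLp u)).coeFn_toLp] with x hx
        simp only [LinearMap.coe_mk, AddHom.coe_mk, hx, norm_mul]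
        exact mul_le_of_le_one_left (norm_nonneg _) (hφ.2 x))
  else 0

theorem coeFn_mulCLM {φ : ℝ → ℂ} (hφ : IsContraction φ) (u : L2R) :
    mulCLM φ u =ᵐ[volume] fun x => φ x * u x := by
  rw [mulCLM, dif_pos hφ]
  exact (hφ.memLp (Lp.memLp u)).coeFn_toLp

theorem inner_eq_integral (u v : L2R) :
    inner ℂ u v = ∫ x, (starRingEnd ℂ) (u x) * v x := by
  rw [L2.inner_def]
  exact integral_congr_ae (Filter.Eventually.of_forall fun x => RCLike.inner_apply' _ _)

theorem IsContraction.mul {φ ψ : ℝ → ℂ} (hφ : IsContraction φ) (hψ : IsContraction ψ) :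
    IsContraction (fun x => φ x * ψ x) :=
  ⟨hφ.1.mul hψ.1, fun x => by
    rw [norm_mul]
    exact mul_le_one₀ (hφ.2 x) (norm_nonneg _) (hψ.2 x)⟩

theorem mulCLM_mul {φ ψ : ℝ → ℂ} (hφ : IsContraction φ) (hψ : IsContraction ψ) :
    mulCLM φ * mulCLM ψ = mulCLM (fun x => φ x * ψ x) := by
  ext1 u
  apply Lp.ext
  rw [mul_apply_eq_comp]
  filter_upwards [coeFn_mulCLM hφ (mulCLM ψ u), coeFn_mulCLM hψ u, coeFn_mulCLM (hφ.mul hψ) u]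
    with x h1 h2 h3
  rw [h1, h2, h3, mul_assoc]

theorem mulCLM_one : mulCLM (fun _ => 1) = 1 := by
  ext1 u
  apply Lp.ext
  have h : IsContraction (fun _ => (1 : ℂ)) := ⟨measurable_const, fun _ => by simp⟩
  filter_upwards [coeFn_mulCLM h u] with x h1
  rw [h1, one_mul, one_apply_eq_self]

theorem IsContraction.star {φ : ℝ → ℂ} (hφ : IsContraction φ) :
    IsContraction (fun x => (starRingEnd ℂ) (φ x)) :=
  ⟨Complex.continuous_conj.measurable.comp hφ.1, fun x => by
    rw [RCLike.norm_conj]; exact hφ.2 x⟩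

theorem inner_mulCLM_left {φ : ℝ → ℂ} (hφ : IsContraction φ) (u v : L2R) :
    inner ℂ (mulCLM φ u) v = inner ℂ u (mulCLM (fun x => (starRingEnd ℂ) (φ x)) v) := by
  rw [inner_eq_integral, inner_eq_integral]
  apply integral_congr_ae
  filter_upwards [coeFn_mulCLM hφ u, coeFn_mulCLM hφ.star v] with x h1 h2
  rw [h1, h2, map_mul]
  ring

theorem isContraction_indicator {s : Set ℝ} (hs : MeasurableSet s) :
    IsContraction (s.indicator 1) :=
  ⟨measurable_one.indicator hs, fun x => by
    by_cases h : x ∈ s <;> simp [h]⟩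

theorem isContraction_of_norm_eq_one {φ : ℝ → ℂ} (h : Measurable φ) (h1 : ∀ x, ‖φ x‖ = 1) :
    IsContraction φ := ⟨h, fun x => (h1 x).le⟩

/-- Multiplication by a function of modulus one. -/
def mulIsometryEquiv (φ : ℝ → ℂ) (h : Measurable φ) (h1 : ∀ x, ‖φ x‖ = 1) : L2R ≃ₗᵢ[ℂ] L2R :=
  have hφ := isContraction_of_norm_eq_one h h1
  have key : mulCLM φ * mulCLM (fun x => (starRingEnd ℂ) (φ x)) = 1 := by
    rw [mulCLM_mul hφ hφ.star, ← mulCLM_one]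
    congr 1
    funext x
    rw [RCLike.mul_conj, h1]; simp
  have key' : mulCLM (fun x => (starRingEnd ℂ) (φ x)) * mulCLM φ = 1 := by
    rw [mulCLM_mul hφ.star hφ, ← mulCLM_one]
    congr 1
    funext x
    rw [RCLike.conj_mul, h1]; simp
  { toLinearEquiv := LinearEquiv.ofLinearMap (mulCLM φ).toLinearMap
      (mulCLM (fun x => (starRingEnd ℂ) (φ x))).toLinearMap
      (by ext1 u; exact congrArg (fun T : L2R →L[ℂ] L2R => T u) key)
      (by ext1 u; exact congrArg (fun T : L2R →L[ℂ] L2R => T u) key')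
    norm_map' := fun u => by
      have h2 : inner ℂ (mulCLM φ u) (mulCLM φ u) = inner ℂ u u := by
        rw [inner_mulCLM_left hφ]
        exact congrArg (fun T : L2R →L[ℂ] L2R => inner ℂ u (T u)) key'
      have h3 : ‖mulCLM φ u‖ ^ 2 = ‖u‖ ^ 2 := by
        rw [@norm_sq_eq_re_inner ℂ, @norm_sq_eq_re_inner ℂ, h2]
      exact (sq_eq_sq₀ (norm_nonneg _) (norm_nonneg _)).1 h3 }

/-! ### Operators that are unitarily equivalent to a multiplication operator -/

section Conj

variable (V : L2R ≃ₗᵢ[ℂ] L2R)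

/-- The operator `V⁻¹ T V`. -/
def conjBy (T : L2R →L[ℂ] L2R) : L2R →L[ℂ] L2R :=
  (V.symm.toContinuousLinearEquiv : L2R →L[ℂ] L2R) ∘L T ∘L
    (V.toContinuousLinearEquiv : L2R →L[ℂ] L2R)

theorem conjBy_apply (T : L2R →L[ℂ] L2R) (u : L2R) : conjBy V T u = V.symm (T (V u)) := rfl

theorem conjBy_mul (T S : L2R →L[ℂ] L2R) : conjBy V T * conjBy V S = conjBy V (T * S) := by
  ext1 u
  simp only [mul_apply_eq_comp, conjBy_apply, V.apply_symm_apply]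

theorem conjBy_one : conjBy V 1 = 1 := by
  ext1 u
  simp only [one_apply_eq_self, conjBy_apply, V.symm_apply_apply]

theorem inner_conjBy (T : L2R →L[ℂ] L2R) (u v : L2R) :
    inner ℂ u (conjBy V T v) = inner ℂ (V u) (T (V v)) := by
  rw [conjBy_apply, ← V.inner_map_map, V.apply_symm_apply]

/-! ### Spectral measures of real multiplication operators -/

/-- The measure `‖u(x)‖² dx`. -/
def density (u : L2R) : Measure ℝ := volume.withDensity fun x => ENNReal.ofReal (‖u x‖ ^ 2)

theorem integrable_normSq (u : L2R) : Integrable fun x => ‖u x‖ ^ 2 :=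
  (memLp_two_iff_integrable_sq_norm (Lp.memLp u).1).1 (Lp.memLp u)

instance (u : L2R) : IsFiniteMeasure (density u) :=
  isFiniteMeasure_withDensity_ofReal (integrable_normSq u).2

theorem aemeasurable_normSq (u : L2R) : AEMeasurable (fun x => ‖u x‖₊ ^ 2) volume :=
  ((Lp.memLp u).1.nnnorm.aemeasurable.pow_const 2)

theorem density_eq (u : L2R) :
    density u = volume.withDensity fun x => ((‖u x‖₊ ^ 2 : NNReal) : ENNReal) := by
  rw [density]
  congr 1
  funext x
  rw [← ENNReal.ofReal_coe_nnreal]; simp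

theorem integral_density {F : Type*} [NormedAddCommGroup F] [NormedSpace ℝ F] (u : L2R)
    (f : ℝ → F) :
    ∫ x, f x ∂(density u) = ∫ x, ‖u x‖ ^ 2 • f x := by
  rw [density_eq, integral_withDensity_eq_integral_smul₀ (aemeasurable_normSq u)]
  rfl

theorem integrable_density_iff {F : Type*} [NormedAddCommGroup F] [NormedSpace ℝ F] (u : L2R)
    (f : ℝ → F) :
    Integrable f (density u) ↔ Integrable fun x => ‖u x‖ ^ 2 • f x := by
  rw [density_eq, integrable_withDensity_iff_integrable_smul₀ (aemeasurable_normSq u)]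
  rfl

theorem inner_mulCLM_self {φ : ℝ → ℂ} (hφ : IsContraction φ) (u : L2R) :
    inner ℂ u (mulCLM φ u) = ∫ x, φ x ∂(density u) := by
  rw [inner_eq_integral, integral_density]
  apply integral_congr_ae
  filter_upwards [coeFn_mulCLM hφ u] with x h1
  rw [h1, Complex.real_smul, Complex.ofReal_pow]
  rw [← Complex.conj_mul']
  ring

theorem inner_mulCLM_indicator {s : Set ℝ} (hs : MeasurableSet s) (u : L2R) :
    inner ℂ u (mulCLM (s.indicator 1) u) = ((density u).real s : ℂ) := by
  rw [inner_mulCLM_self (isContraction_indicator hs)]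
  have : (s.indicator 1 : ℝ → ℂ) = fun x => ((s.indicator 1 x : ℝ) : ℂ) := by
    funext x; by_cases h : x ∈ s <;> simp [h]
  rw [this]
  exact integral_ofReal.trans (congrArg _ (integral_indicator_one hs))

theorem mulCLM_indicator_sq {s : Set ℝ} (hs : MeasurableSet s) :
    mulCLM (s.indicator 1) * mulCLM (s.indicator 1) = mulCLM (s.indicator 1) := by
  rw [mulCLM_mul (isContraction_indicator hs) (isContraction_indicator hs)]
  congr 1; funext x; by_cases h : x ∈ s <;> simp [h]

theorem conj_indicator (s : Set ℝ) :
    (fun x => (starRingEnd ℂ) (s.indicator (1 : ℝ → ℂ) x)) = s.indicator 1 := by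
  funext x; by_cases h : x ∈ s <;> simp [h]

theorem norm_mulCLM_indicator {s : Set ℝ} (hs : MeasurableSet s) (u : L2R) :
    ‖mulCLM (s.indicator 1) u‖ ^ 2 = (density u).real s := by
  rw [@norm_sq_eq_re_inner ℂ, inner_mulCLM_left (isContraction_indicator hs), conj_indicator,
    ← mul_apply_eq_comp, mulCLM_indicator_sq hs, inner_mulCLM_indicator hs]
  exact Complex.ofReal_re _

theorem mulCLM_indicator_sum {s : ℕ → Set ℝ} (hs : ∀ n, MeasurableSet (s n))
    (hd : Pairwise (Function.onFun Disjoint s)) (F : Finset ℕ) (u : L2R) :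
    ∑ n ∈ F, mulCLM ((s n).indicator 1) u = mulCLM ((⋃ n ∈ F, s n).indicator 1) u := by
  classical
  have hm (F : Finset ℕ) : MeasurableSet (⋃ n ∈ F, s n) := F.measurableSet_biUnion fun n _ => hs n
  induction F using Finset.induction_on with
  | empty =>
    apply Lp.ext
    filter_upwards [coeFn_mulCLM (isContraction_indicator (hm ∅)) u, Lp.coeFn_zero ℂ 2 volume]
      with x h1 h2
    rw [h1, Finset.sum_empty, h2]
    simp
  | insert a F ha ih =>
    rw [Finset.sum_insert ha, ih]
    apply Lp.ext
    filter_upwards [coeFn_mulCLM (isContraction_indicator (hm (insert a F))) u,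
      coeFn_mulCLM (isContraction_indicator (hm F)) u,
      coeFn_mulCLM (isContraction_indicator (hs a)) u, Lp.coeFn_add (mulCLM ((s a).indicator 1) u)
      (mulCLM ((⋃ n ∈ F, s n).indicator 1) u)] with x h1 h2 h3 h4
    rw [h4, Pi.add_apply, h1, h2, h3, ← add_mul]
    congr 1
    rw [Finset.set_biUnion_insert, Set.indicator_union_of_disjoint]
    rw [Set.disjoint_iUnion₂_right]
    intro i hi
    exact hd (fun h => ha (h ▸ hi))

/-- The squared norm of the remainder is the mass that the finite measure `density u` gives to the
part of the union not yet covered. Strong convergence is thus countable additivity of that measure.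
-/
theorem hasSum_mulCLM_indicator {s : ℕ → Set ℝ} (hs : ∀ n, MeasurableSet (s n))
    (hd : Pairwise (Function.onFun Disjoint s)) (u : L2R) :
    HasSum (fun n => mulCLM ((s n).indicator 1) u) (mulCLM ((⋃ n, s n).indicator 1) u) := by
  classical
  have hm (F : Finset ℕ) : MeasurableSet (⋃ n ∈ F, s n) := F.measurableSet_biUnion fun n _ => hs n
  have hU := MeasurableSet.iUnion hs
  have key : ∀ F : Finset ℕ,
      ‖∑ n ∈ F, mulCLM ((s n).indicator 1) u - mulCLM ((⋃ n, s n).indicator 1) u‖ ^ 2 =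
        (density u).real (⋃ n, s n) - ∑ n ∈ F, (density u).real (s n) := by
    intro F
    have h1 : ∑ n ∈ F, mulCLM ((s n).indicator 1) u - mulCLM ((⋃ n, s n).indicator 1) u =
        - mulCLM (((⋃ n, s n) \ ⋃ n ∈ F, s n).indicator 1) u := by
      rw [mulCLM_indicator_sum hs hd, sub_eq_iff_eq_add, neg_add_eq_sub, eq_sub_iff_add_eq]
      apply Lp.ext
      filter_upwards [coeFn_mulCLM (isContraction_indicator hU) u,
        coeFn_mulCLM (isContraction_indicator (hm F)) u,
        coeFn_mulCLM (isContraction_indicator (hU.diff (hm F))) u,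
        Lp.coeFn_add (mulCLM ((⋃ n ∈ F, s n).indicator 1) u)
          (mulCLM (((⋃ n, s n) \ ⋃ n ∈ F, s n).indicator 1) u)] with x h1 h2 h3 h4
      rw [h4, Pi.add_apply, h1, h2, h3, ← add_mul]
      congr 1
      have hsub : (⋃ n ∈ F, s n) ⊆ ⋃ n, s n :=
        Set.iUnion₂_subset fun n _ => Set.subset_iUnion s n
      by_cases hx : x ∈ ⋃ n ∈ F, s n
      · simp [Set.indicator_of_mem (hsub hx), hx]
      · by_cases hx' : x ∈ ⋃ n, s n <;>
          simp only [Set.indicator, hx, hx', Set.mem_sdiff] <;> simp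
    rw [h1, norm_neg, norm_mulCLM_indicator (hU.diff (hm F)),
      measureReal_sdiff (Set.iUnion₂_subset fun n _ => Set.subset_iUnion s n) (hm F),
      measureReal_biUnion_finset (fun i _ j _ hij => hd hij) (fun n _ => hs n)]
  have h2 : HasSum (fun n => (density u).real (s n)) ((density u).real (⋃ n, s n)) := by
    have h3 : ∑' n, density u (s n) ≠ ⊤ := by
      rw [← measure_iUnion hd hs]
      exact measure_ne_top _ _
    rw [Measure.real, measure_iUnion hd hs, ENNReal.tsum_toReal_eq (ENNReal.ne_top_of_tsum_ne_top h3)]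
    exact ENNReal.hasSum_toReal h3
  rw [HasSum, tendsto_iff_norm_sub_tendsto_zero]
  have h3 : Filter.Tendsto (fun F : Finset ℕ =>
      √((density u).real (⋃ n, s n) - ∑ n ∈ F, (density u).real (s n))) Filter.atTop
      (nhds (√((density u).real (⋃ n, s n) - (density u).real (⋃ n, s n)))) :=
    (Real.continuous_sqrt.tendsto _).comp (tendsto_const_nhds.sub h2)
  rw [sub_self, Real.sqrt_zero] at h3
  refine h3.congr fun F => ?_
  rw [← key F, Real.sqrt_sq (norm_nonneg _)]

theorem isSelfAdjoint_conjBy_indicator {s : Set ℝ} (hs : MeasurableSet s) :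
    IsSelfAdjoint (conjBy V (mulCLM (s.indicator 1))) := by
  rw [ContinuousLinearMap.isSelfAdjoint_iff_isSymmetric]
  intro x y
  change inner ℂ (conjBy V _ x) y = inner ℂ x (conjBy V _ y)
  rw [inner_conjBy, ← inner_conj_symm, inner_conjBy, inner_conj_symm,
    inner_mulCLM_left (isContraction_indicator hs), conj_indicator]

open scoped Classical in
/-- The spectral measure of the operator `V⁻¹ a V`. -/
def spectralMeasure (a : ℝ → ℝ) (ha : Measurable a) : SpectralMeasure L2R where
  proj s := conjBy V (mulCLM ((a ⁻¹' s).indicator 1))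
  isStarProjection s hs :=
    ⟨by rw [IsIdempotentElem, conjBy_mul, mulCLM_indicator_sq (ha hs)],
      isSelfAdjoint_conjBy_indicator V (ha hs)⟩
  proj_univ := by
    rw [Set.preimage_univ, Set.indicator_univ]
    exact (congrArg (conjBy V) mulCLM_one).trans (conjBy_one V)
  proj_inter s t hs ht := by
    rw [conjBy_mul, mulCLM_mul (isContraction_indicator (ha hs)) (isContraction_indicator (ha ht)),
      Set.preimage_inter, Set.inter_indicator_one]
    rfl
  hasSum_iUnion f hf hd x := by
    rw [Set.preimage_iUnion]
    exact (hasSum_mulCLM_indicator (fun n => ha (hf n))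
      (fun i j hij => (hd hij).preimage a) (V x)).mapL
        (V.symm.toContinuousLinearEquiv : L2R →L[ℂ] L2R)

/-- Scalar spectral measures are push-forwards of `density (V u)` under `a`, so integrals against
them reduce to integrals over `x` by change of variables. -/
theorem spectralMeasure_measure (a : ℝ → ℝ) (ha : Measurable a) (u : L2R) :
    (spectralMeasure V a ha).measure u = (density (V u)).map a := by
  ext s hs
  rw [SpectralMeasure.measure, Measure.ofMeasurable_apply s hs, Measure.map_apply ha hs]
  change ENNReal.ofReal (inner ℂ u (conjBy V _ u)).re = _
  rw [inner_conjBy, inner_mulCLM_indicator (ha hs), Complex.ofReal_re, Measure.real,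
    ENNReal.ofReal_toReal (measure_ne_top _ _)]

/-! ### Unbounded real multiplication operators and their self-adjointness -/

/-- The domain of the operator `V⁻¹ a V`. -/
def mulDomain (a : ℝ → ℝ) : Submodule ℂ L2R where
  carrier := {u | MemLp (fun x => (a x : ℂ) * V u x) 2 volume}
  zero_mem' := by
    refine (MemLp.zero (ε := ℂ)).ae_eq ?_
    rw [map_zero]
    filter_upwards [Lp.coeFn_zero ℂ 2 (volume : Measure ℝ)] with x hx
    rw [hx, Pi.zero_apply, mul_zero]
  add_mem' := fun {u v} hu hv => by
    refine (hu.add hv).ae_eq ?_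
    filter_upwards [Lp.coeFn_add (V u) (V v)] with x hx
    simp only [map_add, hx, Pi.add_apply, mul_add]
  smul_mem' := fun c u hu => by
    refine (hu.const_smul c).ae_eq ?_
    filter_upwards [Lp.coeFn_smul c (V u)] with x hx
    simp only [map_smul, hx, Pi.smul_apply, smul_eq_mul]
    ring

/-- The function `a · V u`. -/
def mulVal (a : ℝ → ℝ) (u : mulDomain V a) : L2R :=
  MemLp.toLp (μ := volume) (p := 2) (fun x => (a x : ℂ) * V u x) u.2

theorem coeFn_mulVal (a : ℝ → ℝ) (u : mulDomain V a) :
    mulVal V a u =ᵐ[volume] fun x => (a x : ℂ) * V u x :=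
  MemLp.coeFn_toLp _

theorem mulVal_add (a : ℝ → ℝ) (u v : mulDomain V a) :
    mulVal V a (u + v) = mulVal V a u + mulVal V a v := by
  apply Lp.ext
  filter_upwards [coeFn_mulVal V a u, coeFn_mulVal V a v, coeFn_mulVal V a (u + v),
    Lp.coeFn_add (V u) (V v), Lp.coeFn_add (mulVal V a u) (mulVal V a v)] with x h1 h2 h3 h4 h5
  rw [h3, h5, Pi.add_apply, h1, h2, Submodule.coe_add, map_add, h4, Pi.add_apply, mul_add]

theorem mulVal_smul (a : ℝ → ℝ) (c : ℂ) (u : mulDomain V a) :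
    mulVal V a (c • u) = c • mulVal V a u := by
  apply Lp.ext
  filter_upwards [coeFn_mulVal V a u, coeFn_mulVal V a (c • u),
    Lp.coeFn_smul c (V u), Lp.coeFn_smul c (mulVal V a u)] with x h1 h3 h4 h5
  rw [h3, h5, Pi.smul_apply, h1, Submodule.coe_smul, map_smul, h4, Pi.smul_apply, smul_eq_mul,
    smul_eq_mul, mul_left_comm]

/-- The operator `V⁻¹ a V`, where `a` denotes the multiplication by `a`. -/
def mulPMap (a : ℝ → ℝ) : L2R →ₗ.[ℂ] L2R where
  domain := mulDomain V a
  toFun :=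
    { toFun := fun u => V.symm (mulVal V a u)
      map_add' := fun u v => by rw [mulVal_add, map_add]
      map_smul' := fun c u => by rw [mulVal_smul, map_smul, RingHom.id_apply] }

theorem mem_mulPMap_domain {a : ℝ → ℝ} {u : L2R} :
    u ∈ (mulPMap V a).domain ↔ MemLp (fun x => (a x : ℂ) * V u x) 2 := Iff.rfl

theorem coeFn_mulPMap {a : ℝ → ℝ} (u : (mulPMap V a).domain) :
    V (mulPMap V a u) =ᵐ[volume] fun x => (a x : ℂ) * V u x := by
  change V (V.symm (mulVal V a u)) =ᵐ[volume] _
  rw [V.apply_symm_apply]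
  exact coeFn_mulVal V a u

theorem mulPMap_eq {a : ℝ → ℝ} (u : (mulPMap V a).domain) {w : L2R}
    (hw : V w =ᵐ[volume] fun x => (a x : ℂ) * V u x) : mulPMap V a u = w := by
  apply V.injective
  apply Lp.ext
  exact (coeFn_mulPMap V u).trans hw.symm

theorem exists_mulPMap_eq {a : ℝ → ℝ} {u w : L2R}
    (hw : V w =ᵐ[volume] fun x => (a x : ℂ) * V u x) :
    ∃ h : u ∈ (mulPMap V a).domain, mulPMap V a ⟨u, h⟩ = w :=
  have h : u ∈ (mulPMap V a).domain := (Lp.memLp (V w)).ae_eq hw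
  ⟨h, mulPMap_eq V ⟨u, h⟩ hw⟩

theorem inner_mulPMap_self {a : ℝ → ℝ} (u : (mulPMap V a).domain) :
    inner ℂ (u : L2R) (mulPMap V a u) = ((∫ x, ‖V u x‖ ^ 2 * a x : ℝ) : ℂ) := by
  rw [← V.inner_map_map, inner_eq_integral]
  refine Eq.trans ?_ integral_ofReal
  apply integral_congr_ae
  filter_upwards [coeFn_mulPMap V u] with x h1
  rw [h1]
  rw [mul_left_comm, Complex.conj_mul', mul_comm]
  push_cast
  rfl

theorem integrable_inner_mulPMap {a : ℝ → ℝ} (u : (mulPMap V a).domain) :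
    Integrable fun x => ‖V u x‖ ^ 2 * a x := by
  have h := (L2.integrable_inner (𝕜 := ℂ) (V u) (V (mulPMap V a u))).re
  refine h.congr ?_
  filter_upwards [coeFn_mulPMap V u] with x h1
  rw [h1, RCLike.inner_apply', mul_left_comm, RCLike.conj_mul, ← RCLike.ofReal_pow, mul_comm]
  exact Complex.re_ofReal_mul _ _ |>.trans (by ring_nf; rfl)

/-- Truncations to the sets where `|a| ≤ n` satisfy this criterion; they are the test vectors both
for density of the domain and for the computation of the adjoint. -/
theorem mem_mulPMap_domain_of_bounded {a : ℝ → ℝ} (ha : Measurable a) {u : L2R} {n : ℝ}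
    (h : ∀ᵐ x, V u x ≠ 0 → |a x| ≤ n) : u ∈ (mulPMap V a).domain := by
  refine (Lp.memLp (V u)).of_le_mul (c := n)
    ((Complex.measurable_ofReal.comp ha).aestronglyMeasurable.fun_mul (Lp.memLp (V u)).1) ?_
  filter_upwards [h] with x hx
  rw [norm_mul, Complex.norm_real, Real.norm_eq_abs]
  by_cases h0 : V u x = 0
  · simp [h0]
  · exact mul_le_mul_of_nonneg_right (hx h0) (norm_nonneg _)

theorem measurableSet_abs_le {a : ℝ → ℝ} (ha : Measurable a) (n : ℕ) :
    MeasurableSet {x | |a x| ≤ n} :=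
  measurableSet_le (continuous_abs.measurable.comp ha) measurable_const

/-- A vector orthogonal to the domain is orthogonal to its own truncations to `|a| ≤ n`, so all of
these vanish; the truncation sets exhaust the line. -/
theorem dense_mulPMap_domain {a : ℝ → ℝ} (ha : Measurable a) :
    Dense ((mulPMap V a).domain : Set L2R) := by
  rw [Submodule.dense_iff_topologicalClosure_eq_top, Submodule.topologicalClosure_eq_top_iff,
    Submodule.eq_bot_iff]
  intro w hw
  have hc (n : ℕ) := isContraction_indicator (measurableSet_abs_le ha n)
  have h1 (n : ℕ) : mulCLM ({x | |a x| ≤ n}.indicator 1) (V w) = 0 := by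
    have hd : conjBy V (mulCLM ({x | |a x| ≤ n}.indicator 1)) w ∈ (mulPMap V a).domain := by
      apply mem_mulPMap_domain_of_bounded V ha (n := n)
      rw [conjBy_apply, V.apply_symm_apply]
      filter_upwards [coeFn_mulCLM (hc n) (V w)] with x hx h0
      by_contra h
      exact h0 (by rw [hx, Set.indicator_of_notMem (by exact h), zero_mul])
    have h2 := hw _ hd
    rw [← inner_conj_symm, inner_conjBy, inner_mulCLM_indicator (measurableSet_abs_le ha n),
      Complex.conj_ofReal, ← norm_mulCLM_indicator (measurableSet_abs_le ha n)] at h2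
    simpa using h2
  have h3 : V w = 0 := by
    apply Lp.ext
    have h4 : ∀ᵐ x : ℝ, ∀ n : ℕ, ({x | |a x| ≤ n}.indicator 1 x : ℂ) * V w x = 0 := by
      rw [ae_all_iff]
      intro n
      have h5 := coeFn_mulCLM (hc n) (V w)
      rw [h1 n] at h5
      filter_upwards [h5, Lp.coeFn_zero ℂ 2 (volume : Measure ℝ)] with x hx h0
      rw [← hx, h0, Pi.zero_apply]
    filter_upwards [h4, Lp.coeFn_zero ℂ 2 (volume : Measure ℝ)] with x hx h0
    obtain ⟨n, hn⟩ := exists_nat_ge |a x|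
    have := hx n
    rw [Set.indicator_of_mem (by exact hn), Pi.one_apply, one_mul] at this
    rw [this, h0, Pi.zero_apply]
  simpa using h3

/-- This says that the adjoint acts as multiplication by `a`. The test vector is the truncated
defect `V w - a · V v` itself, for which the hypothesis says that its norm is zero. -/
theorem ae_eq_of_forall_inner_mulPMap {a : ℝ → ℝ} (ha : Measurable a) {v w : L2R}
    (h : ∀ x : (mulPMap V a).domain, inner ℂ w (x : L2R) = inner ℂ v (mulPMap V a x)) :
    V w =ᵐ[volume] fun x => (a x : ℂ) * V v x := by
  have hn (n : ℕ) : ∀ᵐ x : ℝ, |a x| ≤ n → V w x - (a x : ℂ) * V v x = 0 := by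
    set s : Set ℝ := {x | |a x| ≤ n} with hs
    have hsm : MeasurableSet s := measurableSet_abs_le ha n
    have h1 : MemLp (s.indicator fun x => V w x) 2 volume := (Lp.memLp (V w)).indicator hsm
    have h2 : MemLp (s.indicator fun x => (a x : ℂ) * V v x) 2 volume := by
      refine (Lp.memLp (V v)).of_le_mul (c := n)
        (((Complex.measurable_ofReal.comp ha).aestronglyMeasurable.fun_mul
          (Lp.memLp (V v)).1).indicator hsm) (Filter.Eventually.of_forall fun x => ?_)
      by_cases hx : x ∈ s
      · rw [Set.indicator_of_mem hx, norm_mul, Complex.norm_real, Real.norm_eq_abs]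
        exact mul_le_mul_of_nonneg_right hx (norm_nonneg _)
      · rw [Set.indicator_of_notMem hx, norm_zero]
        positivity
    have hD := h1.sub h2
    set D : L2R := hD.toLp
    have hDe : D =ᵐ[volume] fun x => s.indicator (fun x => V w x - (a x : ℂ) * V v x) x := by
      filter_upwards [hD.coeFn_toLp] with x hx
      rw [hx, Pi.sub_apply]
      by_cases h : x ∈ s <;> simp [h]
    have hmem : V.symm D ∈ (mulPMap V a).domain := by
      apply mem_mulPMap_domain_of_bounded V ha (n := n)
      rw [V.apply_symm_apply]
      filter_upwards [hDe] with x hx h0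
      by_contra h
      exact h0 (by rw [hx, Set.indicator_of_notMem (by exact h)])
    have h3 := h ⟨V.symm D, hmem⟩
    have h4 := coeFn_mulPMap V ⟨V.symm D, hmem⟩
    simp only [V.apply_symm_apply] at h4
    rw [← V.inner_map_map, ← V.inner_map_map v, V.apply_symm_apply] at h3
    have h5 : inner ℂ D D = 0 := by
      rw [← sub_eq_zero, L2.inner_def, L2.inner_def,
        ← integral_sub (L2.integrable_inner _ _) (L2.integrable_inner _ _)] at h3
      rw [L2.inner_def, ← h3]
      apply integral_congr_ae
      filter_upwards [h4, hDe] with x h4 h6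
      rw [h4, RCLike.inner_apply', RCLike.inner_apply', RCLike.inner_apply', h6]
      by_cases hx : x ∈ s
      · rw [Set.indicator_of_mem hx, map_sub, map_mul, Complex.conj_ofReal]
        ring
      · simp [Set.indicator_of_notMem hx]
    rw [inner_self_eq_zero] at h5
    rw [h5] at hDe
    filter_upwards [hDe, Lp.coeFn_zero ℂ 2 (volume : Measure ℝ)] with x hx h0 hxs
    rw [h0, Set.indicator_of_mem (by exact hxs)] at hx
    exact hx.symm
  filter_upwards [ae_all_iff.2 hn] with x hx
  obtain ⟨n, hn⟩ := exists_nat_ge |a x|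
  exact sub_eq_zero.1 (hx n hn)

theorem isFormalAdjoint_mulPMap (a : ℝ → ℝ) :
    (mulPMap V a).IsFormalAdjoint (mulPMap V a) := by
  intro x y
  rw [← V.inner_map_map, ← V.inner_map_map (x : L2R), inner_eq_integral, inner_eq_integral]
  apply integral_congr_ae
  filter_upwards [coeFn_mulPMap V x, coeFn_mulPMap V y] with t h1 h2
  rw [h1, h2, map_mul, Complex.conj_ofReal]
  ring

theorem isSelfAdjoint_mulPMap {a : ℝ → ℝ} (ha : Measurable a) : IsSelfAdjoint (mulPMap V a) := by
  have hd := dense_mulPMap_domain V ha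
  rw [LinearPMap.isSelfAdjoint_def]
  refine le_antisymm ?_ ((isFormalAdjoint_mulPMap V a).le_adjoint hd)
  have key (v : (mulPMap V a).adjoint.domain) :=
    exists_mulPMap_eq V (ae_eq_of_forall_inner_mulPMap V ha
      (fun x => LinearPMap.adjoint_isFormalAdjoint hd v x))
  refine ⟨fun v hv => (key ⟨v, hv⟩).1, fun v u huv => ?_⟩
  obtain ⟨h1, h2⟩ := key v
  rw [← h2]
  congr 1
  exact Subtype.ext huv

theorem isSpectralMeasureOf_mulPMap {a : ℝ → ℝ} (ha : Measurable a) :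
    (spectralMeasure V a ha).IsSpectralMeasureOf (mulPMap V a) := by
  refine ⟨fun u => ?_, fun u => ?_⟩
  · have hm : AEStronglyMeasurable (fun x => (a x : ℂ) * V u x) volume :=
      (Complex.measurable_ofReal.comp ha).aestronglyMeasurable.fun_mul (Lp.memLp (V u)).1
    rw [spectralMeasure_measure, integrable_map_measure (by fun_prop) ha.aemeasurable,
      integrable_density_iff, mem_mulPMap_domain,
      memLp_two_iff_integrable_sq_norm hm]
    refine integrable_congr (Filter.Eventually.of_forall fun x => ?_)
    simp [mul_pow, mul_comm]
  · rw [inner_mulPMap_self, spectralMeasure_measure,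
      integral_map ha.aemeasurable (by fun_prop), integral_density]
    rfl

theorem isImaginaryPowers_mulPMap {a : ℝ → ℝ} (ha : Measurable a) (U : ℝ → L2R →L[ℂ] L2R)
    (φ : ℝ → ℝ → ℂ) (hφ : ∀ t, IsContraction (φ t))
    (hφa : ∀ t x, φ t x = ((|a x| : ℝ) : ℂ) ^ (I * (t : ℂ)))
    (hU : ∀ t, U t = conjBy V (mulCLM (φ t))) :
    (spectralMeasure V a ha).IsImaginaryPowers U := by
  intro t u
  rw [hU, inner_conjBy, inner_mulCLM_self (hφ t), spectralMeasure_measure,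
    integral_map ha.aemeasurable]
  · simp_rw [hφa]
  · exact (Measurable.pow_const (by fun_prop) _).aestronglyMeasurable

theorem re_inner_mulPMap_pos {a : ℝ → ℝ} (hpos : ∀ x, 0 < a x) (u : (mulPMap V a).domain)
    (hu : u ≠ 0) : 0 < (inner ℂ (u : L2R) (mulPMap V a u)).re := by
  rw [inner_mulPMap_self, Complex.ofReal_re]
  have h0 : 0 ≤ fun x => ‖V u x‖ ^ 2 * a x := fun x => mul_nonneg (sq_nonneg _) (hpos x).le
  refine (integral_nonneg h0).lt_of_ne' fun h => hu ?_
  rw [integral_eq_zero_iff_of_nonneg h0 (integrable_inner_mulPMap V u)] at h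
  have h1 : V u = 0 := by
    apply Lp.ext
    filter_upwards [h, Lp.coeFn_zero ℂ 2 (volume : Measure ℝ)] with x hx h0
    rw [h0, Pi.zero_apply]
    simpa [(hpos x).ne'] using hx
  exact Subtype.ext (by simpa using h1)

theorem re_inner_mulPMap_neg {a : ℝ → ℝ} (hneg : ∀ x, a x < 0) (u : (mulPMap V a).domain)
    (hu : u ≠ 0) : (inner ℂ (u : L2R) (mulPMap V a u)).re < 0 := by
  rw [inner_mulPMap_self, Complex.ofReal_re]
  have h0 : 0 ≤ fun x => ‖V u x‖ ^ 2 * -a x := fun x =>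
    mul_nonneg (sq_nonneg _) (neg_nonneg.2 (hneg x).le)
  have hi : Integrable fun x => ‖V u x‖ ^ 2 * -a x := by
    simpa using (integrable_inner_mulPMap V u).neg
  have h2 : ∫ x, ‖V u x‖ ^ 2 * a x = - ∫ x, ‖V u x‖ ^ 2 * -a x := by
    rw [← integral_neg]; simp
  rw [h2, neg_lt_zero]
  refine (integral_nonneg h0).lt_of_ne' fun h => hu ?_
  rw [integral_eq_zero_iff_of_nonneg h0 hi] at h
  have h1 : V u = 0 := by
    apply Lp.ext
    filter_upwards [h, Lp.coeFn_zero ℂ 2 (volume : Measure ℝ)] with x hx h0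
    rw [h0, Pi.zero_apply]
    simpa [(hneg x).ne] using hx
  exact Subtype.ext (by simpa using h1)

end Conj

/-! ### The Fourier transform on `L²(ℝ)` -/

/-- The Fourier transform on `L²(ℝ)`. -/
abbrev fourierL2 : L2R ≃ₗᵢ[ℂ] L2R := Lp.fourierTransformₗᵢ ℝ ℂ

/-- Used to compare the Fourier transform on L², which is tied to tempered distributions, with the
transform given by an integral. -/
theorem ae_eq_of_forall_schwartz {f g : ℝ → ℂ} (hf : LocallyIntegrable f)
    (hg : LocallyIntegrable g)
    (h : ∀ φ : SchwartzMap ℝ ℂ, ∫ x, φ x • f x = ∫ x, φ x • g x) : f =ᵐ[volume] g := by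
  refine ae_eq_of_integral_contDiff_smul_eq hf hg fun φ hφ hc => ?_
  have h1 : HasCompactSupport fun x => (φ x : ℂ) := hc.comp_left (g := fun r : ℝ => (r : ℂ)) rfl
  have h2 : ContDiff ℝ (⊤ : ℕ∞) fun x => (φ x : ℂ) := Complex.ofRealCLM.contDiff.comp hφ
  exact h (h1.toSchwartzMap h2)

theorem continuous_fourier {f : ℝ → ℂ} (hf : Integrable f) : Continuous (𝓕 f) :=
  VectorFourier.fourierIntegral_continuous Real.continuous_fourierChar
    (by exact continuous_inner (𝕜 := ℝ) (E := ℝ)) hf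

theorem continuous_fourierInv {f : ℝ → ℂ} (hf : Integrable f) : Continuous (𝓕⁻ f) := by
  rw [Real.fourierInv_eq_fourier_comp_neg]
  exact continuous_fourier hf.comp_neg

theorem integral_fourier_smul {f g : ℝ → ℂ} (hf : Integrable f) (hg : Integrable g) :
    ∫ x, 𝓕 g x • f x = ∫ x, g x • 𝓕 f x := by
  have h := VectorFourier.integral_fourierIntegral_smul_eq_flip (L := innerₗ ℝ)
    Real.continuous_fourierChar (by exact continuous_inner (𝕜 := ℝ) (E := ℝ)) hg hf
  rw [flip_innerₗ] at h
  exact h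

/-- Paired with a Schwartz function, both transforms can be moved onto that function: the left one
by compatibility with tempered distributions, the right one by Fubini. -/
theorem fourierL2_ae_eq {u : L2R} {f : ℝ → ℂ} (hu : u =ᵐ[volume] f) (hf : Integrable f) :
    fourierL2 u =ᵐ[volume] 𝓕 f := by
  refine ae_eq_of_forall_schwartz ((Lp.memLp _).locallyIntegrable (by norm_num))
    (continuous_fourier hf).locallyIntegrable fun φ => ?_
  have h1 := congrArg (fun T => T φ) (Lp.fourier_toTemperedDistribution_eq u)
  simp only [TemperedDistribution.fourier_apply, Lp.toTemperedDistribution_apply] at h1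
  refine Eq.trans h1.symm ?_
  rw [← integral_fourier_smul hf φ.integrable]
  apply integral_congr_ae
  filter_upwards [hu] with x hx
  rw [hx, SchwartzMap.fourier_coe]

theorem fourierL2_symm_ae_eq {u : L2R} {f : ℝ → ℂ} (hu : u =ᵐ[volume] f) (hf : Integrable f) :
    fourierL2.symm u =ᵐ[volume] 𝓕⁻ f := by
  refine ae_eq_of_forall_schwartz ((Lp.memLp _).locallyIntegrable (by norm_num))
    (continuous_fourierInv hf).locallyIntegrable fun φ => ?_
  have h1 := congrArg (fun T => T φ) (Lp.fourierInv_toTemperedDistribution_eq u)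
  simp only [TemperedDistribution.fourierInv_apply, Lp.toTemperedDistribution_apply] at h1
  refine Eq.trans h1.symm ?_
  have h2 : ∫ x, φ x • 𝓕⁻ f x = ∫ x, φ (-x) • 𝓕 f x := by
    rw [← integral_neg_eq_self]
    simp [Real.fourierInv_eq_fourier_neg]
  rw [h2, ← integral_fourier_smul hf φ.integrable.comp_neg]
  apply integral_congr_ae
  filter_upwards [hu] with x hx
  rw [hx, SchwartzMap.fourierInv_coe, Real.fourierInv_eq_fourier_comp_neg]

/-! ### Translations and modulations -/

/-- The character `e^{2π i r x}`. -/
def character (r : ℝ) (x : ℝ) : ℂ := exp (2 * Real.pi * r * x * I)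

theorem norm_character (r x : ℝ) : ‖character r x‖ = 1 := by
  rw [character, show (2 * Real.pi * r * x * I : ℂ) = ((2 * Real.pi * r * x : ℝ) : ℂ) * I by
    push_cast; ring]
  exact Complex.norm_exp_ofReal_mul_I _

theorem continuous_character (r : ℝ) : Continuous (character r) := by
  unfold character; fun_prop

theorem isContraction_character (r : ℝ) : IsContraction (character r) :=
  isContraction_of_norm_eq_one (continuous_character r).measurable (norm_character r)

theorem fourierInv_character_mul (f : ℝ → ℂ) (r x : ℝ) :
    𝓕⁻ (fun w => character r w * f w) x = 𝓕⁻ f (x + r) := by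
  rw [Real.fourierInv_eq', Real.fourierInv_eq']
  refine integral_congr_ae (Filter.Eventually.of_forall fun v => ?_)
  simp only [character, smul_eq_mul]
  rw [← mul_assoc, ← Complex.exp_add]
  congr 2
  simp only [RCLike.inner_apply, conj_trivial]
  push_cast
  ring

/-- Both sides are continuous in `u`, so Schwartz functions suffice; for these the character is
absorbed into the inverse Fourier integral. -/
theorem translation_ae_eq (r : ℝ) (u : L2R) :
    conjBy fourierL2 (mulCLM (character r)) u =ᵐ[volume] fun x => u (x + r) := by
  have hmp : MeasurePreserving (fun x : ℝ => x + r) volume volume :=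
    measurePreserving_add_right volume r
  have key : ∀ u : L2R, conjBy fourierL2 (mulCLM (character r)) u =
      Lp.compMeasurePreservingₗᵢ ℂ (fun x : ℝ => x + r) hmp u := by
    intro u
    refine DenseRange.induction_on (SchwartzMap.denseRange_toLpCLM (E := ℝ) (F := ℂ)
      (p := 2) (μ := volume) ENNReal.ofNat_ne_top) u
      (isClosed_eq (ContinuousLinearMap.continuous _) (LinearIsometry.continuous _)) fun f => ?_
    apply Lp.ext
    have h1 : fourierL2 (f.toLp 2) =ᵐ[volume] 𝓕 (f : ℝ → ℂ) :=
      fourierL2_ae_eq (f.coeFn_toLp 2 volume) f.integrable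
    have hi : Integrable (𝓕 (f : ℝ → ℂ)) := by
      rw [← SchwartzMap.fourier_coe]; exact (𝓕 f).integrable
    have h2 : mulCLM (character r) (fourierL2 (f.toLp 2)) =ᵐ[volume]
        fun w => character r w * 𝓕 (f : ℝ → ℂ) w := by
      filter_upwards [coeFn_mulCLM (isContraction_character r) (fourierL2 (f.toLp 2)), h1]
        with x h3 h4
      rw [h3, h4]
    have h5 := fourierL2_symm_ae_eq h2
      (hi.bdd_mul (continuous_character r).aestronglyMeasurable
        (Filter.Eventually.of_forall fun x => (norm_character r x).le))
    refine h5.trans ?_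
    have h6 : ((Lp.compMeasurePreservingₗᵢ ℂ (fun x : ℝ => x + r) hmp) (f.toLp 2) : L2R)
        =ᵐ[volume] (f.toLp 2 : L2R) ∘ fun x => x + r :=
      Lp.coeFn_compMeasurePreserving _ hmp
    refine Filter.EventuallyEq.trans ?_ h6.symm
    filter_upwards [hmp.quasiMeasurePreserving.ae (f.coeFn_toLp 2 volume)] with x hx
    rw [fourierInv_character_mul, Function.comp_apply, hx,
      f.continuous.fourierInv_fourier_eq f.integrable hi]
  rw [key u]
  exact Lp.coeFn_compMeasurePreserving _ hmp

/-- The Weyl relations. -/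
theorem translation_mul_modulation (r c : ℝ) :
    conjBy fourierL2 (mulCLM (character r)) * mulCLM (character c) =
      exp (2 * Real.pi * r * c * I) •
        (mulCLM (character c) * conjBy fourierL2 (mulCLM (character r))) := by
  ext1 u
  rw [_root_.smul_apply, mul_apply_eq_comp, mul_apply_eq_comp]
  apply Lp.ext
  have hmp : MeasurePreserving (fun x : ℝ => x + r) volume volume :=
    measurePreserving_add_right volume r
  filter_upwards [translation_ae_eq r (mulCLM (character c) u), translation_ae_eq r u,
    hmp.quasiMeasurePreserving.ae (coeFn_mulCLM (isContraction_character c) u),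
    coeFn_mulCLM (isContraction_character c) (conjBy fourierL2 (mulCLM (character r)) u),
    Lp.coeFn_smul (exp (2 * Real.pi * r * c * I))
      (mulCLM (character c) (conjBy fourierL2 (mulCLM (character r)) u))] with x h1 h2 h3 h4 h5
  rw [h5, Pi.smul_apply, h4, h1, h2, h3, smul_eq_mul, ← mul_assoc]
  congr 1
  rw [character, character, ← Complex.exp_add]
  congr 1
  push_cast
  ring

/-! ### Rapidly decaying holomorphic functions on strips -/

theorem integrable_exp_neg_abs : Integrable fun x : ℝ => Real.exp (-|x|) := by
  refine (integrable_inv_one_add_sq.const_mul 2).mono' (by fun_prop)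
    (Filter.Eventually.of_forall fun x => ?_)
  rw [Real.norm_eq_abs, Real.abs_exp, Real.exp_neg]
  -- The bound 1 + |x| + x²/2 ≤ e^{|x|} explains the constant 2 in the majorant 2/(1 + x²).
  have h := Real.quadratic_le_exp_of_nonneg (abs_nonneg x)
  rw [sq_abs] at h
  rw [← div_eq_mul_inv, inv_eq_one_div, div_le_div_iff₀ (Real.exp_pos _) (by positivity)]
  nlinarith [abs_nonneg x]

/-- `H` is differentiable at the points of the closed strip `c ≤ Im w ≤ d` and decays there faster
than any exponential. -/
structure StripDecay (c d : ℝ) (H : ℂ → ℂ) : Prop where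
  diff : ∀ w : ℂ, c ≤ w.im → w.im ≤ d → DifferentiableAt ℂ H w
  decay : ∀ a : ℝ, ∃ C : ℝ, ∀ w : ℂ, c ≤ w.im → w.im ≤ d → ‖H w‖ ≤ C * Real.exp (-(a * |w.re|))

namespace StripDecay

variable {c d : ℝ} {H : ℂ → ℂ}

/-- The strip with |Re w| ≤ M is compact, so continuity supplies the constant there. -/
theorem of_eventually (hd : ∀ w : ℂ, c ≤ w.im → w.im ≤ d → DifferentiableAt ℂ H w)
    (h : ∀ a : ℝ, ∃ M C : ℝ, ∀ w : ℂ, c ≤ w.im → w.im ≤ d → M ≤ |w.re| →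
      ‖H w‖ ≤ C * Real.exp (-(a * |w.re|))) : StripDecay c d H := by
  refine ⟨hd, fun a => ?_⟩
  obtain ⟨M, C, hC⟩ := h a
  have hcpt : IsCompact (Set.Icc (-M) M ×ℂ Set.Icc c d) := isCompact_Icc.reProdIm isCompact_Icc
  have hcont : ContinuousOn (fun w : ℂ => ‖H w‖ * Real.exp (a * |w.re|))
      (Set.Icc (-M) M ×ℂ Set.Icc c d) := fun w hw =>
    ((hd w hw.2.1 hw.2.2).continuousAt.norm.mul (by fun_prop)).continuousWithinAt
  obtain ⟨B, hB⟩ := hcpt.bddAbove_image hcont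
  refine ⟨max B C, fun w h1 h2 => ?_⟩
  rcases le_total M |w.re| with hM | hM
  · exact (hC w h1 h2 hM).trans (mul_le_mul_of_nonneg_right (le_max_right _ _) (Real.exp_pos _).le)
  · have h3 : ‖H w‖ * Real.exp (a * |w.re|) ≤ B :=
      hB ⟨w, ⟨abs_le.1 hM, h1, h2⟩, rfl⟩
    have h4 : ‖H w‖ = ‖H w‖ * Real.exp (a * |w.re|) * Real.exp (-(a * |w.re|)) := by
      rw [mul_assoc, ← Real.exp_add, add_neg_cancel, Real.exp_zero, mul_one]
    rw [h4]
    exact mul_le_mul_of_nonneg_right (h3.trans (le_max_left _ _)) (Real.exp_pos _).le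

theorem mono {c' d' : ℝ} (h : StripDecay c d H) (hc : c ≤ c') (hd : d' ≤ d) :
    StripDecay c' d' H :=
  ⟨fun w h1 h2 => h.diff w (hc.trans h1) (h2.trans hd), fun a =>
    (h.decay a).imp fun _ hC w h1 h2 => hC w (hc.trans h1) (h2.trans hd)⟩

theorem comp_add (h : StripDecay c d H) (η : ℝ) :
    StripDecay (c - η) (d - η) fun w => H (w + I * η) := by
  have him (w : ℂ) : (w + I * η).im = w.im + η := by simp
  have hre (w : ℂ) : (w + I * η).re = w.re := by simp
  refine ⟨fun w h1 h2 => ?_, fun a => (h.decay a).imp fun C hC w h1 h2 => ?_⟩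
  · exact (h.diff _ (by rw [him]; linarith) (by rw [him]; linarith)).comp w (by fun_prop)
  · have := hC (w + I * η) (by rw [him]; linarith) (by rw [him]; linarith)
    rwa [hre] at this

/-- Growth of `F` at rate a' is paid for by using the decay of `H` at rate a + a', which is
available because `H` decays at every rate. -/
theorem mul (h : StripDecay c d H) {F : ℂ → ℂ}
    (hF : ∀ w : ℂ, c ≤ w.im → w.im ≤ d → DifferentiableAt ℂ F w)
    (hF' : ∃ a C : ℝ, ∀ w : ℂ, c ≤ w.im → w.im ≤ d → ‖F w‖ ≤ C * Real.exp (a * |w.re|)) :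
    StripDecay c d fun w => F w * H w := by
  obtain ⟨a', C', hC'⟩ := hF'
  refine ⟨fun w h1 h2 => (hF w h1 h2).mul (h.diff w h1 h2), fun a => ?_⟩
  obtain ⟨C, hC⟩ := h.decay (a + a')
  refine ⟨C' * C, fun w h1 h2 => ?_⟩
  rw [norm_mul]
  refine (mul_le_mul (hC' w h1 h2) (hC w h1 h2) (norm_nonneg _)
    ((norm_nonneg _).trans (hC' w h1 h2))).trans_eq ?_
  rw [mul_mul_mul_comm, ← Real.exp_add]
  ring_nf

theorem norm_exp_mul_le (z w : ℂ) (hc : c ≤ w.im) (hd : w.im ≤ d) :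
    ‖exp (z * w)‖ ≤ Real.exp (‖z‖ * (|c| + |d|)) * Real.exp (‖z‖ * |w.re|) := by
  rw [Complex.norm_exp, ← Real.exp_add, Real.exp_le_exp]
  have h1 : |w.im| ≤ |c| + |d| := by
    rw [abs_le]
    constructor <;> linarith [neg_abs_le c, le_abs_self d, abs_nonneg c, abs_nonneg d]
  calc (z * w).re ≤ ‖z * w‖ := Complex.re_le_norm _
    _ = ‖z‖ * ‖w‖ := norm_mul _ _
    _ ≤ ‖z‖ * (|w.re| + |w.im|) :=
      mul_le_mul_of_nonneg_left (Complex.norm_le_abs_re_add_abs_im w) (norm_nonneg _)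
    _ ≤ ‖z‖ * (|w.re| + (|c| + |d|)) := by gcongr
    _ = _ := by ring

theorem exp_mul (h : StripDecay c d H) (z : ℂ) : StripDecay c d fun w => exp (z * w) * H w :=
  h.mul (fun w _ _ => by fun_prop) ⟨‖z‖, _, fun w h1 h2 => norm_exp_mul_le z w h1 h2⟩

theorem const_mul (h : StripDecay c d H) (k : ℂ) : StripDecay c d fun w => k * H w :=
  h.mul (fun w _ _ => by fun_prop) ⟨0, ‖k‖, fun w _ _ => by simp⟩

theorem continuous_line (h : StripDecay c d H) {η : ℝ} (h1 : c ≤ η) (h2 : η ≤ d) :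
    Continuous fun x : ℝ => H (x + η * I) := by
  rw [continuous_iff_continuousAt]
  intro x
  have h3 := (h.diff (x + η * I) (by simpa) (by simpa)).continuousAt
  exact ContinuousAt.comp (f := fun x : ℝ => (x + η * I : ℂ)) h3 (by fun_prop)

theorem decay_line (h : StripDecay c d H) {η : ℝ} (h1 : c ≤ η) (h2 : η ≤ d) :
    ∃ C : ℝ, ∀ x : ℝ, ‖H (x + η * I)‖ ≤ C * Real.exp (-|x|) := by
  obtain ⟨C, hC⟩ := h.decay 1
  refine ⟨C, fun x => ?_⟩
  simpa using hC (x + η * I) (by simpa) (by simpa)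

theorem _root_.QuantumSL2.integrable_of_exp_decay {f : ℝ → ℂ} {C : ℝ} (hf : Continuous f)
    (h : ∀ x, ‖f x‖ ≤ C * Real.exp (-|x|)) : Integrable f :=
  (integrable_exp_neg_abs.const_mul C).mono' hf.aestronglyMeasurable
    (Filter.Eventually.of_forall h)

theorem _root_.QuantumSL2.memLp_of_exp_decay {f : ℝ → ℂ} {C : ℝ} (hf : Continuous f)
    (h : ∀ x, ‖f x‖ ≤ C * Real.exp (-|x|)) : MemLp f 2 := by
  rw [memLp_two_iff_integrable_sq_norm hf.aestronglyMeasurable]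
  refine (integrable_exp_neg_abs.const_mul (C ^ 2)).mono' (by fun_prop)
    (Filter.Eventually.of_forall fun x => ?_)
  rw [Real.norm_eq_abs, abs_of_nonneg (sq_nonneg _)]
  calc ‖f x‖ ^ 2 ≤ (C * Real.exp (-|x|)) ^ 2 := by gcongr; exact h x
    _ = C ^ 2 * Real.exp (-|x|) * Real.exp (-|x|) := by ring
    _ ≤ C ^ 2 * Real.exp (-|x|) * 1 := by
      gcongr; rw [Real.exp_le_one_iff]; exact neg_nonpos.2 (abs_nonneg x)
    _ = _ := mul_one _

theorem integrable_line (h : StripDecay c d H) {η : ℝ} (h1 : c ≤ η) (h2 : η ≤ d) :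
    Integrable fun x : ℝ => H (x + η * I) :=
  let ⟨_, hC⟩ := h.decay_line h1 h2
  integrable_of_exp_decay (h.continuous_line h1 h2) hC

theorem integrable (h : StripDecay c d H) (h1 : c ≤ 0) (h2 : 0 ≤ d) :
    Integrable fun x : ℝ => H x := by
  simpa using h.integrable_line h1 h2

theorem continuous (h : StripDecay c d H) (h1 : c ≤ 0) (h2 : 0 ≤ d) :
    Continuous fun x : ℝ => H x := by
  simpa using h.continuous_line h1 h2

theorem memLp (h : StripDecay c d H) (h1 : c ≤ 0) (h2 : 0 ≤ d) :
    MemLp (fun x : ℝ => H x) 2 := by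
  obtain ⟨C, hC⟩ := h.decay_line h1 h2
  have := memLp_of_exp_decay (h.continuous_line h1 h2) hC
  simpa using this

/-- Cauchy's theorem on the rectangle |Re w| ≤ T; the decay makes the vertical sides disappear as T
grows. -/
theorem integral_line_eq (h : StripDecay c d H) (hcd : c ≤ d) :
    ∫ x : ℝ, H (x + c * I) = ∫ x : ℝ, H (x + d * I) := by
  obtain ⟨C, hC⟩ := h.decay 1
  have hrect (T : ℝ) : (∫ x : ℝ in -T..T, H (x + c * I)) - (∫ x : ℝ in -T..T, H (x + d * I)) +
      I • (∫ y : ℝ in c..d, H (T + y * I)) - I • (∫ y : ℝ in c..d, H ((-T : ℝ) + y * I)) = 0 := by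
    have := integral_boundary_rect_eq_zero_of_differentiableOn H (⟨-T, c⟩ : ℂ) (⟨T, d⟩ : ℂ)
      (fun w hw => by
        have h3 := hw.2
        rw [Set.uIcc_of_le hcd] at h3
        exact (h.diff w h3.1 h3.2).differentiableWithinAt)
    exact this
  -- The two values s = 1 and s = -1 treat the right and the left side at once.
  have hvert (s : ℝ) (hs : |s| = 1) : Filter.Tendsto
      (fun T : ℝ => I • ∫ y : ℝ in c..d, H ((s * T : ℝ) + y * I)) Filter.atTop (nhds 0) := by
    rw [tendsto_zero_iff_norm_tendsto_zero]
    have hlim : Filter.Tendsto (fun T : ℝ => C * Real.exp (-|T|) * |d - c|) Filter.atTop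
        (nhds (C * 0 * |d - c|)) :=
      ((Real.tendsto_exp_neg_atTop_nhds_zero.comp
        Filter.tendsto_abs_atTop_atTop).const_mul C).mul_const _
    rw [mul_zero, zero_mul] at hlim
    refine squeeze_zero (fun _ => norm_nonneg _) (fun T => ?_) hlim
    rw [norm_smul, norm_I, one_mul]
    refine intervalIntegral.norm_integral_le_of_norm_le_const fun y hy => ?_
    rw [Set.uIoc_of_le hcd] at hy
    have := hC ((s * T : ℝ) + y * I) (by simpa using hy.1.le) (by simpa using hy.2)
    simpa [abs_mul, hs] using this
  have h1 := intervalIntegral_tendsto_integral (h.integrable_line le_rfl hcd)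
    Filter.tendsto_neg_atTop_atBot Filter.tendsto_id
  have h2 := intervalIntegral_tendsto_integral (h.integrable_line hcd le_rfl)
    Filter.tendsto_neg_atTop_atBot Filter.tendsto_id
  have h3 := ((h1.sub h2).add (hvert 1 (by simp))).sub (hvert (-1) (by simp))
  have h4 := tendsto_nhds_unique h3 (tendsto_const_nhds.congr fun T => by
    have := hrect T
    simp only [one_mul, neg_one_mul, id]
    exact this.symm)
  rw [add_zero, sub_zero] at h4
  exact sub_eq_zero.1 h4

theorem integral_line_eq_integral (h : StripDecay c d H) (h1 : c ≤ 0) (h2 : 0 ≤ d) {η : ℝ}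
    (h3 : c ≤ η) (h4 : η ≤ d) : ∫ x : ℝ, H (x + η * I) = ∫ x : ℝ, H x := by
  have ha := (h.mono le_rfl h4).integral_line_eq h3
  have hb := (h.mono le_rfl h2).integral_line_eq h1
  rw [← ha, hb]
  simp

end StripDecay

/-! ### The inverse Fourier transform as an entire function -/

/-- `∫ e^{2π i x z} H(x) dx`. -/
def invF (H : ℂ → ℂ) (z : ℂ) : ℂ := ∫ x : ℝ, exp (2 * Real.pi * I * z * x) * H x

theorem invF_ofReal (H : ℂ → ℂ) (x : ℝ) : invF H x = 𝓕⁻ (fun w : ℝ => H w) x := by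
  rw [invF, Real.fourierInv_eq']
  refine integral_congr_ae (Filter.Eventually.of_forall fun v => ?_)
  simp only [smul_eq_mul, RCLike.inner_apply, conj_trivial]
  congr 2
  push_cast
  ring

theorem invF_congr {G H : ℂ → ℂ} (h : ∀ x : ℝ, G x = H x) : invF G = invF H := by
  funext z
  simp only [invF, h]

section

variable {c d : ℝ} {H : ℂ → ℂ}

/-- Moving the line of integration to height η extracts the factor e^{-2πηz}. This is how
multiplication by an exponential becomes an imaginary shift of the transform. -/
theorem invF_add_real_shift (h : StripDecay c d H) (h1 : c ≤ 0) (h2 : 0 ≤ d) {η : ℝ}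
    (h3 : c ≤ η) (h4 : η ≤ d) (z : ℂ) :
    exp (2 * Real.pi * η * z) * invF H z = invF (fun w => H (w + I * η)) z := by
  have h5 := (h.exp_mul (2 * Real.pi * I * z)).integral_line_eq_integral h1 h2 h3 h4
  rw [invF, ← h5, ← integral_const_mul, invF]
  refine integral_congr_ae (Filter.Eventually.of_forall fun x => ?_)
  simp only []
  rw [← mul_assoc, ← Complex.exp_add, mul_comm I (η : ℂ)]
  congr 2
  linear_combination (2 * Real.pi * η * z) * I_mul_I

theorem invF_shift (H : ℂ → ℂ) (a : ℝ) (z : ℂ) :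
    invF H (z + I * a) = invF (fun w => exp (-(2 * Real.pi * a) * w) * H w) z := by
  refine integral_congr_ae (Filter.Eventually.of_forall fun x => ?_)
  simp only []
  rw [← mul_assoc, ← Complex.exp_add]
  congr 2
  linear_combination (2 * Real.pi * a * x) * I_mul_I

theorem differentiable_invF (h : StripDecay c d H) (h1 : c ≤ 0) (h2 : 0 ≤ d) :
    Differentiable ℂ (invF H) := by
  intro z
  have hint := h.integrable h1 h2
  have hcont := h.continuous h1 h2
  set A : ℝ := 2 * Real.pi * (‖z‖ + 1) with hA
  have hA0 : 0 ≤ A := by positivity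
  -- `A` bounds the growth rate of the kernel for points within distance 1 of `z`. One more unit of
  -- decay absorbs the factor |x| of the derivative, and the last one leaves e^{-|x|}.
  obtain ⟨C, hC⟩ := h.decay (A + 2)
  have hC0 : 0 ≤ C := by
    have := hC 0 (by simpa) (by simpa)
    simpa using (norm_nonneg _).trans this
  have := hasDerivAt_integral_of_dominated_loc_of_deriv_le (𝕜 := ℂ) (μ := (volume : Measure ℝ))
    (F := fun z (x : ℝ) => exp (2 * Real.pi * I * z * x) * H x)
    (F' := fun z (x : ℝ) => exp (2 * Real.pi * I * z * x) * (2 * Real.pi * I * x) * H x)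
    (x₀ := z) (s := Metric.ball z 1) (bound := fun x => 2 * Real.pi * C * Real.exp (-|x|))
    (Metric.ball_mem_nhds z one_pos)
    (Filter.Eventually.of_forall fun z => (Continuous.mul (by fun_prop) hcont).aestronglyMeasurable)
    ?_ (Continuous.mul (by fun_prop) hcont).aestronglyMeasurable
    (Filter.Eventually.of_forall fun x w hw => ?_)
    (integrable_exp_neg_abs.const_mul _)
    (Filter.Eventually.of_forall fun x w hw => ?_)
  · exact this.2.differentiableAt
  · simpa using (h.exp_mul (2 * Real.pi * I * z)).integrable h1 h2
  · have h6 : ‖exp (2 * Real.pi * I * w * x)‖ ≤ Real.exp (A * |x|) := by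
      rw [Complex.norm_exp, Real.exp_le_exp]
      refine (Complex.re_le_norm _).trans ?_
      have h7 : ‖w‖ ≤ ‖z‖ + 1 := by
        have := norm_le_norm_add_norm_sub' w z
        rw [mem_ball_iff_norm] at hw
        linarith
      simp only [norm_mul, norm_I, Complex.norm_real, Real.norm_eq_abs, Complex.norm_ofNat,
        abs_of_pos Real.pi_pos, hA, mul_one]
      gcongr
    have h8 : |x| ≤ Real.exp |x| := by linarith [Real.add_one_le_exp |x|]
    have h9 := hC x (by simpa) (by simpa)
    rw [Complex.ofReal_re] at h9
    simp only [norm_mul, norm_I, Complex.norm_real, Real.norm_eq_abs, Complex.norm_ofNat,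
      abs_of_pos Real.pi_pos, mul_one]
    calc ‖exp (2 * Real.pi * I * w * x)‖ * (2 * Real.pi * |x|) * ‖H x‖
        ≤ Real.exp (A * |x|) * (2 * Real.pi * Real.exp |x|) *
          (C * Real.exp (-((A + 2) * |x|))) := by gcongr
      _ = 2 * Real.pi * C * (Real.exp (A * |x|) * Real.exp |x| *
          Real.exp (-((A + 2) * |x|))) := by ring
      _ = _ := by
        rw [← Real.exp_add, ← Real.exp_add]
        ring_nf
  · have h10 : HasDerivAt (fun w : ℂ => 2 * Real.pi * I * w * x) (2 * Real.pi * I * x) w := by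
      simpa using ((hasDerivAt_id w).const_mul (2 * Real.pi * I : ℂ)).mul_const (x : ℂ)
    exact h10.cexp.mul_const _

theorem norm_invF_le (h : StripDecay c d H) (h1 : c ≤ 0) (h2 : 0 ≤ d) {η : ℝ}
    (h3 : c ≤ η) (h4 : η ≤ d) :
    ∃ C, ∀ x : ℝ, ‖invF H x‖ ≤ C * Real.exp (-(2 * Real.pi * η * x)) := by
  refine ⟨∫ x : ℝ, ‖H (x + I * η)‖, fun x => ?_⟩
  have h5 := invF_add_real_shift h h1 h2 h3 h4 x
  have h6 : ‖invF (fun w => H (w + I * η)) x‖ ≤ ∫ x : ℝ, ‖H (x + I * η)‖ := by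
    refine (norm_integral_le_integral_norm _).trans_eq ?_
    refine integral_congr_ae (Filter.Eventually.of_forall fun v => ?_)
    simp only [norm_mul]
    rw [Complex.norm_exp, show (2 * Real.pi * I * x * v : ℂ).re = 0 by simp, Real.exp_zero, one_mul]
  rw [← h5, norm_mul, Complex.norm_exp,
    show (2 * Real.pi * η * x : ℂ).re = 2 * Real.pi * η * x by simp] at h6
  rw [Real.exp_neg, ← div_eq_mul_inv, le_div_iff₀ (Real.exp_pos _), mul_comm]
  exact h6

/-- The contour is raised for positive x and lowered for negative x. -/
theorem norm_invF_le_exp_abs {r : ℝ} (hr : 0 ≤ r) (h : StripDecay (-r) r H) :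
    ∃ C, ∀ x : ℝ, ‖invF H x‖ ≤ C * Real.exp (-(2 * Real.pi * r * |x|)) := by
  obtain ⟨C1, hC1⟩ := norm_invF_le h (by linarith) hr (η := r) (by linarith) le_rfl
  obtain ⟨C2, hC2⟩ := norm_invF_le h (by linarith) hr (η := -r) le_rfl (by linarith)
  refine ⟨max C1 C2, fun x => ?_⟩
  rcases le_total 0 x with hx | hx
  · rw [abs_of_nonneg hx]
    exact (hC1 x).trans (mul_le_mul_of_nonneg_right (le_max_left _ _) (Real.exp_pos _).le)
  · rw [abs_of_nonpos hx]
    refine (hC2 x).trans ((mul_le_mul_of_nonneg_right (le_max_right C1 _)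
      (Real.exp_pos _).le).trans_eq ?_)
    ring_nf

theorem integrable_memLp_invF {r : ℝ} (hr : 0 < r) (h : StripDecay (-r) r H) :
    Integrable (fun x : ℝ => invF H x) ∧ MemLp (fun x : ℝ => invF H x) 2 := by
  obtain ⟨C, hC⟩ := norm_invF_le_exp_abs hr.le h
  have hcont : Continuous fun x : ℝ => invF H x :=
    (differentiable_invF h (by linarith) hr.le).continuous.comp Complex.continuous_ofReal
  set k := 2 * Real.pi * r
  have hk : 0 < k := by positivity
  -- Rescaling the variable by k = 2πr normalises the decay rate to 1.
  have hcont' : Continuous fun x : ℝ => invF H (k⁻¹ * x : ℝ) := hcont.comp (by fun_prop)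
  have hC' : ∀ x : ℝ, ‖invF H (k⁻¹ * x : ℝ)‖ ≤ C * Real.exp (-|x|) := fun x => by
    refine (hC _).trans_eq ?_
    rw [abs_mul, abs_of_pos (inv_pos.2 hk), mul_inv_cancel_left₀ hk.ne']
  have h1 := integrable_of_exp_decay hcont' hC'
  have h2 := memLp_of_exp_decay hcont' hC'
  rw [memLp_two_iff_integrable_sq_norm hcont'.aestronglyMeasurable] at h2
  rw [memLp_two_iff_integrable_sq_norm hcont.aestronglyMeasurable]
  exact ⟨(integrable_comp_mul_left_iff (fun x : ℝ => invF H x) (inv_ne_zero hk.ne')).1 h1,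
    (integrable_comp_mul_left_iff (fun x : ℝ => ‖invF H x‖ ^ 2) (inv_ne_zero hk.ne')).1 h2⟩

/-- Holomorphy in a strip of positive width makes `invF H` integrable on the line, which is what
Fourier inversion needs besides the continuity and integrability of `H`. -/
theorem fourier_invF {r : ℝ} (hr : 0 < r) (h : StripDecay (-r) r H) (w : ℝ) :
    𝓕 (fun x : ℝ => invF H x) w = H w := by
  have h1 : (fun x : ℝ => invF H x) = 𝓕⁻ (fun w : ℝ => H w) := funext (invF_ofReal H)
  have h2 := (integrable_memLp_invF hr h).1
  rw [h1] at h2 ⊢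
  have h3 : Integrable (𝓕 fun w : ℝ => H w) := by
    have : 𝓕 (fun w : ℝ => H w) = fun x => 𝓕⁻ (fun w : ℝ => H w) (-x) := by
      funext x; rw [Real.fourierInv_eq_fourier_neg, neg_neg]
    rw [this]
    exact h2.comp_neg
  exact congrFun ((h.continuous (by linarith) hr.le).fourier_fourierInv_eq
    (h.integrable (by linarith) hr.le) h3) w

end

/-! ### The algebraic relations -/

theorem q_ne_zero (b : ℝ) : q b ≠ 0 := Complex.exp_ne_zero _

theorem q_inv (b : ℝ) : (q b)⁻¹ = exp (-(Real.pi * I * (b : ℂ) ^ 2)) := by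
  rw [q, Complex.exp_neg]

theorem q_sub_q_inv (b : ℝ) : q b - (q b)⁻¹ = 2 * I * (Real.sin (Real.pi * b ^ 2) : ℂ) := by
  rw [q_inv, q, Complex.ofReal_sin, Complex.sin]
  push_cast
  rw [show (Real.pi * I * (b : ℂ) ^ 2) = Real.pi * (b : ℂ) ^ 2 * I by ring,
    show -(Real.pi * (b : ℂ) ^ 2 * I) = -(Real.pi * (b : ℂ) ^ 2) * I by ring]
  linear_combination (exp (Real.pi * (b : ℂ) ^ 2 * I) - exp (-(Real.pi * (b : ℂ) ^ 2) * I)) * I_mul_I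

theorem sin_pi_sq_pos {b : ℝ} (hb0 : 0 < b) (hb1 : b < 1) : 0 < Real.sin (Real.pi * b ^ 2) := by
  refine Real.sin_pos_of_pos_of_lt_pi (by positivity) ?_
  have : b ^ 2 < 1 := by nlinarith
  nlinarith [Real.pi_pos]

theorem q_sub_q_inv_ne_zero {b : ℝ} (hb0 : 0 < b) (hb1 : b < 1) : q b - (q b)⁻¹ ≠ 0 := by
  rw [q_sub_q_inv]
  have := (sin_pi_sq_pos hb0 hb1).ne'
  have h2 : (Real.sin (Real.pi * b ^ 2) : ℂ) ≠ 0 := Complex.ofReal_ne_zero.2 this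
  exact mul_ne_zero (mul_ne_zero two_ne_zero I_ne_zero) h2

theorem opE_apply (b : ℝ) (α : ℂ) (f : ℂ → ℂ) (z : ℂ) :
    opE b α f z = exp (2 * Real.pi * b * z) * ((q b - (q b)⁻¹)⁻¹ *
      (exp (Real.pi * I * b * (Q b - α)) * f (z + I * (b / 2 : ℝ)) -
        (exp (Real.pi * I * b * (Q b - α)))⁻¹ * f (z + I * (-(b / 2) : ℝ)))) := by
  rw [← Complex.exp_neg]
  rfl

theorem opF_apply (b : ℝ) (α : ℂ) (f : ℂ → ℂ) (z : ℂ) :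
    opF b α f z = (exp (2 * Real.pi * b * z))⁻¹ * ((q b - (q b)⁻¹)⁻¹ *
      ((exp (Real.pi * I * b * (Q b - α)))⁻¹ * f (z + I * (b / 2 : ℝ)) -
        exp (Real.pi * I * b * (Q b - α)) * f (z + I * (-(b / 2) : ℝ)))) := by
  rw [← Complex.exp_neg, ← Complex.exp_neg,
    show -(Real.pi * I * b * (Q b - α)) = Real.pi * I * b * (α - Q b) by ring,
    show Real.pi * I * b * (Q b - α) = -(Real.pi * I * b * (α - Q b)) by ring]
  rfl

theorem shift_plus_plus (b : ℝ) (z : ℂ) :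
    z + I * (b / 2 : ℝ) + I * (b / 2 : ℝ) = z + I * b := by push_cast; ring

theorem shift_plus_minus (b : ℝ) (z : ℂ) :
    z + I * (b / 2 : ℝ) + I * (-(b / 2) : ℝ) = z := by push_cast; ring

theorem shift_minus_plus (b : ℝ) (z : ℂ) :
    z + I * (-(b / 2) : ℝ) + I * (b / 2 : ℝ) = z := by push_cast; ring

theorem shift_minus_minus (b : ℝ) (z : ℂ) :
    z + I * (-(b / 2) : ℝ) + I * (-(b / 2) : ℝ) = z - I * b := by push_cast; ring

theorem exp_shift_plus (b : ℝ) (z : ℂ) :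
    exp (2 * Real.pi * b * (z + I * (b / 2 : ℝ))) = exp (2 * Real.pi * b * z) * q b := by
  rw [q, ← Complex.exp_add]; congr 1; push_cast; ring

theorem exp_shift_minus (b : ℝ) (z : ℂ) :
    exp (2 * Real.pi * b * (z + I * (-(b / 2) : ℝ))) = exp (2 * Real.pi * b * z) * (q b)⁻¹ := by
  rw [q_inv, ← Complex.exp_add]; congr 1; push_cast; ring

theorem opK_opKinv (b : ℝ) (f : ℂ → ℂ) : opK b (opKinv b f) = f := by
  funext z
  exact congrArg f (shift_plus_minus b z)

theorem opKinv_opK (b : ℝ) (f : ℂ → ℂ) : opKinv b (opK b f) = f := by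
  funext z
  exact congrArg f (shift_minus_plus b z)

theorem opK_opE (b : ℝ) (α : ℂ) (f : ℂ → ℂ) :
    opK b (opE b α f) = q b • opE b α (opK b f) := by
  funext z
  rw [Pi.smul_apply, smul_eq_mul]
  change opE b α f (z + I * (b / 2 : ℝ)) = _
  rw [opE_apply, opE_apply]
  change _ = q b * (_ * (_ * (_ * f (_ + _) - _ * f (_ + _))))
  rw [shift_plus_plus, shift_plus_minus, shift_minus_plus, exp_shift_plus]
  ring

theorem opK_opF (b : ℝ) (α : ℂ) (f : ℂ → ℂ) :
    opK b (opF b α f) = (q b)⁻¹ • opF b α (opK b f) := by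
  funext z
  rw [Pi.smul_apply, smul_eq_mul]
  change opF b α f (z + I * (b / 2 : ℝ)) = _
  rw [opF_apply, opF_apply]
  change _ = (q b)⁻¹ * (_ * (_ * (_ * f (_ + _) - _ * f (_ + _))))
  rw [shift_plus_plus, shift_plus_minus, shift_minus_plus, exp_shift_plus, mul_inv]
  ring

theorem opE_opF_apply (b : ℝ) (α : ℂ) (f : ℂ → ℂ) (z : ℂ) :
    opE b α (opF b α f) z = ((q b - (q b)⁻¹)⁻¹) ^ 2 *
      ((q b)⁻¹ * f (z + I * b) - exp (Real.pi * I * b * (Q b - α)) ^ 2 * (q b)⁻¹ * f z -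
        (exp (Real.pi * I * b * (Q b - α)))⁻¹ ^ 2 * q b * f z + q b * f (z - I * b)) := by
  rw [opE_apply, opF_apply, opF_apply, shift_plus_plus, shift_plus_minus, shift_minus_plus,
    shift_minus_minus, exp_shift_plus, exp_shift_minus]
  have h1 : exp (2 * Real.pi * b * z) ≠ 0 := Complex.exp_ne_zero _
  have h2 : exp (Real.pi * I * b * (Q b - α)) ≠ 0 := Complex.exp_ne_zero _
  have h3 := q_ne_zero b
  -- With the prefactor opaque, this is a rational identity in three nonzero exponentials.
  generalize (q b - (q b)⁻¹)⁻¹ = k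
  field_simp
  ring

theorem opF_opE_apply (b : ℝ) (α : ℂ) (f : ℂ → ℂ) (z : ℂ) :
    opF b α (opE b α f) z = ((q b - (q b)⁻¹)⁻¹) ^ 2 *
      (q b * f (z + I * b) - exp (Real.pi * I * b * (Q b - α)) ^ 2 * (q b)⁻¹ * f z -
        (exp (Real.pi * I * b * (Q b - α)))⁻¹ ^ 2 * q b * f z + (q b)⁻¹ * f (z - I * b)) := by
  rw [opF_apply, opE_apply, opE_apply, shift_plus_plus, shift_plus_minus, shift_minus_plus,
    shift_minus_minus, exp_shift_plus, exp_shift_minus]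
  have h1 : exp (2 * Real.pi * b * z) ≠ 0 := Complex.exp_ne_zero _
  have h2 : exp (Real.pi * I * b * (Q b - α)) ≠ 0 := Complex.exp_ne_zero _
  have h3 := q_ne_zero b
  generalize (q b - (q b)⁻¹)⁻¹ = k
  field_simp
  ring

theorem opE_opF_sub_opF_opE {b : ℝ} (hb0 : 0 < b) (hb1 : b < 1) (α : ℂ) (f : ℂ → ℂ) :
    opE b α (opF b α f) - opF b α (opE b α f) =
      -((q b - (q b)⁻¹)⁻¹ • (opK b (opK b f) - opKinv b (opKinv b f))) := by
  funext z
  rw [Pi.sub_apply, opE_opF_apply, opF_opE_apply, Pi.neg_apply, Pi.smul_apply, Pi.sub_apply,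
    smul_eq_mul]
  change _ = -(_ * (f (_ + _ + _) - f (_ + _ + _)))
  rw [shift_plus_plus, shift_minus_minus]
  have h := mul_inv_cancel₀ (q_sub_q_inv_ne_zero hb0 hb1)
  linear_combination ((q b - (q b)⁻¹)⁻¹ * (f (z - I * b) - f (z + I * b))) * h

/-- The value of the `q`-Casimir. -/
def casimir (b : ℝ) (α : ℂ) : ℝ :=
  -(Real.cosh (Real.pi * b * α.im) / Real.sin (Real.pi * b ^ 2)) ^ 2

/-- On the line Re α = Q/2 one has b(Q - α) = b²/2 + 1/2 - i b Im α, and the summand 1/2 produces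
the factor i. That factor turns the difference of exponentials in the bracket into a hyperbolic
cosine. -/
theorem exp_Q_sub {b : ℝ} (hb0 : 0 < b) {α : ℂ} (hα : α.re = Q b / 2) :
    exp (Real.pi * I * b * (Q b - α)) =
      I * exp (Real.pi * b * α.im) * exp (Real.pi * b ^ 2 / 2 * I) := by
  have hb : (b : ℂ) ≠ 0 := Complex.ofReal_ne_zero.2 hb0.ne'
  have h1 : α = Q b / 2 + α.im * I := by
    conv_lhs => rw [← Complex.re_add_im α, hα]
    push_cast; ring
  have h2 : I = exp (Real.pi / 2 * I) := by rw [Complex.exp_pi_div_two_mul_I]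
  conv_rhs => rw [h2]
  rw [← Complex.exp_add, ← h2, ← Complex.exp_add]
  congr 1
  conv_lhs => rw [h1]
  rw [Q]
  push_cast
  field_simp
  linear_combination (-2 * (b : ℂ) * α.im) * I_mul_I

/-- In F E the coefficients of f(z ± ib) are exactly those of the subtracted term, so only a
multiple of f(z) survives. The summand 2 completes e^{2πbp} + e^{-2πbp}, p = Im α, to 4 cosh²(πbp),
while (q - q⁻¹)² = -4 sin²(πb²). -/
theorem opC_eq {b : ℝ} (hb0 : 0 < b) (hb1 : b < 1) {α : ℂ} (hα : α.re = Q b / 2) (f : ℂ → ℂ) :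
    opC b α f = (casimir b α : ℂ) • f := by
  funext z
  change opF b α (opE b α f) z - ((q b - (q b)⁻¹) ^ 2)⁻¹ * (q b * f (_ + _ + _) +
    (q b)⁻¹ * f (_ + _ + _) - 2 * f z) = (casimir b α : ℂ) * f z
  rw [opF_opE_apply, shift_plus_plus, shift_minus_minus, exp_Q_sub hb0 hα, q_sub_q_inv, casimir]
  have hq : exp (Real.pi * b ^ 2 / 2 * I) ^ 2 = q b := by
    rw [← Complex.exp_nat_mul, q]; congr 1; push_cast; ring
  have hs : (Real.sin (Real.pi * b ^ 2) : ℂ) ≠ 0 :=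
    Complex.ofReal_ne_zero.2 (sin_pi_sq_pos hb0 hb1).ne'
  have h3 := q_ne_zero b
  have h4 : exp (Real.pi * b * α.im) ≠ 0 := Complex.exp_ne_zero _
  have h5 : exp (Real.pi * b ^ 2 / 2 * I) ≠ 0 := Complex.exp_ne_zero _
  have hc : (Real.cosh (Real.pi * b * α.im) : ℂ) =
      (exp (Real.pi * b * α.im) + (exp (Real.pi * b * α.im))⁻¹) / 2 := by
    rw [Complex.ofReal_cosh, Complex.cosh, Complex.exp_neg]; push_cast; rfl
  push_cast at hc ⊢
  rw [hc, ← hq]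
  push_cast at hs
  generalize sin (Real.pi * (b : ℂ) ^ 2) = s at *
  generalize exp (Real.pi * b * α.im) = e at *
  generalize exp (Real.pi * b ^ 2 / 2 * I) = r at *
  simp only [mul_pow, mul_inv, inv_pow, I_sq]
  field_simp
  ring

/-! ### The space `𝒫_α` in terms of the Fourier transform -/

theorem Q_pos {b : ℝ} (hb0 : 0 < b) : 0 < Q b := add_pos hb0 (inv_pos.2 hb0)

theorem lt_Q_half {b : ℝ} (hb0 : 0 < b) (hb1 : b < 1) : b < Q b / 2 := by
  have : 1 < b⁻¹ := (one_lt_inv₀ hb0).2 hb1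
  rw [Q]; linarith

/-- All poles lie on two vertical lines and outside |Im w| < Q/2. Hence shifts by ±ib cross no pole,
and meromorphic corrections are needed only in a bounded range of Re w. -/
theorem poles_re_im {b : ℝ} (hb0 : 0 < b) {α : ℂ} (hα : α.re = Q b / 2) {w : ℂ}
    (hw : w ∈ poles b α) : |w.re| = |α.im| ∧ Q b / 2 ≤ |w.im| := by
  obtain ⟨n, m, h | h⟩ := hw
  all_goals
    have hnm : 0 ≤ n * b + m * b⁻¹ := by positivity
    have hre : ((m : ℂ) * (b : ℂ)⁻¹).re = m * b⁻¹ := by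
      rw [← Complex.ofReal_inv, ← Complex.ofReal_natCast, ← Complex.ofReal_mul, Complex.ofReal_re]
    have him : ((m : ℂ) * (b : ℂ)⁻¹).im = 0 := by
      rw [← Complex.ofReal_inv, ← Complex.ofReal_natCast, ← Complex.ofReal_mul, Complex.ofReal_im]
  · have h1 : w.re = -α.im := by rw [h]; simp [him]
    have h2 : w.im = -(Q b / 2 + (n * b + m * b⁻¹)) := by
      rw [h, Complex.I_mul_im, Complex.sub_re, Complex.sub_re, Complex.sub_re, hre, hα]
      simp; ring
    rw [h1, h2, abs_neg, abs_neg]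
    exact ⟨rfl, (by linarith : Q b / 2 ≤ _).trans (le_abs_self _)⟩
  · have h1 : w.re = α.im := by rw [h]; simp [him]
    have h2 : w.im = Q b / 2 + (n * b + m * b⁻¹) := by
      rw [h, Complex.I_mul_im, Complex.add_re, Complex.add_re, Complex.sub_re, hre, hα]
      simp; ring
    rw [h1, h2]
    exact ⟨rfl, (by linarith : Q b / 2 ≤ _).trans (le_abs_self _)⟩

theorem neg_mem_poles {b : ℝ} {α w : ℂ} (hw : w ∈ poles b α) : -w ∈ poles b α := by
  obtain ⟨n, m, rfl | rfl⟩ := hw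
  · exact ⟨n, m, Or.inr (by ring)⟩
  · exact ⟨n, m, Or.inl (by ring)⟩

theorem IsTransform.stripDecay {b : ℝ} (hb0 : 0 < b) {α : ℂ} (hα : α.re = Q b / 2) {G : ℂ → ℂ}
    (hG : IsTransform b α G) {r : ℝ} (hr : r < Q b / 2) : StripDecay (-r) r G := by
  refine StripDecay.of_eventually (fun w h1 h2 => (hG.analyticAt w fun hw => ?_).differentiableAt)
    fun a => ?_
  · have h3 := (poles_re_im hb0 hα hw).2
    have h4 : |w.im| ≤ r := abs_le.2 ⟨h1, h2⟩
    linarith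
  · obtain ⟨M, C, h⟩ := hG.decay r a
    exact ⟨M, C, fun w h1 h2 => h w (abs_le.2 ⟨h1, h2⟩)⟩

theorem IsTransform.meromorphic {b : ℝ} {α : ℂ} {G : ℂ → ℂ} (hG : IsTransform b α G) (w : ℂ) :
    MeromorphicAt G w := by
  by_cases hw : w ∈ poles b α
  · exact hG.meromorphicAt w hw
  · exact (hG.analyticAt w hw).meromorphicAt

theorem IsTransform.order_ge {b : ℝ} {α : ℂ} {G : ℂ → ℂ} (hG : IsTransform b α G) (w : ℂ) :
    -1 ≤ meromorphicOrderAt G w := by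
  by_cases hw : w ∈ poles b α
  · exact hG.order w hw
  · refine le_trans ?_ (hG.analyticAt w hw).meromorphicOrderAt_nonneg
    decide

/-- Fourier inversion gives equality on the real line and the identity theorem extends it to ℂ. All
later computations can thus be made on `G`. -/
theorem eq_invF_of_mem_space {b : ℝ} (hb0 : 0 < b) {α : ℂ} (hα : α.re = Q b / 2) {f : ℂ → ℂ}
    (hf : f ∈ space b α) : ∃ G, IsTransform b α G ∧ f = invF G ∧
      ∀ w : ℝ, 𝓕 (fun x : ℝ => f x) w = G w := by
  obtain ⟨hd, h1, h2, G, hG, hfG⟩ := hf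
  refine ⟨G, hG, ?_, hfG⟩
  have hs := hG.stripDecay hb0 hα (r := 0) (by linarith [Q_pos hb0])
  have hFG : 𝓕 (fun x : ℝ => f x) = fun w : ℝ => G w := funext hfG
  have hreal (x : ℝ) : f x = invF G x := by
    rw [invF_ofReal, ← hFG]
    have h3 : Integrable (𝓕 (fun x : ℝ => f x)) := by
      rw [hFG]; exact hs.integrable (by simp) le_rfl
    have h4 : Continuous fun x : ℝ => f x := hd.continuous.comp Complex.continuous_ofReal
    exact (congrFun (h4.fourierInv_fourier_eq h1 h3) x).symm
  have hd2 := differentiable_invF hs (by simp) le_rfl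
  have han1 : AnalyticOnNhd ℂ f Set.univ := fun z _ => hd.analyticAt z
  have han2 : AnalyticOnNhd ℂ (invF G) Set.univ := fun z _ => hd2.analyticAt z
  refine han1.eq_of_frequently_eq han2 (z₀ := 0) ?_
  -- Nonzero reals accumulate at 0, so agreement on the line is agreement on a set with a limit
  -- point.
  have h5 : Filter.Tendsto (fun x : ℝ => (x : ℂ)) (nhdsWithin 0 {0}ᶜ) (nhdsWithin 0 {0}ᶜ) := by
    refine tendsto_nhdsWithin_iff.2 ⟨?_, ?_⟩
    · have : Filter.Tendsto (fun x : ℝ => (x : ℂ)) (nhds 0) (nhds ((0 : ℝ) : ℂ)) :=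
        Complex.continuous_ofReal.tendsto 0
      rw [Complex.ofReal_zero] at this
      exact this.mono_left nhdsWithin_le_nhds
    · filter_upwards [self_mem_nhdsWithin] with x hx
      simpa using hx
  exact h5.frequently (Filter.Frequently.of_forall hreal)

theorem invF_mem_space {b : ℝ} (hb0 : 0 < b) {α : ℂ} (hα : α.re = Q b / 2) {G : ℂ → ℂ}
    (hG : IsTransform b α G) : invF G ∈ space b α := by
  have hQ := Q_pos hb0
  have hs := hG.stripDecay hb0 hα (r := Q b / 4) (by linarith)
  obtain ⟨h1, h2⟩ := integrable_memLp_invF (by linarith) hs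
  exact ⟨differentiable_invF hs (by linarith) (by linarith), h1, h2, G, hG,
    fourier_invF (by linarith) hs⟩

/-! ### The symbol of E and the cancellation of poles -/

/-- Meromorphic functions with removable singularities outside `poles b α` can be corrected. -/
theorem exists_isTransform {b : ℝ} {α : ℂ} {H : ℂ → ℂ} {B : ℝ} (hm : ∀ w, MeromorphicAt H w)
    (hord : ∀ w ∈ poles b α, -1 ≤ meromorphicOrderAt H w)
    (hoff : ∀ w, w ∉ poles b α → 0 ≤ meromorphicOrderAt H w)
    (han : ∀ w : ℂ, B < |w.re| → AnalyticAt ℂ H w)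
    (hdecay : ∀ R a : ℝ, ∃ M C : ℝ, ∀ w : ℂ, |w.im| ≤ R → M ≤ |w.re| →
      ‖H w‖ ≤ C * Real.exp (-(a * |w.re|))) :
    ∃ G, IsTransform b α G ∧ ∀ w, AnalyticAt ℂ H w → G w = H w := by
  -- Passing to the meromorphic normal form repairs the values at removable singularities and
  -- changes nothing where `H` is already analytic.
  have hm' : MeromorphicOn H Set.univ := fun w _ => hm w
  have heq (w : ℂ) (hw : AnalyticAt ℂ H w) : toMeromorphicNFOn H Set.univ w = H w := by
    rw [toMeromorphicNFOn_eq_toMeromorphicNFAt hm' (Set.mem_univ w),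
      toMeromorphicNFAt_eq_self.2 hw.meromorphicNFAt]
  have hord' (w : ℂ) : meromorphicOrderAt (toMeromorphicNFOn H Set.univ) w =
      meromorphicOrderAt H w := meromorphicOrderAt_toMeromorphicNFOn hm' (Set.mem_univ w)
  have hnf (w : ℂ) := meromorphicNFOn_toMeromorphicNFOn H Set.univ (Set.mem_univ w)
  refine ⟨toMeromorphicNFOn H Set.univ, ⟨fun w hw => ?_, fun w _ => (hnf w).meromorphicAt,
    fun w hw => (hord w hw).trans_eq (hord' w).symm, fun R a => ?_⟩, heq⟩
  · exact (hnf w).meromorphicOrderAt_nonneg_iff_analyticAt.1 ((hoff w hw).trans_eq (hord' w).symm)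
  · obtain ⟨M, C, h⟩ := hdecay R a
    -- The added 1 gives the strict inequality B < |Re w|, where the normal form agrees with `H`
    -- pointwise and inherits its decay.
    refine ⟨max M (B + 1), C, fun w h1 h2 => ?_⟩
    have h3 := (le_max_right M (B + 1)).trans h2
    rw [heq w (han w (by linarith))]
    exact h w h1 ((le_max_left _ _).trans h2)

theorem decay_mul {F H : ℂ → ℂ}
    (hF : ∀ R : ℝ, ∃ a C : ℝ, ∀ w : ℂ, |w.im| ≤ R → ‖F w‖ ≤ C * Real.exp (a * |w.re|))
    (hH : ∀ R a : ℝ, ∃ M C : ℝ, ∀ w : ℂ, |w.im| ≤ R → M ≤ |w.re| →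
      ‖H w‖ ≤ C * Real.exp (-(a * |w.re|))) :
    ∀ R a : ℝ, ∃ M C : ℝ, ∀ w : ℂ, |w.im| ≤ R → M ≤ |w.re| →
      ‖F w * H w‖ ≤ C * Real.exp (-(a * |w.re|)) := by
  intro R a
  obtain ⟨a', C', hC'⟩ := hF R
  obtain ⟨M, C, hC⟩ := hH R (a + a')
  refine ⟨M, C' * C, fun w h1 h2 => ?_⟩
  rw [norm_mul]
  refine (mul_le_mul (hC' w h1) (hC w h1 h2) (norm_nonneg _)
    ((norm_nonneg _).trans (hC' w h1))).trans_eq ?_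
  rw [mul_mul_mul_comm, ← Real.exp_add]
  ring_nf

theorem growth_exp_mul (z : ℂ) (R : ℝ) :
    ∃ a C : ℝ, ∀ w : ℂ, |w.im| ≤ R → ‖exp (z * w)‖ ≤ C * Real.exp (a * |w.re|) :=
  ⟨‖z‖, _, fun w h => StripDecay.norm_exp_mul_le (c := -R) (d := R) z w (abs_le.1 h).1
    (abs_le.1 h).2⟩

theorem IsTransform.exp_mul {b : ℝ} {α : ℂ} {G : ℂ → ℂ} (hG : IsTransform b α G) (z : ℂ) :
    IsTransform b α fun w => exp (z * w) * G w := by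
  have han (w : ℂ) : AnalyticAt ℂ (fun w => exp (z * w)) w := by fun_prop
  refine ⟨fun w hw => (han w).mul (hG.analyticAt w hw), fun w hw =>
    (han w).meromorphicAt.mul (hG.meromorphicAt w hw), fun w hw => ?_,
    decay_mul (growth_exp_mul z) hG.decay⟩
  exact (hG.order w hw).trans_eq
    (meromorphicOrderAt_mul_of_ne_zero (han w) (Complex.exp_ne_zero _)).symm

theorem IsTransform.comp_neg {b : ℝ} {α : ℂ} {G : ℂ → ℂ} (hG : IsTransform b α G) :
    IsTransform b α fun w => G (-w) := by
  have han (w : ℂ) : AnalyticAt ℂ (fun w : ℂ => -w) w := by fun_prop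
  have hder (w : ℂ) : deriv (fun w : ℂ => -w) w ≠ 0 := by simp
  refine ⟨fun w hw => ?_, fun w _ => ?_, fun w _ => ?_, fun R a => ?_⟩
  · exact (hG.analyticAt (-w) fun h => hw (by simpa using neg_mem_poles h)).comp (han w)
  · exact (hG.meromorphic (-w)).comp_analyticAt (han w)
  · exact (hG.order_ge (-w)).trans_eq
      (meromorphicOrderAt_comp_of_deriv_ne_zero (f := G) (han w) (hder w)).symm
  · obtain ⟨M, C, h⟩ := hG.decay R a
    refine ⟨M, C, fun w h1 h2 => ?_⟩
    simpa using h (-w) (by simpa) (by simpa)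

/-- The function `cosh(π b (w - p + i b / 2)) / sin(π b²)`. -/
def multE (b p : ℝ) (w : ℂ) : ℂ :=
  cosh (Real.pi * b * (w - p) + Real.pi * b ^ 2 / 2 * I) / (Real.sin (Real.pi * b ^ 2) : ℂ)

theorem differentiable_multE (b p : ℝ) : Differentiable ℂ (multE b p) := by
  unfold multE
  fun_prop

theorem multE_eq (b p : ℝ) (w : ℂ) : multE b p w =
    (2 * (Real.sin (Real.pi * b ^ 2) : ℂ))⁻¹ *
      (exp (-(Real.pi * b * p) + Real.pi * b ^ 2 / 2 * I) * exp (Real.pi * b * w) +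
        exp (Real.pi * b * p - Real.pi * b ^ 2 / 2 * I) * exp (-(Real.pi * b) * w)) := by
  rw [multE, Complex.cosh, ← Complex.exp_add, ← Complex.exp_add, mul_inv]
  ring_nf

theorem growth_multE (b p : ℝ) (R : ℝ) :
    ∃ a C : ℝ, ∀ w : ℂ, |w.im| ≤ R → ‖multE b p w‖ ≤ C * Real.exp (a * |w.re|) := by
  obtain ⟨a1, C1, h1⟩ := growth_exp_mul (Real.pi * b) R
  obtain ⟨a2, C2, h2⟩ := growth_exp_mul (-(Real.pi * b)) R
  refine ⟨max a1 a2, ‖(2 * (Real.sin (Real.pi * b ^ 2) : ℂ))⁻¹‖ *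
    (‖exp (-(Real.pi * b * p) + Real.pi * b ^ 2 / 2 * I)‖ * |C1| +
      ‖exp (Real.pi * b * p - Real.pi * b ^ 2 / 2 * I)‖ * |C2|), fun w hw => ?_⟩
  have h3 : ‖exp (Real.pi * b * w)‖ ≤ |C1| * Real.exp (max a1 a2 * |w.re|) := by
    refine (h1 w hw).trans ?_
    gcongr
    · exact le_abs_self _
    · exact le_max_left _ _
  have h4 : ‖exp (-(Real.pi * b) * w)‖ ≤ |C2| * Real.exp (max a1 a2 * |w.re|) := by
    refine (h2 w hw).trans ?_
    gcongr
    · exact le_abs_self _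
    · exact le_max_right _ _
  rw [multE_eq, norm_mul]
  refine (mul_le_mul_of_nonneg_left ?_ (norm_nonneg _)).trans_eq (mul_assoc _ _ _).symm
  refine (norm_add_le _ _).trans ?_
  rw [norm_mul, norm_mul, add_mul]
  exact add_le_add ((mul_le_mul_of_nonneg_left h3 (norm_nonneg _)).trans_eq (mul_assoc _ _ _).symm)
    ((mul_le_mul_of_nonneg_left h4 (norm_nonneg _)).trans_eq (mul_assoc _ _ _).symm)

/-- `multE` vanishes at the points `p + i (Q/2 - b + m/b)`. -/
theorem multE_eq_zero {b : ℝ} (hb0 : 0 < b) {α : ℂ} (hα : α.re = Q b / 2) {w : ℂ} {m : ℕ}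
    (hw : w + I * b = I * (Q b - α + m * (b : ℂ)⁻¹)) : multE b α.im w = 0 := by
  have hb : (b : ℂ) ≠ 0 := Complex.ofReal_ne_zero.2 hb0.ne'
  have h1 : α = Q b / 2 + α.im * I := by
    conv_lhs => rw [← Complex.re_add_im α, hα]
    push_cast; ring
  have h2 : w - α.im = I * (Q b / 2 - b + m * (b : ℂ)⁻¹) := by
    rw [eq_sub_of_add_eq hw]
    conv_lhs => rw [h1]
    simp only [Complex.add_im, Complex.mul_im, Complex.ofReal_re, Complex.ofReal_im, Complex.I_re,
      Complex.I_im]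
    have : (((Q b : ℂ) / 2).im) = 0 := by
      rw [← Complex.ofReal_ofNat, ← Complex.ofReal_div, Complex.ofReal_im]
    rw [this]
    push_cast
    linear_combination (-(α.im : ℂ)) * I_mul_I
  rw [multE, h2, div_eq_zero_iff]
  left
  rw [show Real.pi * b * (I * (Q b / 2 - b + m * (b : ℂ)⁻¹)) + Real.pi * b ^ 2 / 2 * I =
      ((2 * (m : ℤ) + 1) * Real.pi / 2) * I by
    rw [Q]; push_cast; field_simp; ring, Complex.cosh_mul_I, Complex.cos_eq_zero_iff]
  exact ⟨m, rfl⟩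

/-- Lowering the poles by b maps the lower family into itself and the upper family into itself,
apart from its members with n = 0. These leave the allowed set unless they meet it elsewhere, and at
them the symbol vanishes, which cancels a simple pole. -/
theorem IsTransform.exists_multE_mul {b : ℝ} (hb0 : 0 < b) {α : ℂ}
    (hα : α.re = Q b / 2) {G : ℂ → ℂ} (hG : IsTransform b α G) :
    ∃ G', IsTransform b α G' ∧
      ∀ w, w + I * b ∉ poles b α → G' w = multE b α.im w * G (w + I * b) := by
  have hm (w : ℂ) : AnalyticAt ℂ (multE b α.im) w := (differentiable_multE b α.im).analyticAt w
  have hGm (w : ℂ) : MeromorphicAt (fun w => G (w + I * b)) w :=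
    (hG.meromorphic (w + I * b)).comp_analyticAt (g := fun w => w + I * b) (by fun_prop)
  have hGo (w : ℂ) : meromorphicOrderAt (fun w => G (w + I * b)) w =
      meromorphicOrderAt G (w + I * b) := meromorphicOrderAt_comp_add_const_eq_meromorphicOrderAt
  have hord (w : ℂ) : meromorphicOrderAt (fun w => multE b α.im w * G (w + I * b)) w =
      meromorphicOrderAt (multE b α.im) w + meromorphicOrderAt G (w + I * b) := by
    rw [← hGo]
    exact meromorphicOrderAt_mul (hm w).meromorphicAt (hGm w)
  have han (w : ℂ) (hw : w + I * b ∉ poles b α) :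
      AnalyticAt ℂ (fun w => multE b α.im w * G (w + I * b)) w :=
    (hm w).mul ((hG.analyticAt _ hw).comp (g := G) (f := fun w => w + I * b) (by fun_prop))
  have hdec : ∀ R a : ℝ, ∃ M C : ℝ, ∀ w : ℂ, |w.im| ≤ R → M ≤ |w.re| →
      ‖G (w + I * b)‖ ≤ C * Real.exp (-(a * |w.re|)) := by
    intro R a
    obtain ⟨M, C, h⟩ := hG.decay (R + b) a
    refine ⟨M, C, fun w h1 h2 => ?_⟩
    have hre : (w + I * b).re = w.re := by simp
    have him : (w + I * b).im = w.im + b := by simp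
    have := h (w + I * b) ?_ (by rwa [hre])
    · rwa [hre] at this
    · rw [him]
      exact (abs_add_le _ _).trans (by rw [abs_of_pos hb0]; linarith)
  suffices ∃ G', IsTransform b α G' ∧
      ∀ w, AnalyticAt ℂ (fun w => multE b α.im w * G (w + I * b)) w →
        G' w = multE b α.im w * G (w + I * b) from
    let ⟨G', h1, h2⟩ := this
    ⟨G', h1, fun w hw => h2 w (han w hw)⟩
  refine exists_isTransform (B := |α.im|) (fun w => (hm w).meromorphicAt.mul (hGm w))
    (fun w _ => ?_) (fun w hw => ?_) (fun w hw => ?_) (decay_mul (growth_multE b α.im) hdec)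
  · rw [hord]
    exact (hG.order_ge (w + I * b)).trans
      (le_add_of_nonneg_left (hm w).meromorphicOrderAt_nonneg)
  · by_cases hwp : w + I * b ∈ poles b α
    · have h0 : multE b α.im w = 0 := by
        obtain ⟨n, m, h | h⟩ := hwp
        -- Lower family: the shift raises the index n by one.
        · exact absurd ⟨n + 1, m, Or.inl (by rw [eq_sub_of_add_eq h]; push_cast; ring)⟩ hw
        · rcases n with _ | n
          -- Upper family with n = 0: a zero of the symbol.
          · exact multE_eq_zero hb0 hα (m := m) (by rw [h]; simp)
          -- Upper family with positive index: the shift lowers it by one.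
          · exact absurd ⟨n, m, Or.inr (by rw [eq_sub_of_add_eq h]; push_cast; ring)⟩ hw
      have h1 : 1 ≤ meromorphicOrderAt (multE b α.im) w := by
        rw [(hm w).meromorphicOrderAt_eq]
        have h3 : analyticOrderAt (multE b α.im) w ≠ 0 := by
          rw [ne_eq, (hm w).analyticOrderAt_eq_zero]; simpa using h0
        have h4 : 1 ≤ analyticOrderAt (multE b α.im) w := Order.one_le_iff_ne_zero.2 h3
        generalize analyticOrderAt (multE b α.im) w = k at h4
        cases k with
        | top => exact le_top
        | coe k =>
          have : (1 : ℕ) ≤ k := by exact_mod_cast h4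
          rw [ENat.map_natCast]
          exact_mod_cast this
      rw [hord]
      -- A zero of order at least one offsets a pole of order at most one.
      calc (0 : WithTop ℤ) = 1 + -1 := by decide
        _ ≤ _ := add_le_add h1 (hG.order_ge _)
    · exact (han w hwp).meromorphicOrderAt_nonneg
  · refine han w fun h => ?_
    have h3 := (poles_re_im hb0 hα h).1
    rw [show (w + I * b).re = w.re by simp] at h3
    linarith

/-! ### The action of the generators on Fourier transforms -/

theorem invF_const_mul (k : ℂ) (H : ℂ → ℂ) (z : ℂ) :
    invF (fun w => k * H w) z = k * invF H z := by
  rw [invF, invF, ← integral_const_mul]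
  simp only [mul_left_comm]

theorem invF_sub {c d : ℝ} {G H : ℂ → ℂ} (hG : StripDecay c d G) (hH : StripDecay c d H)
    (h1 : c ≤ 0) (h2 : 0 ≤ d) (z : ℂ) :
    invF (fun w => G w - H w) z = invF G z - invF H z := by
  rw [invF, invF, invF, ← integral_sub ((hG.exp_mul (2 * Real.pi * I * z)).integrable h1 h2)
    ((hH.exp_mul (2 * Real.pi * I * z)).integrable h1 h2)]
  simp only [mul_sub]

theorem StripDecay.sub {c d : ℝ} {G H : ℂ → ℂ} (hG : StripDecay c d G) (hH : StripDecay c d H) :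
    StripDecay c d fun w => G w - H w := by
  refine ⟨fun w h1 h2 => (hG.diff w h1 h2).sub (hH.diff w h1 h2), fun a => ?_⟩
  obtain ⟨C, hC⟩ := hG.decay a
  obtain ⟨C', hC'⟩ := hH.decay a
  refine ⟨C + C', fun w h1 h2 => ?_⟩
  rw [add_mul]
  exact (norm_sub_le _ _).trans (add_le_add (hC w h1 h2) (hC' w h1 h2))

theorem opK_invF (b : ℝ) (G : ℂ → ℂ) :
    opK b (invF G) = invF fun w => exp (-(Real.pi * b) * w) * G w := by
  funext z
  refine (invF_shift G (b / 2) z).trans (congrFun (congrArg invF (funext fun w => ?_)) z)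
  congr 2; push_cast; ring

theorem opKinv_invF (b : ℝ) (G : ℂ → ℂ) :
    opKinv b (invF G) = invF fun w => exp (Real.pi * b * w) * G w := by
  funext z
  refine (invF_shift G (-(b / 2)) z).trans (congrFun (congrArg invF (funext fun w => ?_)) z)
  congr 2; push_cast; ring

/-- The common computation for both generators, with η = b for E and η = -b for F: imaginary shifts
become exponential factors, then the outer exponential shifts the contour. -/
theorem comb_invF {r : ℝ} (hr : 0 ≤ r) {G : ℂ → ℂ} (hG : StripDecay (-r) r G) (b η : ℝ)
    (hη : |η| ≤ r) (k A B z : ℂ) :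
    exp (2 * Real.pi * η * z) * (k * (A * invF G (z + I * (b / 2 : ℝ)) -
      B * invF G (z + I * (-(b / 2) : ℝ)))) =
    invF (fun w => k * (A * exp (-(Real.pi * b) * (w + I * η)) -
      B * exp (Real.pi * b * (w + I * η))) * G (w + I * η)) z := by
  have h1 := (hG.exp_mul (-(Real.pi * b))).const_mul A
  have h2 := (hG.exp_mul (Real.pi * b)).const_mul B
  have h3 := (h1.sub h2).const_mul k
  have h4 := invF_add_real_shift h3 (by linarith) hr (abs_le.1 hη).1 (abs_le.1 hη).2 z
  have h5 : invF G (z + I * (b / 2 : ℝ)) = invF (fun w => exp (-(Real.pi * b) * w) * G w) z :=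
    congrFun (opK_invF b G) z
  have h6 : invF G (z + I * (-(b / 2) : ℝ)) = invF (fun w => exp (Real.pi * b * w) * G w) z :=
    congrFun (opKinv_invF b G) z
  rw [invF_const_mul, invF_sub h1 h2 (by linarith) hr, invF_const_mul, invF_const_mul] at h4
  rw [h5, h6, h4]
  congr 1
  funext w
  ring

theorem multE_eq_comb {b : ℝ} (hb0 : 0 < b) {α : ℂ} (hα : α.re = Q b / 2) (w : ℂ) :
    (q b - (q b)⁻¹)⁻¹ * (exp (Real.pi * I * b * (Q b - α)) * exp (-(Real.pi * b) * (w + I * b)) -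
      (exp (Real.pi * I * b * (Q b - α)))⁻¹ * exp (Real.pi * b * (w + I * b))) =
      multE b α.im w := by
  rw [multE_eq, exp_Q_sub hb0 hα, mul_inv, mul_inv, inv_I, ← Complex.exp_neg, ← Complex.exp_neg,
    q_sub_q_inv]
  have h1 : exp (Real.pi * b * α.im) * exp (Real.pi * b ^ 2 / 2 * I) *
      exp (-(Real.pi * b) * (w + I * b)) =
      exp (Real.pi * b * α.im - Real.pi * b ^ 2 / 2 * I) * exp (-(Real.pi * b) * w) := by
    rw [← Complex.exp_add, ← Complex.exp_add, ← Complex.exp_add]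
    ring_nf
  have h2 : exp (-(Real.pi * b * α.im)) * exp (-(Real.pi * b ^ 2 / 2 * I)) *
      exp (Real.pi * b * (w + I * b)) =
      exp (-(Real.pi * b * α.im) + Real.pi * b ^ 2 / 2 * I) * exp (Real.pi * b * w) := by
    rw [← Complex.exp_add, ← Complex.exp_add, ← Complex.exp_add]
    ring_nf
  rw [← h1, ← h2, mul_inv, mul_inv, mul_inv, inv_I]
  linear_combination (-(2 : ℂ)⁻¹ * (Real.sin (Real.pi * b ^ 2) : ℂ)⁻¹ *
    (exp (Real.pi * b * α.im) * exp (Real.pi * b ^ 2 / 2 * I) *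
      exp (-(Real.pi * b) * (w + I * b)) +
    exp (-(Real.pi * b * α.im)) * exp (-(Real.pi * b ^ 2 / 2 * I)) *
      exp (Real.pi * b * (w + I * b)))) * I_mul_I

theorem multE_neg_eq_comb {b : ℝ} (hb0 : 0 < b) {α : ℂ} (hα : α.re = Q b / 2) (w : ℂ) :
    (q b - (q b)⁻¹)⁻¹ * ((exp (Real.pi * I * b * (Q b - α)))⁻¹ *
      exp (-(Real.pi * b) * (w + I * (-b : ℝ))) -
      exp (Real.pi * I * b * (Q b - α)) * exp (Real.pi * b * (w + I * (-b : ℝ)))) =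
      -multE b α.im (-w) := by
  rw [← multE_eq_comb hb0 hα, show -(Real.pi * b) * (w + I * (-b : ℝ)) =
    Real.pi * b * (-w + I * b) by push_cast; ring, show Real.pi * b * (w + I * (-b : ℝ)) =
    -(Real.pi * b) * (-w + I * b) by push_cast; ring]
  ring

theorem notMem_poles_of_real_add {b : ℝ} (hb0 : 0 < b) (hb1 : b < 1) {α : ℂ}
    (hα : α.re = Q b / 2) (x : ℝ) {η : ℝ} (hη : |η| ≤ b) :
    (x : ℂ) + I * η ∉ poles b α := by
  intro h
  have h1 := (poles_re_im hb0 hα h).2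
  have h2 := lt_Q_half hb0 hb1
  simp at h1
  linarith

theorem opE_invF {b : ℝ} (hb0 : 0 < b) (hb1 : b < 1) {α : ℂ}
    (hα : α.re = Q b / 2) {G : ℂ → ℂ} (hG : IsTransform b α G) :
    opE b α (invF G) = invF fun w => multE b α.im w * G (w + I * b) := by
  funext z
  rw [opE_apply, comb_invF hb0.le (hG.stripDecay hb0 hα (lt_Q_half hb0 hb1)) b b
    (abs_of_pos hb0).le]
  simp only [multE_eq_comb hb0 hα]

theorem opF_invF {b : ℝ} (hb0 : 0 < b) (hb1 : b < 1) {α : ℂ}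
    (hα : α.re = Q b / 2) {G : ℂ → ℂ} (hG : IsTransform b α G) :
    opF b α (invF G) =
    invF fun w => -(multE b α.im (-w) * G (w + I * (-b : ℝ))) := by
  funext z
  rw [opF_apply, ← Complex.exp_neg, show -(2 * Real.pi * b * z) = 2 * Real.pi * (-b : ℝ) * z by
    push_cast; ring, comb_invF hb0.le (hG.stripDecay hb0 hα (lt_Q_half hb0 hb1)) b (-b)
    (by rw [abs_neg, abs_of_pos hb0])]
  simp only [multE_neg_eq_comb hb0 hα]
  simp only [neg_mul]

/-- Only values on the real line enter `invF`, so the product may be replaced by its meromorphic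
correction, which agrees with it there. -/
theorem opE_invF_mem {b : ℝ} (hb0 : 0 < b) (hb1 : b < 1) {α : ℂ}
    (hα : α.re = Q b / 2) {G : ℂ → ℂ} (hG : IsTransform b α G) :
    opE b α (invF G) ∈ space b α := by
  obtain ⟨G', h1, h2⟩ := hG.exists_multE_mul hb0 hα
  rw [opE_invF hb0 hb1 hα hG, invF_congr fun x => (h2 x
    (notMem_poles_of_real_add hb0 hb1 hα x (abs_of_pos hb0).le)).symm]
  exact invF_mem_space hb0 hα h1

/-- The reflection w ↦ -w preserves the pole set and exchanges the two shifts, reducing this to the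
case of E up to sign. -/
theorem opF_invF_mem {b : ℝ} (hb0 : 0 < b) (hb1 : b < 1) {α : ℂ}
    (hα : α.re = Q b / 2) {G : ℂ → ℂ} (hG : IsTransform b α G) :
    opF b α (invF G) ∈ space b α := by
  obtain ⟨G', h1, h2⟩ := hG.comp_neg.exists_multE_mul hb0 hα
  have h3 : (fun w => -(multE b α.im (-w) * G (w + I * (-b : ℝ)))) =
      fun w => -(multE b α.im (-w) * G (-(-w + I * b))) := by
    funext w; congr 3; push_cast; ring
  rw [opF_invF hb0 hb1 hα hG, h3, invF_congr (H := fun w => -1 * G' (-w)) fun x => ?_]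
  · rw [show invF (fun w => -1 * G' (-w)) = (-1 : ℂ) • invF fun w => G' (-w) from
      funext fun z => invF_const_mul _ _ z]
    exact (space b α).smul_mem _ (invF_mem_space hb0 hα h1.comp_neg)
  · rw [h2 (-x), neg_one_mul]
    have := notMem_poles_of_real_add hb0 hb1 hα (-x) (abs_of_pos hb0).le
    push_cast at this
    exact this

theorem opK_invF_mem {b : ℝ} (hb0 : 0 < b) {α : ℂ} (hα : α.re = Q b / 2) {G : ℂ → ℂ}
    (hG : IsTransform b α G) : opK b (invF G) ∈ space b α := by
  rw [opK_invF]
  exact invF_mem_space hb0 hα (hG.exp_mul _)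

theorem opKinv_invF_mem {b : ℝ} (hb0 : 0 < b) {α : ℂ} (hα : α.re = Q b / 2) {G : ℂ → ℂ}
    (hG : IsTransform b α G) : opKinv b (invF G) ∈ space b α := by
  rw [opKinv_invF]
  exact invF_mem_space hb0 hα (hG.exp_mul _)

/-! ### Density -/

/-- The Gaussian `e^{-π w² + 2π i c w}`. -/
def gaussian (c : ℝ) (w : ℂ) : ℂ := exp (-Real.pi * w ^ 2 + 2 * Real.pi * I * c * w)

theorem isTransform_gaussian (b : ℝ) (α : ℂ) (c : ℝ) : IsTransform b α (gaussian c) := by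
  have han (w : ℂ) : AnalyticAt ℂ (gaussian c) w := by unfold gaussian; fun_prop
  refine ⟨fun w _ => han w, fun w _ => (han w).meromorphicAt, fun w _ =>
    le_trans (by decide) (han w).meromorphicOrderAt_nonneg, fun R a => ?_⟩
  -- Beyond |Re w| = |a| one has a|Re w| ≤ (Re w)² ≤ π(Re w)²; the constant collects what Im w
  -- contributes when |Im w| ≤ R.
  refine ⟨|a|, Real.exp (Real.pi * R ^ 2 + 2 * Real.pi * |c| * |R|), fun w h1 h2 => ?_⟩
  rw [gaussian, Complex.norm_exp, ← Real.exp_add, Real.exp_le_exp]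
  have h3 : (-Real.pi * w ^ 2 + 2 * Real.pi * I * c * w).re =
      -Real.pi * (w.re ^ 2 - w.im ^ 2) - 2 * Real.pi * c * w.im := by
    simp [pow_two]
    ring
  rw [h3]
  have h4 : w.im ^ 2 ≤ R ^ 2 := sq_le_sq.2 (h1.trans (le_abs_self R))
  have h5 : -(c * w.im) ≤ |c| * |R| := by
    refine (neg_le_abs _).trans ?_
    rw [abs_mul]
    exact mul_le_mul_of_nonneg_left (h1.trans (le_abs_self R)) (abs_nonneg c)
  have h6 : a * |w.re| ≤ w.re ^ 2 := by
    rw [← sq_abs, sq]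
    exact mul_le_mul_of_nonneg_right ((le_abs_self a).trans h2) (abs_nonneg _)
  have h7 : w.re ^ 2 ≤ Real.pi * w.re ^ 2 :=
    le_mul_of_one_le_left (sq_nonneg _) (by linarith [Real.pi_gt_three])
  nlinarith [Real.pi_pos, mul_le_mul_of_nonneg_left h4 Real.pi_pos.le,
    mul_le_mul_of_nonneg_left h5 Real.pi_pos.le]

/-- The subspace of `L²(ℝ)` given by `𝒫_α`. -/
def spaceL2 (b : ℝ) (α : ℂ) : Submodule ℂ L2R where
  carrier := {u : L2R | ∃ f ∈ space b α, Represents u f}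
  zero_mem' := ⟨0, (space b α).zero_mem, Lp.coeFn_zero _ _ _⟩
  add_mem' := by
    rintro u v ⟨f, hf, hu⟩ ⟨g, hg, hv⟩
    refine ⟨f + g, (space b α).add_mem hf hg, ?_⟩
    filter_upwards [Lp.coeFn_add u v, hu, hv] with x h1 h2 h3
    rw [h1, Pi.add_apply, h2, h3, Pi.add_apply]
  smul_mem' := by
    rintro c u ⟨f, hf, hu⟩
    refine ⟨c • f, (space b α).smul_mem c hf, ?_⟩
    filter_upwards [Lp.coeFn_smul c u, hu] with x h1 h2
    rw [h1, Pi.smul_apply, h2, Pi.smul_apply]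

/-- For h orthogonal to the space, testing with the Gaussians modulated by c says that the Fourier
transform at c of gaussian times ĥ vanishes. As c is arbitrary and the Gaussian has no zero, ĥ = 0.
-/
theorem dense_space {b : ℝ} (hb0 : 0 < b) {α : ℂ} (hα : α.re = Q b / 2) :
    Dense {u : L2R | ∃ f ∈ space b α, Represents u f} := by
  change Dense (spaceL2 b α : Set L2R)
  rw [Submodule.dense_iff_topologicalClosure_eq_top, Submodule.topologicalClosure_eq_top_iff,
    Submodule.eq_bot_iff]
  intro h hh
  have hg (c : ℝ) : MemLp (fun x : ℝ => gaussian c x) 2 :=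
    ((isTransform_gaussian b α c).stripDecay hb0 hα (r := 0) (by linarith [Q_pos hb0])).memLp
      (by simp) le_rfl
  have hk1 : Integrable fun x : ℝ => gaussian 0 x * fourierL2 h x :=
    MemLp.integrable_mul (p := 2) (q := 2) (hg 0) (Lp.memLp _)
  have hk2 : MemLp (fun x : ℝ => gaussian 0 x * fourierL2 h x) 2 := by
    have hc : IsContraction fun x : ℝ => gaussian 0 x := by
      constructor
      · unfold gaussian; fun_prop
      · intro x
        simp only [gaussian]
        rw [Complex.norm_exp, Real.exp_le_one_iff]
        have : (-Real.pi * (x : ℂ) ^ 2 + 2 * Real.pi * I * (0 : ℝ) * x).re = -Real.pi * x ^ 2 := by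
          simp [pow_two]
        rw [this]
        nlinarith [Real.pi_pos, sq_nonneg x]
    exact hc.memLp (Lp.memLp _)
  have hzero (c : ℝ) : 𝓕 (fun x : ℝ => gaussian 0 x * fourierL2 h x) c = 0 := by
    have hG := isTransform_gaussian b α c
    have hf := invF_mem_space hb0 hα hG
    have hs := hG.stripDecay hb0 hα (r := Q b / 4) (by linarith [Q_pos hb0])
    set u : L2R := hf.2.2.1.toLp
    have hu : u =ᵐ[volume] fun x : ℝ => invF (gaussian c) x := hf.2.2.1.coeFn_toLp
    have h1 : inner ℂ u h = 0 := hh u ⟨_, hf, hu⟩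
    rw [← fourierL2.inner_map_map, inner_eq_integral] at h1
    rw [Real.fourier_eq', ← h1]
    apply integral_congr_ae
    filter_upwards [fourierL2_ae_eq hu hf.2.1] with x hx
    rw [hx, fourier_invF (by linarith [Q_pos hb0]) hs, smul_eq_mul, ← mul_assoc]
    congr 1
    rw [gaussian, gaussian, ← Complex.exp_add, ← Complex.exp_conj]
    congr 1
    simp only [RCLike.inner_apply, conj_trivial, map_add, map_mul, map_neg, map_pow, conj_ofReal,
      conj_I, map_ofNat]
    push_cast
    ring
  have h2 := fourierL2_ae_eq (hk2.coeFn_toLp) hk1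
  have h3 : fourierL2 hk2.toLp = 0 := by
    apply Lp.ext
    filter_upwards [h2, Lp.coeFn_zero ℂ 2 (volume : Measure ℝ)] with x h4 h5
    rw [h4, h5, hzero, Pi.zero_apply]
  rw [LinearIsometryEquiv.map_eq_zero_iff] at h3
  have h6 : fourierL2 h = 0 := by
    apply Lp.ext
    have h7 := hk2.coeFn_toLp
    rw [h3] at h7
    filter_upwards [h7, Lp.coeFn_zero ℂ 2 (volume : Measure ℝ)] with x h8 h9
    rw [h9, Pi.zero_apply] at h8 ⊢
    exact (mul_eq_zero.1 h8.symm).resolve_left (Complex.exp_ne_zero _)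
  rwa [LinearIsometryEquiv.map_eq_zero_iff] at h6

/-! ### The Fourier sine transform of `1 / sinh` -/

theorem norm_cos_le (u : ℂ) : ‖cos u‖ ≤ Real.exp |u.im| := by
  rw [Complex.cos, norm_div, Complex.norm_ofNat, div_le_iff₀ two_pos]
  refine (norm_add_le _ _).trans ?_
  rw [Complex.norm_exp, Complex.norm_exp]
  have h1 : (u * I).re ≤ |u.im| := by simpa using neg_le_abs u.im
  have h2 : (-u * I).re ≤ |u.im| := by simpa using le_abs_self u.im
  linarith [Real.exp_le_exp.2 h1, Real.exp_le_exp.2 h2]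

theorem convex_abs_im_le (c : ℝ) : Convex ℝ {u : ℂ | |u.im| ≤ c} := by
  have : {u : ℂ | |u.im| ≤ c} = Complex.imLm ⁻¹' Set.Icc (-c) c := by
    ext u; simp [abs_le]
  rw [this]
  exact (convex_Icc _ _).linear_preimage _

/-- Mean value inequality on the convex strip |Im v| ≤ |Im u|, where the cosine is bounded by e^{|Im
u|}. -/
theorem norm_sin_le (u : ℂ) : ‖sin u‖ ≤ ‖u‖ * Real.exp |u.im| := by
  have h := Convex.norm_image_sub_le_of_norm_hasDerivWithin_le (f := Complex.sin) (f' := Complex.cos)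
    (C := Real.exp |u.im|) (s := {v : ℂ | |v.im| ≤ |u.im|}) (x := 0) (y := u)
    (fun v _ => (Complex.hasDerivAt_sin v).hasDerivWithinAt)
    (fun v hv => (norm_cos_le v).trans (Real.exp_le_exp.2 hv)) (convex_abs_im_le _) (by simp)
    (by simp)
  rw [Complex.sin_zero, sub_zero, sub_zero, mul_comm] at h
  exact h

/-- Keeps both the singularity at 0 and the decay at infinity; it rests on 1 + 2t ≤ e^{2t}. -/
theorem inv_sinh_le {t : ℝ} (ht : 0 < t) :
    (Real.sinh t)⁻¹ ≤ (1 + 2 * t) * Real.exp (-t) / t := by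
  have h1 : 0 < Real.sinh t := Real.sinh_pos_iff.2 ht
  rw [inv_eq_one_div, div_le_div_iff₀ h1 ht, one_mul, Real.sinh_eq]
  have h2 : 1 + 2 * t ≤ Real.exp t * Real.exp t := by
    rw [← Real.exp_add]; linarith [Real.add_one_le_exp (t + t)]
  have h3 : Real.exp t * Real.exp (-t) = 1 := by rw [← Real.exp_add]; simp
  have h4 : Real.exp (-t) * ((1 + 2 * t) * Real.exp (-t)) ≤ 1 := by
    calc _ ≤ Real.exp (-t) * ((Real.exp t * Real.exp t) * Real.exp (-t)) := by gcongr
      _ = (Real.exp t * Real.exp (-t)) * (Real.exp t * Real.exp (-t)) := by ring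
      _ = 1 := by rw [h3, mul_one]
  have h5 : (1 + 2 * t) * Real.exp (-t) * ((Real.exp t - Real.exp (-t)) / 2) =
    ((1 + 2 * t) * (Real.exp t * Real.exp (-t)) -
      Real.exp (-t) * ((1 + 2 * t) * Real.exp (-t))) / 2 := by ring
  rw [h5, h3]
  linarith

/-- Trades a linear factor for an arbitrarily small loss δ in the exponential rate. -/
theorem one_add_mul_le_exp {k δ : ℝ} (hk : 0 ≤ k) (hδ : 0 < δ) {t : ℝ} (ht : 0 ≤ t) :
    1 + k * t ≤ (1 + k / δ) * Real.exp (δ * t) := by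
  have h1 := Real.add_one_le_exp (δ * t)
  have h2 : 1 ≤ Real.exp (δ * t) := Real.one_le_exp (by positivity)
  have h3 : k * t = k / δ * (δ * t) := by field_simp
  rw [add_mul, one_mul, h3]
  gcongr
  linarith

theorem integrableOn_exp_neg_mul {r : ℝ} (hr : 0 < r) :
    IntegrableOn (fun t : ℝ => Real.exp (-(r * t))) (Set.Ioi 0) := by
  simpa using integrableOn_exp_mul_Ioi (a := -r) (by linarith) 0

theorem integrableOn_sin_div_sinh {v : ℂ} (hv : |v.im| < 1) :
    IntegrableOn (fun t : ℝ => sin (v * t) * ((Real.sinh t)⁻¹ : ℝ)) (Set.Ioi 0) := by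
  -- Half the gap between the growth of the sine and the decay of 1/sinh, so decay at rate δ
  -- remains.
  set δ := (1 - |v.im|) / 2
  have hδ : 0 < δ := by simp only [δ]; linarith
  refine ((integrableOn_exp_neg_mul hδ).const_mul (‖v‖ * (1 + 2 / δ))).mono'
    (by fun_prop) ?_
  filter_upwards [ae_restrict_mem measurableSet_Ioi] with t ht
  have ht : 0 < t := ht
  have h1 := norm_sin_le (v * t)
  have h2 := inv_sinh_le ht
  have h3 := one_add_mul_le_exp zero_le_two hδ ht.le
  rw [norm_mul, Complex.norm_real, Real.norm_of_nonneg (inv_nonneg.2 (Real.sinh_pos_iff.2 ht).le)]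
  have h4 : |(v * t).im| = |v.im| * t := by simp [abs_mul, abs_of_pos ht]
  rw [h4, norm_mul, Complex.norm_real, Real.norm_of_nonneg ht.le] at h1
  calc ‖sin (v * t)‖ * (Real.sinh t)⁻¹
      ≤ (‖v‖ * t * Real.exp (|v.im| * t)) * ((1 + 2 * t) * Real.exp (-t) / t) := by
        gcongr
    _ ≤ (‖v‖ * t * Real.exp (|v.im| * t)) *
        (((1 + 2 / δ) * Real.exp (δ * t)) * Real.exp (-t) / t) := by gcongr
    _ = ‖v‖ * (1 + 2 / δ) * (Real.exp (|v.im| * t) * Real.exp (δ * t) * Real.exp (-t)) := by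
        field_simp
    _ = _ := by
        rw [← Real.exp_add, ← Real.exp_add]
        congr 2
        simp only [δ]; ring

theorem hasSum_exp_eq_inv_sinh {t : ℝ} (ht : 0 < t) :
    HasSum (fun n : ℕ => 2 * Real.exp (-((2 * n + 1) * t))) (Real.sinh t)⁻¹ := by
  have h1 : Real.exp (-(2 * t)) < 1 := by rw [Real.exp_lt_one_iff]; linarith
  have h := (hasSum_geometric_of_lt_one (Real.exp_pos _).le h1).mul_left (2 * Real.exp (-t))
  have h2 : 2 * Real.exp (-t) * (1 - Real.exp (-(2 * t)))⁻¹ = (Real.sinh t)⁻¹ := by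
    rw [Real.sinh_eq, inv_div, ← div_eq_mul_inv, div_eq_div_iff (by linarith)
      (by rw [sub_ne_zero]; intro h; have := Real.exp_injective h; linarith)]
    have h3 : Real.exp (-t) * Real.exp t = 1 := by rw [← Real.exp_add]; simp
    have h4 : Real.exp (-(2 * t)) = Real.exp (-t) * Real.exp (-t) := by
      rw [← Real.exp_add]; ring_nf
    rw [h4]
    linear_combination 2 * h3
  rw [h2] at h
  refine h.congr_fun ?_
  intro n
  rw [mul_assoc, ← Real.exp_nat_mul, ← Real.exp_add]
  ring_nf

theorem integral_sin_mul_exp {v : ℂ} {k : ℝ} (hk : |v.im| < k) :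
    ∫ t in Set.Ioi (0 : ℝ), sin (v * t) * (Real.exp (-(k * t)) : ℂ) = v / (k ^ 2 + v ^ 2) := by
  have hk' := abs_lt.1 hk
  have h1 : ((-k + v * I : ℂ)).re < 0 := by simp; linarith
  have h2 : ((-k - v * I : ℂ)).re < 0 := by simp; linarith
  have e1 := integral_exp_mul_complex_Ioi h1 0
  have e2 := integral_exp_mul_complex_Ioi h2 0
  have i1 := integrableOn_exp_mul_complex_Ioi h1 0
  have i2 := integrableOn_exp_mul_complex_Ioi h2 0
  have h3 : (fun t : ℝ => sin (v * t) * (Real.exp (-(k * t)) : ℂ)) = fun t : ℝ =>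
      (exp ((-k - v * I) * t) - exp ((-k + v * I) * t)) * (I / 2) := by
    funext t
    rw [Complex.sin, Complex.ofReal_exp, div_mul_eq_mul_div, mul_right_comm, sub_mul,
      ← Complex.exp_add, ← Complex.exp_add, mul_div_assoc]
    push_cast
    ring_nf
  rw [h3, integral_mul_const, integral_sub i2 i1, e1, e2]
  have n1 : (-k + v * I : ℂ) ≠ 0 := fun h => by rw [h] at h1; simp at h1
  have n2 : (-k - v * I : ℂ) ≠ 0 := fun h => by rw [h] at h2; simp at h2
  have n3 : (k ^ 2 + v ^ 2 : ℂ) ≠ 0 := by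
    have : (k ^ 2 + v ^ 2 : ℂ) = (-k + v * I) * (-k - v * I) := by
      linear_combination v ^ 2 * I_mul_I
    rw [this]; exact mul_ne_zero n1 n2
  simp only [Complex.ofReal_zero, mul_zero, Complex.exp_zero]
  rw [div_sub_div _ _ n2 n1, div_mul_div_comm, div_eq_div_iff (by simp [n1, n2]) n3]
  linear_combination (-(2 * v * k ^ 2)) * I_mul_I

/-- Termwise integration of 1/sinh t = 2 Σ e^{-(2n+1)t}; the terms are positive, so the integrand's
own norm controls the sum. -/
theorem hasSum_integral_sin_div_sinh {v : ℂ} (hv : |v.im| < 1) :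
    HasSum (fun n : ℕ => 2 * v / ((2 * n + 1) ^ 2 + v ^ 2))
      (∫ t in Set.Ioi (0 : ℝ), sin (v * t) * ((Real.sinh t)⁻¹ : ℝ)) := by
  have h := hasSum_integral_of_dominated_convergence (μ := volume.restrict (Set.Ioi (0 : ℝ)))
    (F := fun (n : ℕ) (t : ℝ) => sin (v * t) * ((2 * Real.exp (-((2 * n + 1) * t)) : ℝ) : ℂ))
    (f := fun t : ℝ => sin (v * t) * ((Real.sinh t)⁻¹ : ℝ))
    (fun n t => ‖sin (v * t)‖ * (2 * Real.exp (-((2 * n + 1) * t))))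
    (fun n => by fun_prop)
    (fun n => Filter.Eventually.of_forall fun t => by
      rw [norm_mul, Complex.norm_real, Real.norm_of_nonneg (by positivity)])
    (by
      filter_upwards [ae_restrict_mem measurableSet_Ioi] with t ht
      exact ((hasSum_exp_eq_inv_sinh ht).mul_left _).summable)
    (by
      refine (integrableOn_sin_div_sinh hv).norm.congr ?_
      filter_upwards [ae_restrict_mem measurableSet_Ioi] with t ht
      rw [((hasSum_exp_eq_inv_sinh ht).mul_left _).tsum_eq, norm_mul, Complex.norm_real,
        Real.norm_of_nonneg (inv_nonneg.2 (Real.sinh_pos_iff.2 ht).le)])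
    (by
      filter_upwards [ae_restrict_mem measurableSet_Ioi] with t ht
      exact (Complex.hasSum_ofReal.2 (hasSum_exp_eq_inv_sinh ht)).mul_left _)
  refine h.congr_fun ?_
  intro n
  have hn : |v.im| < 2 * n + 1 := hv.trans_le (by linarith [n.cast_nonneg (α := ℝ)])
  have h1 := integral_sin_mul_exp hn
  push_cast at h1 ⊢
  simp_rw [mul_left_comm _ (2 : ℂ)]
  rw [integral_const_mul, h1]
  ring

/-- The cotangent series at x runs over all nonzero integers; its even part is half the series at
x/2. Subtracting leaves the odd integers and π cot πx - (π/2) cot(πx/2). -/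
theorem tsum_odd_eq_tan {x : ℂ} (hx : x ∈ Complex.integerComplement)
    (hx2 : x / 2 ∈ Complex.integerComplement) :
    ∑' n : ℕ, (1 / (x - (2 * n + 1)) + 1 / (x + (2 * n + 1))) =
      -(Real.pi / 2) * tan (Real.pi * x / 2) := by
  have hs : Summable fun n : ℕ => 1 / (x - (n + 1)) + 1 / (x + (n + 1)) := summable_cotTerm hx
  have h1 := cot_series_rep' hx
  have h2 := cot_series_rep' hx2
  have i1 : Function.Injective fun n : ℕ => 2 * n := fun a b h => by simpa using h
  have i2 : Function.Injective fun n : ℕ => 2 * n + 1 := fun a b h => by simpa using h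
  have h3 := tsum_even_add_odd (f := fun n : ℕ => 1 / (x - (n + 1)) + 1 / (x + (n + 1)))
    (hs.comp_injective i1) (hs.comp_injective i2)
  have h4 : ∑' k : ℕ, (1 / (x - ((2 * k + 1 : ℕ) + 1)) + 1 / (x + ((2 * k + 1 : ℕ) + 1))) =
      2⁻¹ * ∑' n : ℕ, (1 / (x / 2 - (n + 1)) + 1 / (x / 2 + (n + 1))) := by
    rw [← tsum_mul_left]
    congr 1
    funext n
    rw [show x - ((2 * n + 1 : ℕ) + 1) = 2 * (x / 2 - (n + 1)) by push_cast; ring,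
      show x + ((2 * n + 1 : ℕ) + 1) = 2 * (x / 2 + (n + 1)) by push_cast; ring,
      one_div, one_div, mul_inv, mul_inv]
    ring
  rw [h4, ← h1, ← h2] at h3
  have hx0 : x ≠ 0 := fun h => hx ⟨0, by simp [h]⟩
  push_cast at h3
  rw [eq_sub_of_add_eq h3]
  have hsin : sin (Real.pi * x / 2) ≠ 0 := by
    intro h
    rw [Complex.sin_eq_zero_iff] at h
    obtain ⟨k, hk⟩ := h
    refine hx2 ⟨k, ?_⟩
    have hpi : (Real.pi : ℂ) ≠ 0 := Complex.ofReal_ne_zero.2 Real.pi_ne_zero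
    have : (Real.pi : ℂ) * (k - x / 2) = 0 := by linear_combination -hk
    exact sub_eq_zero.1 ((mul_eq_zero.1 this).resolve_left hpi)
  have hsin2 : sin (Real.pi * x) ≠ 0 := by
    intro h
    rw [Complex.sin_eq_zero_iff] at h
    obtain ⟨k, hk⟩ := h
    refine hx ⟨k, ?_⟩
    have hpi : (Real.pi : ℂ) ≠ 0 := Complex.ofReal_ne_zero.2 Real.pi_ne_zero
    have : (Real.pi : ℂ) * (k - x) = 0 := by linear_combination -hk
    exact sub_eq_zero.1 ((mul_eq_zero.1 this).resolve_left hpi)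
  have e1 : Real.pi * x = 2 * (Real.pi * x / 2) := by ring
  have e2 : Real.pi * (x / 2) = Real.pi * x / 2 := by ring
  rw [e1, Complex.sin_two_mul] at hsin2
  have hcos : cos (Real.pi * x / 2) ≠ 0 := right_ne_zero_of_mul hsin2
  have c1 : Real.pi * cot (Real.pi * x) = Real.pi *
      ((2 * cos (Real.pi * x / 2) ^ 2 - 1) /
        (2 * sin (Real.pi * x / 2) * cos (Real.pi * x / 2))) := by
    rw [Complex.cot, ← Complex.sin_two_mul, ← Complex.cos_two_mul, ← e1]
  have h5 := Complex.sin_sq_add_cos_sq (Real.pi * x / 2)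
  rw [c1, Complex.cot, Complex.tan, e2]
  generalize sin (Real.pi * x / 2) = S at *
  generalize cos (Real.pi * x / 2) = C at *
  field_simp
  linear_combination (Real.pi * x) * h5

/-- The tangent expansion is applied at x = iv, whose real part has modulus below 1, so x and x/2
avoid the integers as soon as v ≠ 0. -/
theorem integral_sin_div_sinh {v : ℂ} (hv : |v.im| < 1) :
    ∫ t in Set.Ioi (0 : ℝ), sin (v * t) * ((Real.sinh t)⁻¹ : ℝ) =
      Real.pi / 2 * tanh (Real.pi * v / 2) := by
  rcases eq_or_ne v 0 with rfl | hv0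
  · simp
  have hmem (r : ℝ) (hr : r ≠ 0) (hr1 : |r| ≤ 1) :
      I * (r * v) ∈ Complex.integerComplement := by
    rintro ⟨k, hk⟩
    have h1 := congrArg Complex.re hk
    have h2 := congrArg Complex.im hk
    simp at h1 h2
    have h3 : |(k : ℝ)| < 1 := by
      rw [h1, abs_neg, abs_mul]
      calc |r| * |v.im| ≤ 1 * |v.im| := by gcongr
        _ < 1 := by rwa [one_mul]
    have h4 : k = 0 := by
      have : |k| < 1 := by exact_mod_cast h3
      exact Int.abs_lt_one_iff.1 this
    rw [h4] at h1
    simp [hr] at h1 h2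
    exact hv0 (Complex.ext (by simpa using h2) (by simpa using h1))
  have hx := hmem 1 one_ne_zero (by simp)
  have hx2 := hmem (1 / 2) (by norm_num) (by norm_num [abs_le])
  rw [Complex.ofReal_one, one_mul] at hx
  rw [show I * ((1 / 2 : ℝ) * v) = I * v / 2 by push_cast; ring] at hx2
  have h1 := tsum_odd_eq_tan hx hx2
  rw [← (hasSum_integral_sin_div_sinh hv).tsum_eq]
  have h2 : (fun n : ℕ => 2 * v / ((2 * n + 1) ^ 2 + v ^ 2)) = fun n : ℕ =>
      I * (1 / (I * v - (2 * n + 1)) + 1 / (I * v + (2 * n + 1))) := by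
    funext n
    have a1 : I * v - (2 * n + 1) ≠ 0 := fun h => hx ⟨2 * n + 1, by
      push_cast; linear_combination -h⟩
    have a2 : I * v + (2 * n + 1) ≠ 0 := fun h => hx ⟨-(2 * n + 1), by
      push_cast; linear_combination -h⟩
    have a3 : ((2 * n + 1) ^ 2 + v ^ 2 : ℂ) = -((I * v - (2 * n + 1)) * (I * v + (2 * n + 1))) := by
      linear_combination v ^ 2 * I_mul_I
    rw [a3, one_div_add_one_div a1 a2, ← mul_div_assoc, div_neg, ← neg_div]
    congr 1
    linear_combination (-2 * v) * I_mul_I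
  rw [h2, tsum_mul_left, h1, show Real.pi * (I * v) / 2 = Real.pi * v / 2 * I by ring,
    Complex.tan_mul_I]
  linear_combination (-(Real.pi / 2) * tanh (Real.pi * v / 2)) * I_mul_I

/-! ### The double sine function -/

theorem norm_cos_sub_one_le (u : ℂ) : ‖cos u - 1‖ ≤ ‖u‖ ^ 2 * Real.exp |u.im| := by
  have h1 : cos u - 1 = -2 * (sin (u / 2)) ^ 2 := by
    have h2 := Complex.cos_two_mul (u / 2)
    rw [mul_div_cancel₀ u two_ne_zero] at h2
    rw [h2]
    linear_combination 2 * Complex.sin_sq_add_cos_sq (u / 2)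
  have h2 := norm_sin_le (u / 2)
  have h3 : |(u / 2).im| = |u.im| / 2 := by
    rw [show (u / 2).im = u.im / 2 by simp, abs_div, abs_two]
  rw [h3, norm_div, Complex.norm_ofNat] at h2
  rw [h1, norm_mul, norm_pow, norm_neg, Complex.norm_ofNat]
  calc 2 * ‖sin (u / 2)‖ ^ 2 ≤ 2 * (‖u‖ / 2 * Real.exp (|u.im| / 2)) ^ 2 := by gcongr
    _ = ‖u‖ ^ 2 * (Real.exp (|u.im| / 2)) ^ 2 / 2 := by ring
    _ = ‖u‖ ^ 2 * Real.exp |u.im| / 2 := by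
      rw [← Real.exp_nat_mul]; congr 3; push_cast; ring
    _ ≤ _ := half_le_self (by positivity)

/-- The cubic order at 0 matches the singularity t⁻³ of the weight in `logSine`, which is why the
linear term is subtracted there. -/
theorem norm_sin_sub_le (u : ℂ) : ‖sin u - u‖ ≤ ‖u‖ ^ 3 * Real.exp |u.im| := by
  have h := Convex.norm_image_sub_le_of_norm_hasDerivWithin_le
    (f := fun v : ℂ => sin v - v) (f' := fun v => cos v - 1)
    (C := ‖u‖ ^ 2 * Real.exp |u.im|)
    (s := {v : ℂ | |v.im| ≤ |u.im|} ∩ Metric.closedBall 0 ‖u‖) (x := 0) (y := u)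
    (fun v _ => ((Complex.hasDerivAt_sin v).sub (hasDerivAt_id v)).hasDerivWithinAt)
    (fun v hv => (norm_cos_sub_one_le v).trans (by
      have h1 : ‖v‖ ≤ ‖u‖ := by simpa using hv.2
      have h2 : |v.im| ≤ |u.im| := hv.1
      gcongr))
    ((convex_abs_im_le _).inter (convex_closedBall _ _)) (by simp) (by simp)
  simp only [Complex.sin_zero, sub_zero] at h
  refine h.trans_eq (by ring)

/-- A single bound, quadratic near 0 and bounded at infinity. At u = xt, after the quadratic
singularity of the weight is divided out, it leaves a Lorentzian whose integral is linear in |x|. -/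
theorem abs_cos_sub_one_le (u : ℝ) : |Real.cos (2 * u) - 1| ≤ 4 * u ^ 2 / (1 + u ^ 2) := by
  have h1 : Real.cos (2 * u) - 1 = -(2 * Real.sin u ^ 2) := by
    rw [Real.cos_two_mul]; linear_combination 2 * Real.sin_sq_add_cos_sq u
  have h2 : Real.sin u ^ 2 ≤ u ^ 2 := sq_le_sq.2 Real.abs_sin_le_abs
  have h3 : Real.sin u ^ 2 ≤ 1 := Real.sin_sq_le_one u
  rw [h1, abs_neg, abs_of_nonneg (by positivity), le_div_iff₀ (by positivity)]
  nlinarith [sq_nonneg u, mul_le_mul_of_nonneg_left h3 (sq_nonneg u)]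

theorem abs_sinh_le {u : ℝ} (hu : 0 ≤ u) : |Real.sinh u| ≤ u * Real.exp u := by
  have h := norm_sin_le (u * I)
  rwa [Complex.sin_mul_I, norm_mul, Complex.norm_I, mul_one, ← Complex.ofReal_sinh,
    Complex.norm_real, norm_mul, Complex.norm_I, mul_one, Complex.norm_real, Real.norm_eq_abs,
    Real.norm_eq_abs, show ((u : ℂ) * I).im = u by simp, abs_of_nonneg hu] at h

theorem abs_sinh_sub_le {u : ℝ} (hu : 0 ≤ u) : |Real.sinh u - u| ≤ u ^ 3 * Real.exp u := by
  have h := norm_sin_sub_le (u * I)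
  rwa [Complex.sin_mul_I, ← sub_mul, norm_mul, Complex.norm_I, mul_one, ← Complex.ofReal_sinh,
    ← Complex.ofReal_sub, Complex.norm_real, norm_mul, Complex.norm_I, mul_one, Complex.norm_real,
    Real.norm_eq_abs, Real.norm_eq_abs, show ((u : ℂ) * I).im = u by simp, abs_of_nonneg hu] at h

/-- `1 / (sinh (b t) sinh (t / b))`. -/
def sineKernel (b t : ℝ) : ℝ := (Real.sinh (b * t) * Real.sinh (t / b))⁻¹

theorem measurable_sineKernel (b : ℝ) : Measurable (sineKernel b) := by
  unfold sineKernel; fun_prop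

theorem sineKernel_pos {b : ℝ} (hb0 : 0 < b) {t : ℝ} (ht : 0 < t) : 0 < sineKernel b t := by
  have h1 : 0 < Real.sinh (b * t) := Real.sinh_pos_iff.2 (by positivity)
  have h2 : 0 < Real.sinh (t / b) := Real.sinh_pos_iff.2 (by positivity)
  exact inv_pos.2 (mul_pos h1 h2)

/-- The two factors decay at rates b and 1/b, of sum `Q b`; half of Q - r is spent on each linear
factor from `inv_sinh_le`. -/
theorem exists_sineKernel_le {b : ℝ} (hb0 : 0 < b) {r : ℝ} (hr : r < Q b) :
    ∃ C, 0 ≤ C ∧ ∀ t, 0 < t → sineKernel b t ≤ C * Real.exp (-(r * t)) / t ^ 2 := by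
  set δ := (Q b - r) / 2 with hδ'
  have hδ : 0 < δ := by rw [hδ']; linarith
  refine ⟨(1 + 2 * b / δ) * (1 + 2 / b / δ), by positivity, fun t ht => ?_⟩
  have h1 := inv_sinh_le (t := b * t) (by positivity)
  have h2 := inv_sinh_le (t := t / b) (by positivity)
  have h3 := one_add_mul_le_exp (k := 2 * b) (by positivity) hδ ht.le
  have h4 := one_add_mul_le_exp (k := 2 / b) (by positivity) hδ ht.le
  have h5 : 0 < Real.sinh (t / b) := Real.sinh_pos_iff.2 (by positivity)
  rw [sineKernel, mul_inv]
  calc _ ≤ ((1 + 2 * (b * t)) * Real.exp (-(b * t)) / (b * t)) *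
        ((1 + 2 * (t / b)) * Real.exp (-(t / b)) / (t / b)) := by gcongr
    _ = (1 + 2 * b * t) * (1 + 2 / b * t) * (Real.exp (-(b * t)) * Real.exp (-(t / b))) /
        t ^ 2 := by field_simp
    _ ≤ ((1 + 2 * b / δ) * Real.exp (δ * t)) * ((1 + 2 / b / δ) * Real.exp (δ * t)) *
        (Real.exp (-(b * t)) * Real.exp (-(t / b))) / t ^ 2 := by gcongr
    _ = (1 + 2 * b / δ) * (1 + 2 / b / δ) * (Real.exp (δ * t) * Real.exp (δ * t) *
        (Real.exp (-(b * t)) * Real.exp (-(t / b)))) / t ^ 2 := by ring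
    _ = _ := by
        rw [← Real.exp_add, ← Real.exp_add, ← Real.exp_add]
        congr 3
        rw [hδ', Q, div_eq_mul_inv t b]
        ring

/-- The logarithm of the double sine function, up to a factor and an affine function. -/
def logSine (b : ℝ) (y : ℂ) : ℂ :=
  ∫ t in Set.Ioi (0 : ℝ), (sin (2 * y * t) - 2 * y * t) * ((sineKernel b t / (2 * t) : ℝ) : ℂ)

theorem abs_im_two_mul {y : ℂ} {t : ℝ} (ht : 0 < t) :
    |(2 * y * t).im| = 2 * |y.im| * t := by
  have : (2 * y * t).im = 2 * y.im * t := by simp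
  rw [this, abs_mul, abs_mul, abs_two, abs_of_pos ht]

theorem norm_two_mul {y : ℂ} {t : ℝ} (ht : 0 < t) : ‖2 * y * t‖ = 2 * ‖y‖ * t := by
  rw [norm_mul, norm_mul, Complex.norm_ofNat, Complex.norm_real, Real.norm_of_nonneg ht.le]

theorem integrableOn_logSine {b : ℝ} (hb0 : 0 < b) {y : ℂ} (hy : |y.im| < Q b / 2) :
    IntegrableOn (fun t : ℝ => (sin (2 * y * t) - 2 * y * t) *
      ((sineKernel b t / (2 * t) : ℝ) : ℂ)) (Set.Ioi 0) := by
  obtain ⟨C, hC0, hC⟩ := exists_sineKernel_le hb0 (r := (2 * |y.im| + Q b) / 2) (by linarith)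
  have hm := measurable_sineKernel b
  refine ((integrableOn_exp_neg_mul (r := (Q b - 2 * |y.im|) / 2) (by linarith)).const_mul
    ((2 * ‖y‖) ^ 3 * C / 2)).mono' (by fun_prop) ?_
  filter_upwards [ae_restrict_mem measurableSet_Ioi] with t ht
  have ht : 0 < t := ht
  have h1 := norm_sin_sub_le (2 * y * t)
  rw [abs_im_two_mul ht, norm_two_mul ht] at h1
  have h2 := sineKernel_pos hb0 ht
  rw [norm_mul, Complex.norm_real, Real.norm_of_nonneg (by positivity)]
  calc _ ≤ (2 * ‖y‖ * t) ^ 3 * Real.exp (2 * |y.im| * t) *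
        (C * Real.exp (-((2 * |y.im| + Q b) / 2 * t)) / t ^ 2 / (2 * t)) := by
        gcongr; exact hC t ht
    _ = (2 * ‖y‖) ^ 3 * C / 2 *
        (Real.exp (2 * |y.im| * t) * Real.exp (-((2 * |y.im| + Q b) / 2 * t))) := by field_simp
    _ = _ := by rw [← Real.exp_add]; congr 2; ring

/-- Differentiation under the integral. The level c between |Im y| and Q/2 gives a neighbourhood of
y with one integrable majorant. -/
theorem hasDerivAt_logSine {b : ℝ} (hb0 : 0 < b) {y : ℂ} (hy : |y.im| < Q b / 2) :
    IntegrableOn (fun t : ℝ => (cos (2 * y * t) - 1) * (sineKernel b t : ℂ)) (Set.Ioi 0) ∧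
    HasDerivAt (logSine b)
      (∫ t in Set.Ioi (0 : ℝ), (cos (2 * y * t) - 1) * (sineKernel b t : ℂ)) y := by
  have hm := measurable_sineKernel b
  set c := (|y.im| + Q b / 2) / 2 with hc
  obtain ⟨C, hC0, hC⟩ := exists_sineKernel_le hb0 (r := (2 * c + Q b) / 2) (by linarith)
  have hopen : IsOpen {v : ℂ | |v.im| < c ∧ ‖v‖ < ‖y‖ + 1} :=
    (isOpen_lt Complex.continuous_im.abs continuous_const).inter
      (isOpen_lt continuous_norm continuous_const)
  refine hasDerivAt_integral_of_dominated_loc_of_deriv_le (𝕜 := ℂ)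
    (F := fun (y : ℂ) (t : ℝ) => (sin (2 * y * t) - 2 * y * t) *
      ((sineKernel b t / (2 * t) : ℝ) : ℂ))
    (F' := fun (y : ℂ) (t : ℝ) => (cos (2 * y * t) - 1) * (sineKernel b t : ℂ))
    (bound := fun t => (2 * (‖y‖ + 1)) ^ 2 * C * Real.exp (-((Q b - 2 * c) / 2 * t)))
    (hopen.mem_nhds (show |y.im| < c ∧ ‖y‖ < ‖y‖ + 1 from ⟨by linarith, by linarith⟩))
    (Filter.Eventually.of_forall fun v => by fun_prop) (integrableOn_logSine hb0 hy)
    (by fun_prop) ?_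
    ((integrableOn_exp_neg_mul (by linarith)).const_mul _) ?_
  · filter_upwards [ae_restrict_mem measurableSet_Ioi] with t ht v hv
    have ht : 0 < t := ht
    have h1 := norm_cos_sub_one_le (2 * v * t)
    rw [abs_im_two_mul ht, norm_two_mul ht] at h1
    have h2 := sineKernel_pos hb0 ht
    have h3 := hv.1.le
    have h4 := hv.2.le
    rw [norm_mul, Complex.norm_real, Real.norm_of_nonneg h2.le]
    calc _ ≤ ((2 * ‖v‖ * t) ^ 2 * Real.exp (2 * |v.im| * t)) *
          (C * Real.exp (-((2 * c + Q b) / 2 * t)) / t ^ 2) := by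
          gcongr; exact hC t ht
      _ ≤ ((2 * (‖y‖ + 1) * t) ^ 2 * Real.exp (2 * c * t)) *
          (C * Real.exp (-((2 * c + Q b) / 2 * t)) / t ^ 2) := by gcongr
      _ = (2 * (‖y‖ + 1)) ^ 2 * C *
          (Real.exp (2 * c * t) * Real.exp (-((2 * c + Q b) / 2 * t))) := by field_simp
      _ = _ := by rw [← Real.exp_add]; congr 2; ring
  · filter_upwards [ae_restrict_mem measurableSet_Ioi] with t ht v hv
    have ht : 0 < t := ht
    have h1 : HasDerivAt (fun v : ℂ => 2 * v * t) (2 * t) v := by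
      simpa using ((hasDerivAt_id v).const_mul 2).mul_const (t : ℂ)
    have h2 := (((Complex.hasDerivAt_sin _).comp v h1).sub h1).mul_const
      ((sineKernel b t / (2 * t) : ℝ) : ℂ)
    refine h2.congr_deriv ?_
    have : (t : ℂ) ≠ 0 := Complex.ofReal_ne_zero.2 ht.ne'
    push_cast
    field_simp

theorem differentiableAt_logSine {b : ℝ} (hb0 : 0 < b) {y : ℂ} (hy : |y.im| < Q b / 2) :
    DifferentiableAt ℂ (logSine b) y := (hasDerivAt_logSine hb0 hy).2.differentiableAt

theorem sin_two_mul_re_im (x η t : ℝ) :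
    sin (2 * (x + I * η) * t) = ((Real.sin (2 * (x * t)) * Real.cosh (2 * η * t) : ℝ) : ℂ) +
      ((Real.cos (2 * (x * t)) * Real.sinh (2 * η * t) : ℝ) : ℂ) * I := by
  rw [show 2 * (x + I * η) * t = ((2 * (x * t) : ℝ) : ℂ) + ((2 * η * t : ℝ) : ℂ) * I by
    push_cast; ring, Complex.sin_add_mul_I]
  push_cast
  ring

theorem im_logSine {b : ℝ} (hb0 : 0 < b) (x η : ℝ) (hη : |η| < Q b / 2) :
    (logSine b (x + I * η)).im = ∫ t in Set.Ioi (0 : ℝ),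
      (Real.cos (2 * (x * t)) * Real.sinh (2 * η * t) - 2 * η * t) *
        (sineKernel b t / (2 * t)) := by
  have h := integrableOn_logSine hb0 (y := x + I * η) (by simpa using hη)
  rw [logSine, ← Complex.imCLM_apply, ← Complex.imCLM.integral_comp_comm h]
  refine integral_congr_ae (Filter.Eventually.of_forall fun t => ?_)
  simp only [Complex.imCLM_apply]
  rw [Complex.im_mul_ofReal, sin_two_mul_re_im, Complex.sub_im, Complex.add_im, Complex.ofReal_im,
    Complex.im_ofReal_mul, Complex.I_im, zero_add, mul_one]
  simp

theorem re_logSine {b : ℝ} (hb0 : 0 < b) (x η : ℝ) (hη : |η| < Q b / 2) :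
    (logSine b (x + I * η)).re = ∫ t in Set.Ioi (0 : ℝ),
      (Real.sin (2 * (x * t)) * Real.cosh (2 * η * t) - 2 * x * t) *
        (sineKernel b t / (2 * t)) := by
  have h := integrableOn_logSine hb0 (y := x + I * η) (by simpa using hη)
  rw [logSine, ← Complex.reCLM_apply, ← Complex.reCLM.integral_comp_comm h]
  refine integral_congr_ae (Filter.Eventually.of_forall fun t => ?_)
  simp only [Complex.reCLM_apply]
  rw [Complex.re_mul_ofReal, sin_two_mul_re_im, Complex.sub_re, Complex.add_re, Complex.ofReal_re,
    Complex.re_ofReal_mul, Complex.I_re, mul_zero, add_zero]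
  simp

theorem im_logSine_ofReal {b : ℝ} (hb0 : 0 < b) (x : ℝ) : (logSine b x).im = 0 := by
  have h := im_logSine hb0 x 0 (by rw [abs_zero]; exact half_pos (Q_pos hb0))
  simpa using h

/-- With the reality on the real axis, this fixes the phase of the constant in the difference
equation. -/
theorem re_logSine_I_mul {b : ℝ} (hb0 : 0 < b) (η : ℝ) (hη : |η| < Q b / 2) :
    (logSine b (I * η)).re = 0 := by
  have h := re_logSine hb0 0 η hη
  simpa using h

theorem integrable_lorentz (x : ℝ) : Integrable fun t : ℝ => x ^ 2 * (1 + (x * t) ^ 2)⁻¹ := by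
  rcases eq_or_ne x 0 with rfl | hx
  · simp
  · exact (integrable_inv_one_add_sq.comp_mul_left' hx).const_mul _

theorem integral_lorentz (x : ℝ) :
    ∫ t : ℝ, x ^ 2 * (1 + (x * t) ^ 2)⁻¹ = Real.pi * |x| := by
  rcases eq_or_ne x 0 with rfl | hx
  · simp
  rw [integral_const_mul, Measure.integral_comp_mul_left (fun t => (1 + t ^ 2)⁻¹),
    integral_univ_inv_one_add_sq, smul_eq_mul, abs_inv, ← sq_abs]
  have : |x| ≠ 0 := abs_ne_zero.2 hx
  field_simp

/-- Split cos · sinh - 2ηt as (cos - 1) sinh plus (sinh - 2ηt). The first part yields a Lorentzian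
and hence linear growth in |x|; the second is cubic in t and contributes a bounded amount. -/
theorem exists_abs_im_logSine_le {b : ℝ} (hb0 : 0 < b) (hb1 : b < 1) :
    ∃ A B : ℝ, ∀ x η : ℝ, 0 ≤ η → η ≤ b → |(logSine b (x + I * η)).im| ≤ A * |x| + B := by
  have hbQ := lt_Q_half hb0 hb1
  obtain ⟨C, hC0, hC⟩ := exists_sineKernel_le hb0 (r := (2 * b + Q b) / 2) (by linarith)
  set r := (Q b - 2 * b) / 2 with hr'
  have hr : 0 < r := by linarith
  refine ⟨4 * b * C * Real.pi, 4 * b ^ 3 * C * ∫ t in Set.Ioi (0 : ℝ), Real.exp (-(r * t)),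
    fun x η h0 h1 => ?_⟩
  rw [im_logSine hb0 x η (by rw [abs_of_nonneg h0]; linarith), ← Real.norm_eq_abs]
  have hi := (integrable_lorentz x).const_mul (4 * b * C)
  have hj := (integrableOn_exp_neg_mul hr).const_mul (4 * b ^ 3 * C)
  have h2 := norm_integral_le_of_norm_le (μ := volume.restrict (Set.Ioi (0 : ℝ)))
    (f := fun t => (Real.cos (2 * (x * t)) * Real.sinh (2 * η * t) - 2 * η * t) *
        (sineKernel b t / (2 * t)))
    (hi.integrableOn.add hj) (by
      filter_upwards [ae_restrict_mem measurableSet_Ioi] with t ht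
      have ht : 0 < t := ht
      have hp := sineKernel_pos hb0 ht
      have e1 := abs_cos_sub_one_le (x * t)
      have e2 := abs_sinh_le (u := 2 * η * t) (by positivity)
      have e3 := abs_sinh_sub_le (u := 2 * η * t) (by positivity)
      have e4 : |Real.cos (2 * (x * t)) * Real.sinh (2 * η * t) - 2 * η * t| ≤
          (4 * (x * t) ^ 2 / (1 + (x * t) ^ 2) * (2 * b * t) + (2 * b * t) ^ 3) *
            Real.exp (2 * b * t) := by
        rw [show Real.cos (2 * (x * t)) * Real.sinh (2 * η * t) - 2 * η * t =
          (Real.cos (2 * (x * t)) - 1) * Real.sinh (2 * η * t) +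
            (Real.sinh (2 * η * t) - 2 * η * t) by ring]
        refine (abs_add_le _ _).trans ?_
        rw [abs_mul, add_mul, mul_assoc _ (2 * b * t)]
        refine add_le_add (mul_le_mul e1 (e2.trans ?_) (abs_nonneg _) (by positivity))
          (e3.trans ?_) <;> gcongr
      rw [Real.norm_eq_abs, abs_mul, abs_of_nonneg (a := sineKernel b t / (2 * t)) (by positivity)]
      calc _ ≤ ((4 * (x * t) ^ 2 / (1 + (x * t) ^ 2) * (2 * b * t) + (2 * b * t) ^ 3) *
            Real.exp (2 * b * t)) *
            (C * Real.exp (-((2 * b + Q b) / 2 * t)) / t ^ 2 / (2 * t)) := by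
            gcongr; exact hC t ht
        _ = (4 * b * C * (x ^ 2 * (1 + (x * t) ^ 2)⁻¹) + 4 * b ^ 3 * C) *
            (Real.exp (2 * b * t) * Real.exp (-((2 * b + Q b) / 2 * t))) := by
            field_simp
            ring
        _ = (4 * b * C * (x ^ 2 * (1 + (x * t) ^ 2)⁻¹) + 4 * b ^ 3 * C) *
            Real.exp (-(r * t)) := by
            rw [← Real.exp_add]; congr 2; rw [hr']; ring
        _ ≤ _ := by
            rw [add_mul, Pi.add_apply]
            refine add_le_add (mul_le_of_le_one_right (by positivity) ?_) le_rfl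
            rw [Real.exp_le_one_iff]
            have := mul_pos hr ht
            linarith)
  refine h2.trans ?_
  have h3 : ∫ t in Set.Ioi (0 : ℝ), 4 * b * C * (x ^ 2 * (1 + (x * t) ^ 2)⁻¹) ≤
      4 * b * C * Real.pi * |x| := by
    refine (setIntegral_le_integral hi (Filter.Eventually.of_forall fun t => ?_)).trans_eq ?_
    · simp only [Pi.zero_apply]; positivity
    · rw [integral_const_mul, integral_lorentz]; ring
  have h4 := integral_add hi.integrableOn hj (μ := volume.restrict (Set.Ioi (0 : ℝ)))
  simp only [Pi.add_apply] at h4 ⊢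
  rw [h4, integral_const_mul (4 * b ^ 3 * C)]
  linarith

/-! ### The difference equation -/

/-- The difference of the two cosines is -2i sin(2yt) sinh(bt). The last factor cancels in the
kernel, and the substitution t = bu leaves the sine transform of 1/sinh at v = 2by. -/
theorem hasDerivAt_logSine_sub {b : ℝ} (hb0 : 0 < b) {y : ℂ} (hy : |y.im| < b⁻¹ / 2) :
    HasDerivAt (fun y => logSine b (y + I * (b / 2)) - logSine b (y - I * (b / 2)))
      (-(I * (Real.pi * b * tanh (Real.pi * b * y)))) y := by
  have hy' := abs_lt.1 hy
  have e1 : (I * (b / 2 : ℂ)).im = b / 2 := by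
    rw [← Complex.ofReal_ofNat, ← Complex.ofReal_div]; simp
  have h1 : |(y + I * (b / 2)).im| < Q b / 2 := by
    rw [Complex.add_im, e1, Q, abs_lt]; constructor <;> linarith [hy'.1, hy'.2]
  have h2 : |(y - I * (b / 2)).im| < Q b / 2 := by
    rw [Complex.sub_im, e1, Q, abs_lt]; constructor <;> linarith [hy'.1, hy'.2]
  obtain ⟨i1, d1⟩ := hasDerivAt_logSine hb0 h1
  obtain ⟨i2, d2⟩ := hasDerivAt_logSine hb0 h2
  have h := (d1.comp_add_const y (I * (b / 2))).sub (d2.comp_sub_const y (I * (b / 2)))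
  refine h.congr_deriv ?_
  rw [← integral_sub i1 i2]
  have h3 : ∀ t ∈ Set.Ioi (0 : ℝ),
      (cos (2 * (y + I * (b / 2)) * t) - 1) * (sineKernel b t : ℂ) -
        (cos (2 * (y - I * (b / 2)) * t) - 1) * (sineKernel b t : ℂ) =
      (-(2 * I)) * (fun u : ℝ => sin (2 * y * b * u) * ((Real.sinh u)⁻¹ : ℝ)) (b⁻¹ * t) := by
    intro t ht
    have ht : 0 < t := ht
    have hb : (b : ℂ) ≠ 0 := Complex.ofReal_ne_zero.2 hb0.ne'
    have n1 : Real.sinh (b * t) ≠ 0 := (Real.sinh_pos_iff.2 (by positivity)).ne'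
    have e2 : 2 * y * b * ((b⁻¹ * t : ℝ) : ℂ) = 2 * y * t := by
      push_cast; field_simp
    simp only
    rw [e2, ← sub_mul, show 2 * (y + I * (b / 2)) * t = 2 * y * t + ((b * t : ℝ) : ℂ) * I by
      push_cast; ring, show 2 * (y - I * (b / 2)) * t = 2 * y * t - ((b * t : ℝ) : ℂ) * I by
      push_cast; ring, Complex.cos_add, Complex.cos_sub, Complex.sin_mul_I, ← Complex.ofReal_sinh,
      sineKernel, mul_inv, div_eq_inv_mul]
    push_cast
    have n2 : (Real.sinh (b * t) : ℂ) ≠ 0 := Complex.ofReal_ne_zero.2 n1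
    push_cast at n2
    generalize sinh ((b : ℂ) * t) = X at *
    field_simp
    ring
  have h4 := integral_comp_mul_left_Ioi
    (fun u : ℝ => sin (2 * y * b * u) * ((Real.sinh u)⁻¹ : ℝ)) 0 (inv_pos.2 hb0)
  rw [setIntegral_congr_fun measurableSet_Ioi h3, integral_const_mul, h4, mul_zero,
    integral_sin_div_sinh, inv_inv,
    Complex.real_smul, show Real.pi * (2 * y * b) / 2 = Real.pi * b * y by ring]
  · ring
  · rw [show (2 * y * b).im = 2 * b * y.im by simp; ring, abs_mul, abs_of_pos (by positivity)]
    calc 2 * b * |y.im| < 2 * b * (b⁻¹ / 2) := by gcongr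
      _ = 1 := by field_simp

theorem cosh_ne_zero {b : ℝ} (hb0 : 0 < b) {y : ℂ} (hy : |y.im| < b⁻¹ / 2) :
    cosh (Real.pi * b * y) ≠ 0 := by
  intro h
  rw [← Complex.cos_mul_I, Complex.cos_eq_zero_iff] at h
  obtain ⟨k, hk⟩ := h
  have h1 := congrArg Complex.re hk
  have h2 : (Real.pi * b * y * I).re = -(Real.pi * b * y.im) := by
    simp [mul_assoc]
  have h3 : ((2 * k + 1) * Real.pi / 2 : ℂ) = (((2 * k + 1) * Real.pi / 2 : ℝ) : ℂ) := by
    push_cast; ring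
  rw [h2, h3, Complex.ofReal_re] at h1
  have h4 : b * (2 * y.im) = -(2 * k + 1 : ℝ) := by
    have := Real.pi_pos.ne'
    field_simp at h1
    linarith
  have h5 : |b * (2 * y.im)| < 1 := by
    rw [abs_mul, abs_mul, abs_two, abs_of_pos hb0]
    calc b * (2 * |y.im|) < b * (2 * (b⁻¹ / 2)) := by gcongr
      _ = 1 := by field_simp
  rw [h4, abs_neg] at h5
  have h6 : |2 * k + 1| < 1 := by exact_mod_cast h5
  have := Int.abs_lt_one_iff.1 h6
  omega

/-- The quotient of the two sides has zero derivative on a convex strip, where cosh has no zero. At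
y = 0 the exponent is real, because `logSine` is imaginary on the imaginary axis; so the constant is
a positive number. -/
theorem exists_exp_logSine_sub {b : ℝ} (hb0 : 0 < b) (hb1 : b < 1) :
    ∃ κ : ℝ, ∀ y : ℂ, |y.im| < b⁻¹ / 2 →
      exp (I * (logSine b (y + I * (b / 2)) - logSine b (y - I * (b / 2)))) =
        Real.exp κ * cosh (Real.pi * b * y) := by
  set D : ℂ → ℂ := fun y => logSine b (y + I * (b / 2)) - logSine b (y - I * (b / 2)) with hD
  set S : Set ℂ := {y | |y.im| < b⁻¹ / 2} with hS
  have hopen : IsOpen S := isOpen_lt Complex.continuous_im.abs continuous_const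
  have hconv : Convex ℝ S := by
    have : S = Complex.imLm ⁻¹' Set.Ioo (-(b⁻¹ / 2)) (b⁻¹ / 2) := by
      ext u; simp [hS, abs_lt]
    rw [this]
    exact (convex_Ioo _ _).linear_preimage _
  have hd : ∀ y ∈ S, HasDerivAt (fun y => exp (I * D y) / cosh (Real.pi * b * y)) 0 y := by
    intro y hy
    have h1 := ((hasDerivAt_logSine_sub hb0 hy).const_mul I).cexp
    have h2 : HasDerivAt (fun y : ℂ => cosh (Real.pi * b * y))
        (sinh (Real.pi * b * y) * (Real.pi * b)) y := by
      have := ((hasDerivAt_id y).const_mul (Real.pi * b : ℂ)).ccosh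
      simpa using this
    have h0 := cosh_ne_zero hb0 hy
    refine (h1.div h2 h0).congr_deriv ?_
    rw [Complex.tanh_eq_sinh_div_cosh, div_eq_zero_iff]
    left
    generalize exp (I * (logSine b (y + I * (b / 2)) - logSine b (y - I * (b / 2)))) = X
    generalize cosh (Real.pi * b * y) = Y at *
    field_simp
    linear_combination (-(X * sinh (Real.pi * b * y) * Real.pi * b)) * I_mul_I
  have h0 : (0 : ℂ) ∈ S := by simp [hS, hb0]
  have hhalf : |b / 2| < Q b / 2 := by
    rw [abs_of_pos (by positivity)]; linarith [lt_Q_half hb0 hb1]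
  have hre : (D 0).re = 0 := by
    have h1 := re_logSine_I_mul hb0 (b / 2) hhalf
    have h2 := re_logSine_I_mul hb0 (-(b / 2)) (by rwa [abs_neg])
    push_cast at h1 h2
    simp only [hD, zero_add, zero_sub, Complex.sub_re]
    rw [h1, ← mul_neg, h2, sub_zero]
  refine ⟨-(D 0).im, fun y hy => ?_⟩
  have h1 := hopen.is_const_of_deriv_eq_zero hconv.isPreconnected
    (fun y hy => (hd y hy).differentiableAt.differentiableWithinAt)
    (fun y hy => (hd y hy).deriv) hy h0
  simp only [mul_zero, Complex.cosh_zero, div_one] at h1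
  rw [div_eq_iff (cosh_ne_zero hb0 hy)] at h1
  rw [h1, Complex.ofReal_exp]
  congr 2
  rw [← Complex.re_add_im (D 0), hre]
  push_cast
  simp
  linear_combination ((D 0).im : ℂ) * I_mul_I

/-- A function that is unimodular on the real line and solves the difference equation
`h (x + i b) = multE b 0 x * h x`. -/
theorem exists_unimodular_solution {b : ℝ} (hb0 : 0 < b) (hb1 : b < 1) :
    ∃ h : ℂ → ℂ, (∀ w : ℂ, |w.im| < Q b / 2 → DifferentiableAt ℂ h w) ∧
      (∀ x : ℝ, ‖h x‖ = 1) ∧ (∀ x : ℝ, h (x + I * b) = multE b 0 x * h x) ∧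
      ∃ a C : ℝ, ∀ w : ℂ, 0 ≤ w.im → w.im ≤ b → ‖h w‖ ≤ C * Real.exp (a * |w.re|) := by
  obtain ⟨κ, hκ⟩ := exists_exp_logSine_sub hb0 hb1
  obtain ⟨A, B, hAB⟩ := exists_abs_im_logSine_le hb0 hb1
  have hsin := sin_pi_sq_pos hb0 hb1
  -- The linear term multiplies the shifted value by e^{-cb}; this c turns the constant e^κ into
  -- 1/sin(πb²).
  set c : ℝ := (Real.log (Real.sin (Real.pi * b ^ 2)) + κ) / b with hc
  refine ⟨fun w => exp (I * (logSine b w + c * w)), fun w hw => ?_, fun x => ?_, fun x => ?_,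
    A, Real.exp (B + |c| * b), fun w h0 h1 => ?_⟩
  · exact (((differentiableAt_logSine hb0 hw).add (by fun_prop)).const_mul I).cexp
  · rw [Complex.norm_exp, Complex.I_mul_re, Complex.add_im, im_logSine_ofReal hb0,
      ← Complex.ofReal_mul, Complex.ofReal_im]
    simp
  · have h1 := hκ (x + I * (b / 2)) (by
      have : ((x : ℂ) + I * (b / 2)).im = b / 2 := by
        rw [← Complex.ofReal_ofNat, ← Complex.ofReal_div]; simp
      rw [this, abs_of_pos (by positivity)]
      have : 1 < b⁻¹ := (one_lt_inv₀ hb0).2 hb1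
      linarith)
    rw [add_sub_cancel_right, add_assoc, show I * (b / 2) + I * (b / 2) = I * (b : ℂ) by ring] at h1
    have h2 : multE b 0 x = (Real.sin (Real.pi * b ^ 2))⁻¹ *
        cosh (Real.pi * b * (x + I * (b / 2))) := by
      rw [multE, div_eq_inv_mul]
      push_cast
      congr 2
      ring
    have h3 : Real.exp κ * Real.exp (-(c * b)) = (Real.sin (Real.pi * b ^ 2))⁻¹ := by
      rw [← Real.exp_add, hc, div_mul_cancel₀ _ hb0.ne', show
        κ + -(Real.log (Real.sin (Real.pi * b ^ 2)) + κ) =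
          -Real.log (Real.sin (Real.pi * b ^ 2)) by ring, Real.exp_neg, Real.exp_log hsin]
    beta_reduce
    rw [h2, ← h3, Complex.ofReal_mul, mul_right_comm (Real.exp κ : ℂ), ← h1,
      Complex.ofReal_exp, ← Complex.exp_add, ← Complex.exp_add]
    congr 1
    push_cast
    linear_combination (c * b : ℂ) * I_mul_I
  · have h2 := hAB w.re w.im h0 h1
    rw [mul_comm I, Complex.re_add_im] at h2
    rw [Complex.norm_exp, Complex.I_mul_re, Complex.add_im, Complex.im_ofReal_mul,
      ← Real.exp_add, Real.exp_le_exp]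
    have h3 : |c * w.im| ≤ |c| * b := by
      rw [abs_mul, abs_of_nonneg h0]; gcongr
    linarith [neg_abs_le (logSine b w).im, neg_abs_le (c * w.im)]

/-! ### Unitary groups and Weyl relations -/

theorem ofReal_exp_cpow_I_mul (y t : ℝ) :
    ((|Real.exp y| : ℝ) : ℂ) ^ (I * (t : ℂ)) = exp (t * y * I) := by
  rw [abs_of_pos (Real.exp_pos y), Complex.cpow_def_of_ne_zero
    (Complex.ofReal_ne_zero.2 (Real.exp_pos y).ne'), ← Complex.ofReal_log (Real.exp_pos y).le,
    Real.log_exp]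
  congr 1
  ring

theorem conjBy_smul (V : L2R ≃ₗᵢ[ℂ] L2R) (c : ℂ) (T : L2R →L[ℂ] L2R) :
    conjBy V (c • T) = c • conjBy V T := by
  ext1 u
  simp [conjBy_apply]

/-- The unitary operator `V⁻¹ e^{2 π i r x} V`. -/
def unitaryCharacter (V : L2R ≃ₗᵢ[ℂ] L2R) (r : ℝ) : unitary (L2R →L[ℂ] L2R) :=
  Unitary.linearIsometryEquiv.symm ((V.trans (mulIsometryEquiv (character r)
    (continuous_character r).measurable (norm_character r))).trans V.symm)

theorem coe_unitaryCharacter (V : L2R ≃ₗᵢ[ℂ] L2R) (r : ℝ) :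
    (unitaryCharacter V r : L2R →L[ℂ] L2R) = conjBy V (mulCLM (character r)) := rfl

/-- The Fourier multiplier with symbol `φ`. -/
def fourierMul (φ : ℝ → ℂ) (h : Measurable φ) (h1 : ∀ x, ‖φ x‖ = 1) : L2R ≃ₗᵢ[ℂ] L2R :=
  (fourierL2.trans (mulIsometryEquiv φ h h1)).trans fourierL2.symm

section FourierMul

variable (φ : ℝ → ℂ) (h : Measurable φ) (h1 : ∀ x, ‖φ x‖ = 1)

theorem fourierMul_apply (u : L2R) :
    fourierMul φ h h1 u = fourierL2.symm (mulCLM φ (fourierL2 u)) := rfl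

theorem fourierMul_symm_apply (u : L2R) :
    (fourierMul φ h h1).symm u =
      fourierL2.symm (mulCLM (fun x => (starRingEnd ℂ) (φ x)) (fourierL2 u)) := rfl

/-- Two Fourier multipliers commute, so conjugation by a unimodular one leaves translations
unchanged. -/
theorem conjBy_fourierMul_translation (r : ℝ) :
    conjBy (fourierMul φ h h1) (conjBy fourierL2 (mulCLM (character r))) =
      conjBy fourierL2 (mulCLM (character r)) := by
  have hφ := isContraction_of_norm_eq_one h h1
  have hr := isContraction_character r
  ext1 u
  simp only [conjBy_apply, fourierMul_apply, fourierMul_symm_apply,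
    LinearIsometryEquiv.apply_symm_apply]
  congr 1
  change (mulCLM _ * (mulCLM _ * mulCLM _)) _ = _
  rw [mulCLM_mul hr hφ, mulCLM_mul hφ.star (hr.mul hφ)]
  congr 2
  funext x
  rw [mul_left_comm, ← Complex.normSq_eq_conj_mul_self, Complex.normSq_eq_norm_sq, h1]
  simp

/-- Translations being fixed by the conjugation, both operators are conjugates under the same
unitary, and the relation is inherited from translation and modulation. -/
theorem unitaryCharacter_mul (r c : ℝ) :
    ((unitaryCharacter fourierL2 r * unitaryCharacter (fourierMul φ h h1) c :
      unitary (L2R →L[ℂ] L2R)) : L2R →L[ℂ] L2R) =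
      exp (2 * Real.pi * r * c * I) •
        ((unitaryCharacter (fourierMul φ h h1) c * unitaryCharacter fourierL2 r :
          unitary (L2R →L[ℂ] L2R)) : L2R →L[ℂ] L2R) := by
  rw [Submonoid.coe_mul, Submonoid.coe_mul, coe_unitaryCharacter, coe_unitaryCharacter,
    ← conjBy_fourierMul_translation φ h h1, conjBy_mul, conjBy_mul, ← conjBy_smul,
    translation_mul_modulation]

end FourierMul

/-- The argument πb² of `q b` lies in (0, π), so the principal branch gives the intended power. -/
theorem q_cpow {b : ℝ} (hb0 : 0 < b) (hb1 : b < 1) (r : ℝ) :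
    q b ^ (r : ℂ) = exp (Real.pi * b ^ 2 * r * I) := by
  have h1 : b ^ 2 < 1 := by nlinarith
  have h2 : 0 < b ^ 2 := by positivity
  have h3 : (Real.pi * I * (b : ℂ) ^ 2) = ((Real.pi * b ^ 2 : ℝ) : ℂ) * I := by push_cast; ring
  have hpi := Real.pi_pos
  rw [Complex.cpow_def_of_ne_zero (q_ne_zero b), q, h3, Complex.log_exp]
  · push_cast; congr 1; ring
  · rw [Complex.im_ofReal_mul, Complex.I_im, mul_one]; nlinarith
  · rw [Complex.im_ofReal_mul, Complex.I_im, mul_one]; nlinarith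

theorem isImaginaryPowers_exp (V : L2R ≃ₗᵢ[ℂ] L2R) (k : ℝ) {a : ℝ → ℝ} (ha : Measurable a)
    (h : ∀ x, |a x| = Real.exp (2 * Real.pi * k * x)) :
    (spectralMeasure V a ha).IsImaginaryPowers
      fun t => (unitaryCharacter V (k * t) : L2R →L[ℂ] L2R) := by
  refine isImaginaryPowers_mulPMap V ha _ (fun t => character (k * t))
    (fun t => isContraction_character _) (fun t x => ?_) (fun t => coe_unitaryCharacter V _)
  have h2 := ofReal_exp_cpow_I_mul (2 * Real.pi * k * x) t
  rw [abs_of_pos (Real.exp_pos _)] at h2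
  rw [h, h2, character]
  congr 1
  push_cast
  ring

theorem proj_congr (V : L2R ≃ₗᵢ[ℂ] L2R) {a : ℝ → ℝ} (ha : Measurable a) {s t : Set ℝ}
    (h : a ⁻¹' s = a ⁻¹' t) :
    (spectralMeasure V a ha).proj s = (spectralMeasure V a ha).proj t := by
  change conjBy V _ = conjBy V _
  rw [h]

/-- Every spectral projection of a scalar operator is 0 or 1. -/
theorem stronglyCommutes_const (V : L2R ≃ₗᵢ[ℂ] L2R) (c : ℝ) (P : SpectralMeasure L2R) :
    (spectralMeasure V (fun _ => c) measurable_const).StronglyCommutes P := by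
  intro s t _ _
  by_cases hs : c ∈ s
  · rw [proj_congr V measurable_const (t := Set.univ) (by ext; simp [hs]),
      SpectralMeasure.proj_univ]
    exact Commute.one_left _
  · have h0 : (spectralMeasure V (fun _ => c) measurable_const).proj ∅ = 0 := by
      ext1 u; exact SpectralMeasure.proj_empty _ u
    rw [proj_congr V measurable_const (t := ∅) (by ext; simp [hs]), h0]
    exact Commute.zero_left _

/-! ### The self-adjoint extensions -/

theorem extends_mulPMap {b : ℝ} {α : ℂ} {V : L2R ≃ₗᵢ[ℂ] L2R} {a : ℝ → ℝ}
    {T : (ℂ → ℂ) →ₗ[ℂ] (ℂ → ℂ)} (hT : ∀ f ∈ space b α, T f ∈ space b α)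
    (h : ∀ f ∈ space b α, ∀ u w : L2R, Represents u f → Represents w (T f) →
      V w =ᵐ[volume] fun x => (a x : ℂ) * V u x) : Extends b α (mulPMap V a) T := by
  intro f hf
  have h1 : Represents (MemLp.toLp _ hf.2.2.1) f := MemLp.coeFn_toLp _
  have h2 : Represents (MemLp.toLp _ (hT f hf).2.2.1) (T f) := MemLp.coeFn_toLp _
  obtain ⟨hm, hw⟩ := exists_mulPMap_eq V (h f hf _ _ h1 h2)
  exact ⟨⟨_, hm⟩, h1, by rw [hw]; exact h2⟩

theorem fourierMul_ae_eq {φ : ℝ → ℂ} (h : Measurable φ) (h1 : ∀ x, ‖φ x‖ = 1) {u : L2R}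
    {G : ℝ → ℂ} (hu : fourierL2 u =ᵐ[volume] G) (hG : Integrable fun x => φ x * G x) :
    fourierMul φ h h1 u =ᵐ[volume] 𝓕⁻ fun x => φ x * G x := by
  rw [fourierMul_apply]
  refine fourierL2_symm_ae_eq ?_ hG
  filter_upwards [coeFn_mulCLM (isContraction_of_norm_eq_one h h1) (fourierL2 u), hu] with x h2 h3
  rw [h2, h3]

/-- Conjugation by the Fourier multiplier `g` turns `G ↦ k (g⁻¹ (gG)(· + i η))` on the Fourier side
into the multiplication by `k e^{2 π η x}`. -/
theorem fourierMul_intertwines {c d η k : ℝ} (hc : c ≤ 0) (hd : 0 ≤ d) (hcη : c ≤ η)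
    (hηd : η ≤ d) {g G : ℂ → ℂ} {G' : ℝ → ℂ} (hG : StripDecay c d G)
    (hg : ∀ w : ℂ, c ≤ w.im → w.im ≤ d → DifferentiableAt ℂ g w)
    (hg' : ∃ a C : ℝ, ∀ w : ℂ, c ≤ w.im → w.im ≤ d → ‖g w‖ ≤ C * Real.exp (a * |w.re|))
    (hm : Measurable fun x : ℝ => g x) (h1 : ∀ x : ℝ, ‖g x‖ = 1)
    (hG' : ∀ x : ℝ, k * (g (x + I * η) * G (x + I * η)) = g x * G' x) {u w : L2R}
    (hu : fourierL2 u =ᵐ[volume] fun x : ℝ => G x) (hw : fourierL2 w =ᵐ[volume] G') :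
    fourierMul (fun x : ℝ => g x) hm h1 w =ᵐ[volume] fun x =>
      ((k * Real.exp (2 * Real.pi * η * x) : ℝ) : ℂ) * fourierMul (fun x : ℝ => g x) hm h1 u x := by
  have hgG := hG.mul hg hg'
  have e1 := fourierMul_ae_eq hm h1 hu (hgG.integrable hc hd)
  have e2 := fourierMul_ae_eq hm h1 hw (by
    simp_rw [← hG', mul_comm I (η : ℂ)]
    exact (hgG.integrable_line hcη hηd).const_mul _)
  filter_upwards [e1, e2] with x h2 h3
  have h4 := invF_add_real_shift hgG hc hd hcη hηd x
  rw [h2, h3, ← invF_ofReal (fun w => g w * G w)]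
  simp_rw [← hG']
  rw [← invF_ofReal (fun w => k * (g (w + I * η) * G (w + I * η))), invF_const_mul, ← h4]
  push_cast
  ring

theorem fourierL2_ae_eq_of_represents {b : ℝ} {α : ℂ} {f : ℂ → ℂ} (hf : f ∈ space b α) {u : L2R}
    (hu : Represents u f) : fourierL2 u =ᵐ[volume] 𝓕 fun x : ℝ => f x :=
  fourierL2_ae_eq hu hf.2.1

theorem opE_mem {b : ℝ} (hb0 : 0 < b) (hb1 : b < 1) {α : ℂ} (hα : α.re = Q b / 2) {f : ℂ → ℂ}
    (hf : f ∈ space b α) : opE b α f ∈ space b α := by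
  obtain ⟨G, hG, rfl, -⟩ := eq_invF_of_mem_space hb0 hα hf
  exact opE_invF_mem hb0 hb1 hα hG

theorem opF_mem {b : ℝ} (hb0 : 0 < b) (hb1 : b < 1) {α : ℂ} (hα : α.re = Q b / 2) {f : ℂ → ℂ}
    (hf : f ∈ space b α) : opF b α f ∈ space b α := by
  obtain ⟨G, hG, rfl, -⟩ := eq_invF_of_mem_space hb0 hα hf
  exact opF_invF_mem hb0 hb1 hα hG

theorem opK_mem {b : ℝ} (hb0 : 0 < b) {α : ℂ} (hα : α.re = Q b / 2) {f : ℂ → ℂ}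
    (hf : f ∈ space b α) : opK b f ∈ space b α := by
  obtain ⟨G, hG, rfl, -⟩ := eq_invF_of_mem_space hb0 hα hf
  exact opK_invF_mem hb0 hα hG

theorem opKinv_mem {b : ℝ} (hb0 : 0 < b) {α : ℂ} (hα : α.re = Q b / 2) {f : ℂ → ℂ}
    (hf : f ∈ space b α) : opKinv b f ∈ space b α := by
  obtain ⟨G, hG, rfl, -⟩ := eq_invF_of_mem_space hb0 hα hf
  exact opKinv_invF_mem hb0 hα hG

theorem extends_opC {b : ℝ} (hb0 : 0 < b) (hb1 : b < 1) {α : ℂ} (hα : α.re = Q b / 2) :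
    Extends b α (mulPMap (LinearIsometryEquiv.refl ℂ L2R) fun _ => casimir b α) (opC b α) := by
  refine extends_mulPMap (fun f hf => ?_) fun f _ u w hu hw => ?_
  · rw [opC_eq hb0 hb1 hα]; exact (space b α).smul_mem _ hf
  · rw [Represents, opC_eq hb0 hb1 hα] at hw
    filter_upwards [hu, hw] with x h1 h2
    simp only [LinearIsometryEquiv.coe_refl, id_eq]
    rw [h1, h2]
    rfl

theorem extends_opK {b : ℝ} (hb0 : 0 < b) {α : ℂ} (hα : α.re = Q b / 2) :
    Extends b α (mulPMap fourierL2 fun x => Real.exp (-(Real.pi * b * x))) (opK b) := by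
  refine extends_mulPMap (fun f hf => opK_mem hb0 hα hf) fun f hf u w hu hw => ?_
  have e2 := fourierL2_ae_eq_of_represents (opK_mem hb0 hα hf) hw
  have e1 := fourierL2_ae_eq_of_represents hf hu
  obtain ⟨G, hG, rfl, hfG⟩ := eq_invF_of_mem_space hb0 hα hf
  have hQ : 0 < Q b / 4 := by linarith [Q_pos hb0]
  have hS := (hG.stripDecay hb0 hα (r := Q b / 4) (by linarith)).exp_mul (-(Real.pi * b))
  filter_upwards [e1, e2] with x h1 h2
  rw [h1, h2, opK_invF, fourier_invF hQ hS, hfG]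
  push_cast
  congr 2
  ring

theorem StripDecay.multE_mul {c d : ℝ} {H : ℂ → ℂ} (h : StripDecay c d H) (b p : ℝ) :
    StripDecay c d fun w => multE b p w * H w := by
  obtain ⟨a, C, hC⟩ := growth_multE b p (max |c| |d|)
  exact h.mul (fun w _ _ => differentiable_multE b p w)
    ⟨a, C, fun w h1 h2 => hC w (abs_le_max_abs_abs h1 h2)⟩

/-- The Fourier transform of `opE b α f`. -/
theorem fourier_opE {b : ℝ} (hb0 : 0 < b) (hb1 : b < 1) {α : ℂ} (hα : α.re = Q b / 2)
    {G : ℂ → ℂ} (hG : IsTransform b α G) (x : ℝ) :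
    𝓕 (fun x : ℝ => opE b α (invF G) x) x = multE b α.im x * G (x + I * b) := by
  have hQ := lt_Q_half hb0 hb1
  -- A radius halfway between b and Q/2 leaves, after the shift by b, a strip of positive width on
  -- both sides of the real line.
  have hS := hG.stripDecay hb0 hα (r := (b + Q b / 2) / 2) (by linarith)
  rw [opE_invF hb0 hb1 hα hG]
  exact fourier_invF (r := (Q b / 2 - b) / 2) (by linarith)
    (((hS.comp_add b).mono (by linarith) (by linarith)).multE_mul b α.im) x

theorem fourier_opF {b : ℝ} (hb0 : 0 < b) (hb1 : b < 1) {α : ℂ} (hα : α.re = Q b / 2)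
    {G : ℂ → ℂ} (hG : IsTransform b α G) (x : ℝ) :
    𝓕 (fun x : ℝ => opF b α (invF G) x) x =
      -(multE b α.im (-x) * G (x + I * (-b : ℝ))) := by
  have hQ := lt_Q_half hb0 hb1
  have hS := hG.stripDecay hb0 hα (r := (b + Q b / 2) / 2) (by linarith)
  rw [opF_invF hb0 hb1 hα hG]
  refine fourier_invF (r := (Q b / 2 - b) / 2)
    (H := fun w => -(multE b α.im (-w) * G (w + I * (-b : ℝ)))) (by linarith) ?_ x
  obtain ⟨a, C, hC⟩ := growth_multE b α.im ((Q b / 2 - b) / 2)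
  simp_rw [← neg_mul]
  refine ((hS.comp_add (-b)).mono (by linarith) (by linarith)).mul
    (fun w _ _ => (((differentiable_multE b α.im).comp differentiable_neg).neg) w)
    ⟨a, C, fun w h1 h2 => ?_⟩
  rw [norm_neg]
  simpa using hC (-w) (by rw [Complex.neg_im, abs_neg]; exact abs_le.2 ⟨h1, h2⟩)

theorem multE_sub (b p : ℝ) (w : ℂ) : multE b 0 (w - p) = multE b p w := by
  simp [multE]

/-- The solution for p = 0 is translated by the real number p, which changes neither imaginary parts
nor moduli on the line. -/
theorem exists_unimodular_multiplier {b : ℝ} (hb0 : 0 < b) (hb1 : b < 1) (p : ℝ) :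
    ∃ g : ℂ → ℂ, (∀ w : ℂ, 0 ≤ w.im → w.im ≤ b → DifferentiableAt ℂ g w) ∧
      (∀ x : ℝ, ‖g x‖ = 1) ∧ (∀ x : ℝ, g (x + I * b) = multE b p x * g x) ∧
      ∃ a C : ℝ, ∀ w : ℂ, 0 ≤ w.im → w.im ≤ b → ‖g w‖ ≤ C * Real.exp (a * |w.re|) := by
  obtain ⟨h, hh, h1, hE, A, C, hAC⟩ := exists_unimodular_solution hb0 hb1
  have hQ := lt_Q_half hb0 hb1
  have him (w : ℂ) : (w - p).im = w.im := by simp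
  refine ⟨fun w => h (w - p), fun w h0 h2 => ?_, fun x => ?_, fun x => ?_, |A|,
    |C| * Real.exp (|A| * |p|), fun w h0 h2 => ?_⟩
  · have : DifferentiableAt ℂ h (w - p) := hh _ (by rw [him, abs_of_nonneg h0]; linarith)
    exact DifferentiableAt.comp w this (differentiableAt_id.sub_const _)
  · beta_reduce; rw [← Complex.ofReal_sub]; exact h1 _
  · have := hE (x - p)
    push_cast at this
    rw [show (x : ℂ) - p + I * b = x + I * b - p by ring, multE_sub] at this
    exact this
  · refine (hAC (w - p) (by rwa [him]) (by rwa [him])).trans ?_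
    rw [mul_assoc, ← Real.exp_add, ← mul_add]
    have h3 : |(w - p).re| ≤ |p| + |w.re| := by
      rw [Complex.sub_re, Complex.ofReal_re, add_comm]; exact abs_sub _ _
    have h4 : A * |(w - p).re| ≤ |A| * (|p| + |w.re|) :=
      mul_le_mul (le_abs_self A) h3 (abs_nonneg _) (abs_nonneg _)
    exact mul_le_mul (le_abs_self C) (Real.exp_le_exp.2 h4) (Real.exp_pos _).le (abs_nonneg _)

/-- An extension of `opE b α` is unitarily equivalent to the multiplication by `e^{2 π b x}`. -/
theorem exists_extends_opE {b : ℝ} (hb0 : 0 < b) (hb1 : b < 1) {α : ℂ} (hα : α.re = Q b / 2) :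
    ∃ (φ : ℝ → ℂ) (h : Measurable φ) (h1 : ∀ x, ‖φ x‖ = 1),
      Extends b α (mulPMap (fourierMul φ h h1) fun x => Real.exp (2 * Real.pi * b * x))
        (opE b α) := by
  obtain ⟨g, hg, h1, gE, hg'⟩ := exists_unimodular_multiplier hb0 hb1 α.im
  have hc : Continuous fun x : ℝ => g x := continuous_iff_continuousAt.2 fun x =>
    (hg x (by simp) (by simpa using hb0.le)).continuousAt.comp
      Complex.continuous_ofReal.continuousAt
  refine ⟨fun x : ℝ => g x, hc.measurable, h1, ?_⟩
  refine extends_mulPMap (fun f hf => opE_mem hb0 hb1 hα hf) fun f hf u w hu hw => ?_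
  have e2 := fourierL2_ae_eq_of_represents (opE_mem hb0 hb1 hα hf) hw
  have e1 := fourierL2_ae_eq_of_represents hf hu
  obtain ⟨G, hG, rfl, hfG⟩ := eq_invF_of_mem_space hb0 hα hf
  have hS := (hG.stripDecay hb0 hα (lt_Q_half hb0 hb1)).mono (c' := 0) (d' := b)
    (by linarith) le_rfl
  have := fourierMul_intertwines (k := 1) le_rfl hb0.le hb0.le le_rfl hS hg hg' hc.measurable h1
    (G' := fun x => multE b α.im x * G (x + I * b))
    (fun x => by rw [gE]; push_cast; ring) (e1.trans (Filter.Eventually.of_forall hfG))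
    (e2.trans (Filter.Eventually.of_forall (fourier_opE hb0 hb1 hα hG)))
  simpa only [one_mul] using this

/-- An extension of `opF b α` is unitarily equivalent to the multiplication by `-e^{-2 π b x}`. -/
theorem exists_extends_opF {b : ℝ} (hb0 : 0 < b) (hb1 : b < 1) {α : ℂ} (hα : α.re = Q b / 2) :
    ∃ (φ : ℝ → ℂ) (h : Measurable φ) (h1 : ∀ x, ‖φ x‖ = 1),
      Extends b α (mulPMap (fourierMul φ h h1) fun x => -Real.exp (2 * Real.pi * -b * x))
        (opF b α) := by
  obtain ⟨g, hg, h1, gE, A, C, hg'⟩ := exists_unimodular_multiplier hb0 hb1 α.im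
  -- The symbol for F is the reflection of the one for E, so its multiplier is g(-w), controlled on
  -- the reflected strip where the shift by -ib takes place.
  have hn : ∀ w : ℂ, -b ≤ w.im → w.im ≤ 0 → DifferentiableAt ℂ (fun w => g (-w)) w := by
    intro w h2 h3
    exact DifferentiableAt.comp w
      (hg (-w) (by rw [Complex.neg_im]; linarith) (by rw [Complex.neg_im]; linarith))
      differentiable_neg.differentiableAt
  have hc : Continuous fun x : ℝ => g (-x) := continuous_iff_continuousAt.2 fun x =>
    (hn x (by simpa using hb0.le) (by simp)).continuousAt.comp
      Complex.continuous_ofReal.continuousAt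
  have h1' : ∀ x : ℝ, ‖g (-x)‖ = 1 := fun x => by rw [← Complex.ofReal_neg]; exact h1 _
  refine ⟨fun x : ℝ => g (-x), hc.measurable, h1', ?_⟩
  refine extends_mulPMap (fun f hf => opF_mem hb0 hb1 hα hf) fun f hf u w hu hw => ?_
  have e2 := fourierL2_ae_eq_of_represents (opF_mem hb0 hb1 hα hf) hw
  have e1 := fourierL2_ae_eq_of_represents hf hu
  obtain ⟨G, hG, rfl, hfG⟩ := eq_invF_of_mem_space hb0 hα hf
  have hS := (hG.stripDecay hb0 hα (lt_Q_half hb0 hb1)).mono (c' := -b) (d' := 0)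
    le_rfl hb0.le
  have := fourierMul_intertwines (g := fun w => g (-w)) (k := -1) (η := -b) (by linarith) le_rfl
    le_rfl (by linarith) hS hn ⟨A, C, fun w h2 h3 => by
      simpa using hg' (-w) (by rw [Complex.neg_im]; linarith) (by rw [Complex.neg_im]; linarith)⟩
    hc.measurable h1'
    (G' := fun x => -(multE b α.im (-x) * G (x + I * (-b : ℝ))))
    (fun x => by
      have := gE (-x)
      push_cast at this ⊢
      rw [show -((x : ℂ) + I * -b) = -x + I * b by ring, this]
      ring)
    (e1.trans (Filter.Eventually.of_forall hfG))
    (e2.trans (Filter.Eventually.of_forall (fourier_opF hb0 hb1 hα hG)))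
  simpa only [neg_one_mul] using this

end QuantumSL2

end

/-! ### The main theorem -/

theorem mainTheorem11 (b : ℝ) (hb0 : 0 < b) (hb1 : b < 1) (hb : Irrational b)
    (α : ℂ) (hα : α.re = Q b / 2) :
    -- the operators act on the dense subspace `𝒫_α` of `L²(ℝ)`
    Dense {u : L2R | ∃ f ∈ space b α, Represents u f} ∧
    (∀ f ∈ space b α,
      opE b α f ∈ space b α ∧
      opF b α f ∈ space b α ∧
      opK b f ∈ space b α ∧
      opKinv b f ∈ space b α) ∧
    -- and satisfy the defining relations there
    (∀ f ∈ space b α,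
      opK b (opKinv b f) = f ∧
      opKinv b (opK b f) = f ∧
      opK b (opE b α f) =
        q b • opE b α (opK b f) ∧
      opK b (opF b α f) =
        (q b)⁻¹ • opF b α (opK b f) ∧
      opE b α (opF b α f) - opF b α (opE b α f) =
        -((q b - (q b)⁻¹)⁻¹ •
          (opK b (opK b f) -
            opKinv b (opKinv b f)))) ∧
    -- integrability
    ∃ E F K C : L2R →ₗ.[ℂ] L2R,
      (IsSelfAdjoint E ∧ IsSelfAdjoint F ∧ IsSelfAdjoint K ∧ IsSelfAdjoint C) ∧
      (Extends b α E (opE b α) ∧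
        Extends b α F (opF b α) ∧
        Extends b α K (opK b) ∧
        Extends b α C (opC b α)) ∧
      ((∀ u : E.domain, u ≠ 0 → 0 < (inner ℂ (u : L2R) (E u)).re) ∧
        (∀ u : F.domain, u ≠ 0 → (inner ℂ (u : L2R) (F u)).re < 0) ∧
        (∀ u : K.domain, u ≠ 0 → 0 < (inner ℂ (u : L2R) (K u)).re)) ∧
      ∃ PE PF PK PC : SpectralMeasure L2R,
        (PE.IsSpectralMeasureOf E ∧ PF.IsSpectralMeasureOf F ∧
          PK.IsSpectralMeasureOf K ∧ PC.IsSpectralMeasureOf C) ∧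
        (∃ UE UF UK : ℝ → unitary (L2R →L[ℂ] L2R),
          PE.IsImaginaryPowers (fun t => (UE t : L2R →L[ℂ] L2R)) ∧
          PF.IsImaginaryPowers (fun t => (UF t : L2R →L[ℂ] L2R)) ∧
          PK.IsImaginaryPowers (fun t => (UK t : L2R →L[ℂ] L2R)) ∧
          (∀ s t : ℝ,
            ((UK s * UE t : unitary (L2R →L[ℂ] L2R)) :
                L2R →L[ℂ] L2R) =
              q b ^ ((-(t * s) : ℝ) : ℂ) •
                ((UE t * UK s : unitary (L2R →L[ℂ] L2R)) :
                  L2R →L[ℂ] L2R)) ∧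
          (∀ s t : ℝ,
            ((UK s * UF t : unitary (L2R →L[ℂ] L2R)) :
                L2R →L[ℂ] L2R) =
              q b ^ ((t * s : ℝ) : ℂ) •
                ((UF t * UK s : unitary (L2R →L[ℂ] L2R)) :
                  L2R →L[ℂ] L2R))) ∧
        (PC.StronglyCommutes PE ∧ PC.StronglyCommutes PF ∧ PC.StronglyCommutes PK) := by
  obtain ⟨φ, hφ, hφ1, hE⟩ := exists_extends_opE hb0 hb1 hα
  obtain ⟨ψ, hψ, hψ1, hF⟩ := exists_extends_opF hb0 hb1 hα
  have mE : Measurable fun x : ℝ => Real.exp (2 * Real.pi * b * x) := by fun_prop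
  have mF : Measurable fun x : ℝ => -Real.exp (2 * Real.pi * -b * x) := by fun_prop
  have mK : Measurable fun x : ℝ => Real.exp (-(Real.pi * b * x)) := by fun_prop
  refine ⟨dense_space hb0 hα, fun f hf => ⟨opE_mem hb0 hb1 hα hf, opF_mem hb0 hb1 hα hf,
    opK_mem hb0 hα hf, opKinv_mem hb0 hα hf⟩, fun f _ => ⟨opK_opKinv b f, opKinv_opK b f,
    opK_opE b α f, opK_opF b α f, opE_opF_sub_opF_opE hb0 hb1 α f⟩, ?_⟩
  refine ⟨_, _, _, _, ⟨isSelfAdjoint_mulPMap _ mE, isSelfAdjoint_mulPMap _ mF,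
    isSelfAdjoint_mulPMap _ mK, isSelfAdjoint_mulPMap _ measurable_const⟩,
    ⟨hE, hF, extends_opK hb0 hα, extends_opC hb0 hb1 hα⟩,
    ⟨re_inner_mulPMap_pos _ fun x => Real.exp_pos _,
      re_inner_mulPMap_neg _ fun x => neg_lt_zero.2 (Real.exp_pos _),
      re_inner_mulPMap_pos _ fun x => Real.exp_pos _⟩,
    spectralMeasure _ _ mE, spectralMeasure _ _ mF, spectralMeasure _ _ mK,
    spectralMeasure _ _ measurable_const,
    ⟨isSpectralMeasureOf_mulPMap _ mE, isSpectralMeasureOf_mulPMap _ mF,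
      isSpectralMeasureOf_mulPMap _ mK, isSpectralMeasureOf_mulPMap _ measurable_const⟩, ?_,
    stronglyCommutes_const _ _ _, stronglyCommutes_const _ _ _, stronglyCommutes_const _ _ _⟩
  -- The symbols are e^{2πkx} in modulus, with k = b, -b, -b/2. The Weyl phase e^{2πirc} at r =
  -- -bs/2, c = ±bt is then q^{∓ts}.
  refine ⟨fun t => unitaryCharacter (fourierMul φ hφ hφ1) (b * t),
    fun t => unitaryCharacter (fourierMul ψ hψ hψ1) (-b * t),
    fun t => unitaryCharacter fourierL2 (-(b / 2) * t),
    isImaginaryPowers_exp _ b mE fun x => abs_of_pos (Real.exp_pos _),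
    isImaginaryPowers_exp _ (-b) mF fun x => by rw [abs_neg, abs_of_pos (Real.exp_pos _)],
    isImaginaryPowers_exp _ (-(b / 2)) mK fun x => by
      rw [abs_of_pos (Real.exp_pos _)]; congr 1; ring, fun s t => ?_, fun s t => ?_⟩
  all_goals
    rw [unitaryCharacter_mul, q_cpow hb0 hb1]
    congr 2
    push_cast
    ring
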